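/- Throughout, surfaces are compact and connected, and their boundary is a finite disjoint union of circles. For a surface $S$, let $\chi(S)$ be its Euler characteristic, $\beta(S)$ the number of connected components of its boundary, and $\overline{S}$ the closed surface obtained from $S$ by gluing a disc along each boundary component. A map on a surface is a decomposition of it into finitely many vertices ($0$-cells), edges ($1$-cells) and faces ($2$-cells). The degree of a vertex is the number of edge-ends at it, the degree of a face is the number of edge-sides along it, and a leaf is a vertex of degree $1$. A map is triangular if every face has degree $3$ (loops and multiple edges are allowed). A rooted map is a map with a distinguished end and a distinguished side of one of its edges, the root-edge; the vertex at the distinguished end is the root-vertex. Rooted maps are considered up to cell-preserving homeomorphisms that preserve the root. A rooted map is boundary-rooted if its root-edge lies on the boundary of the surface, and leaf-rooted if its root-vertex is a leaf. A cubic scheme of a surface $S$ with boundary is a leaf-rooted map on $\overline{S}$ with $\beta(S)$ faces in which every vertex other than the root-vertex has degree $3$. **Theorem.** Let $S$ be a surface with (non-empty) boundary, other than the disc. Let $a(S)$ be the number of cubic schemes of $S$ and, for $n \in \mathbb{N}$, let $M_S(n)$ be the number of boundary-rooted triangular maps on $S$ with $n$ vertices, all of them lying on the boundary of $S$. These numbers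 are finite, and, as $n \to \infty$, $$M_S(n) = \frac{a(S)}{4\,\Gamma\left(1-\tfrac{3\chi(S)}{2}\right)}\; n^{-3\chi(S)/2}\; 4^n \left(1+O\left(n^{-1/2}\right)\right),$$ where $\Gamma$ is the usual Gamma function and the constant implied by $O$ may depend on $S$. -/

import Mathlib

open Filter Asymptotics

/-- A closed (compact, connected, boundaryless) surface up to homeomorphism: the sphere with
`g ≥ 0` handles, or the sphere with `k ≥ 1` cross-caps. -/
inductive ClosedSurface : Type
  | handles (g : ℕ) : ClosedSurface
  | crosscaps (k : ℕ+) : ClosedSurface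

/-- A compact connected surface up to homeomorphism: a closed surface from which `β` disjoint
open discs have been removed. -/
structure Surface : Type where
  /-- the closed surface obtained by gluing a disc on each boundary circle -/
  capped : ClosedSurface
  /-- the number of boundary circles -/
  β : ℕ

namespace ClosedSurface

/-- Euler characteristic: `2 - 2g` with `g` handles, `2 - k` with `k` cross-caps. -/
def eulerChar : ClosedSurface → ℤ
  | handles g => 2 - 2 * (g : ℤ)
  | crosscaps k => 2 - ((k : ℕ) : ℤ)

/-- The surfaces made with handles are the orientable ones. -/
def IsOrientable : ClosedSurface → Prop
  | handles _ => True
  | crosscaps _ => False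

end ClosedSurface

namespace Surface

/-- Removing a disc lowers the Euler characteristic by one. -/
def eulerChar (S : Surface) : ℤ := S.capped.eulerChar - (S.β : ℤ)

/-- Orientability. -/
def IsOrientable (S : Surface) : Prop := S.capped.IsOrientable

/-- The surface without boundary obtained by gluing a disc along every boundary circle. -/
def closure (S : Surface) : Surface := ⟨S.capped, 0⟩

/-- The disc: the sphere minus one disc. -/
def disc : Surface := ⟨ClosedSurface.handles 0, 1⟩

end Surface

/-- A cell decomposition (with at least one edge) of a surface, possibly with boundary, up to
cell-preserving homeomorphism, as a combinatorial map. A flag is a pair made of an end and a side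
of the same edge; so an inner edge has four flags and a boundary edge, which has a single side,
has two.
* `endFlip` exchanges the two ends of the edge and keeps the side;
* `sideFlip` keeps the end and goes to the other side of the edge; it fixes exactly the flags of
  the edges that lie on the boundary of the surface;
* `cornerFlip` goes to the other flag that bounds the same corner (of a face, at a vertex). -/
structure CombMap (F : Type*) where
  endFlip : Equiv.Perm F
  cornerFlip : Equiv.Perm F
  sideFlip : Equiv.Perm F
  endFlip_endFlip : ∀ x, endFlip (endFlip x) = x
  cornerFlip_cornerFlip : ∀ x, cornerFlip (cornerFlip x) = x
  sideFlip_sideFlip : ∀ x, sideFlip (sideFlip x) = x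
  endFlip_sideFlip : ∀ x, endFlip (sideFlip x) = sideFlip (endFlip x)
  endFlip_ne : ∀ x, endFlip x ≠ x
  cornerFlip_ne : ∀ x, cornerFlip x ≠ x
  endFlip_ne_sideFlip : ∀ x, endFlip x ≠ sideFlip x

namespace CombMap

variable {F : Type*} (M : CombMap F)

/-- The vertex of a flag, as the set of all the flags at this vertex. -/
def vertex (x : F) : Set F := MulAction.orbit (Subgroup.closure {M.cornerFlip, M.sideFlip}) x

/-- The edge of a flag, as the set of all the flags of this edge. -/
def edge (x : F) : Set F := MulAction.orbit (Subgroup.closure {M.endFlip, M.sideFlip}) x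

/-- The face of a flag, as the set of all the flags in this face. -/
def face (x : F) : Set F := MulAction.orbit (Subgroup.closure {M.endFlip, M.cornerFlip}) x

/-- The edge-end of a flag, as the set of the (one or two) flags that share it. -/
def edgeEnd (x : F) : Set F := {x, M.sideFlip x}

/-- The edge-side of a flag, as the set of the two flags that share it. -/
def edgeSide (x : F) : Set F := {x, M.endFlip x}

/-- The degree of the vertex of `x`: the number of edge-ends at it (a loop counts twice). -/
noncomputable def vertexDegree (x : F) : ℕ := (M.edgeEnd '' M.vertex x).ncard

/-- The degree of the face of `x`: the number of edge-sides along it (an edge both of whose sides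
are incident to the face counts twice). -/
noncomputable def faceDegree (x : F) : ℕ := (M.edgeSide '' M.face x).ncard

/-- The number of vertices. -/
noncomputable def numVertices : ℕ := (Set.range M.vertex).ncard

/-- The number of edges. -/
noncomputable def numEdges : ℕ := (Set.range M.edge).ncard

/-- The number of faces. -/
noncomputable def numFaces : ℕ := (Set.range M.face).ncard

/-- The flag belongs to an edge on the boundary of the surface. -/
def OnBoundary (x : F) : Prop := M.sideFlip x = x

/-- The number of connected components of the boundary: boundary edges that share a vertex lie
on the same component, and `Quot` takes the generated equivalence relation. -/
noncomputable def numBoundaries : ℕ :=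
  Nat.card (Quot fun x y : {x : F // M.OnBoundary x} =>
    (y : F) ∈ M.edge (x : F) ∨ (y : F) ∈ M.vertex (x : F))

/-- `v - e + f`. -/
noncomputable def eulerChar : ℤ :=
  (M.numVertices : ℤ) - (M.numEdges : ℤ) + (M.numFaces : ℤ)

/-- The underlying surface is connected. -/
def IsConnected : Prop :=
  ∀ x y : F, y ∈ MulAction.orbit (Subgroup.closure {M.endFlip, M.cornerFlip, M.sideFlip}) x

/-- The underlying surface is orientable: the flags can be given signs so that any two distinct
neighbouring flags have opposite signs. -/
def IsOrientable : Prop :=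
  ∃ c : F → Bool, ∀ x, c (M.endFlip x) ≠ c x ∧ c (M.cornerFlip x) ≠ c x ∧
    (M.sideFlip x ≠ x → c (M.sideFlip x) ≠ c x)

/-- `M` is a map on the surface `S`. By the classification of surfaces, a compact connected
surface is determined by its Euler characteristic, its number of boundary components and its
orientability. -/
def IsMapOn (S : Surface) : Prop :=
  M.IsConnected ∧ M.eulerChar = S.eulerChar ∧ M.numBoundaries = S.β ∧
    (M.IsOrientable ↔ S.IsOrientable)

/-- Every face has degree three. -/
def IsTriangular : Prop := ∀ x, M.faceDegree x = 3

/-- Every vertex lies on the boundary of the surface. -/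
def AllVerticesOnBoundary : Prop := ∀ x, ∃ y ∈ M.vertex x, M.OnBoundary y

end CombMap

/-- A finite map with a root, that is, a distinguished end and side of an edge. -/
structure RootedMap : Type where
  numFlags : ℕ
  toMap : CombMap (Fin numFlags)
  root : Fin numFlags

namespace RootedMap

/-- Isomorphism of rooted maps: a bijection of the flags that respects all the incidences and the
root. It expresses the cell-preserving homeomorphisms that preserve the root-end and root-side. -/
def Iso (R R' : RootedMap) : Prop :=
  ∃ φ : Fin R.numFlags ≃ Fin R'.numFlags,
    (∀ x, φ (R.toMap.endFlip x) = R'.toMap.endFlip (φ x)) ∧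
    (∀ x, φ (R.toMap.cornerFlip x) = R'.toMap.cornerFlip (φ x)) ∧
    (∀ x, φ (R.toMap.sideFlip x) = R'.toMap.sideFlip (φ x)) ∧
    φ R.root = R'.root

theorem Iso.refl (R : RootedMap) : Iso R R :=
  ⟨Equiv.refl _, fun _ => rfl, fun _ => rfl, fun _ => rfl, rfl⟩

theorem Iso.symm {R R' : RootedMap} : Iso R R' → Iso R' R := by
  rintro ⟨φ, h0, h1, h2, hr⟩
  refine ⟨φ.symm, fun x => ?_, fun x => ?_, fun x => ?_, ?_⟩
  · rw [Equiv.symm_apply_eq, h0, Equiv.apply_symm_apply]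
  · rw [Equiv.symm_apply_eq, h1, Equiv.apply_symm_apply]
  · rw [Equiv.symm_apply_eq, h2, Equiv.apply_symm_apply]
  · rw [Equiv.symm_apply_eq, hr]

theorem Iso.trans {R R' R'' : RootedMap} : Iso R R' → Iso R' R'' → Iso R R'' := by
  rintro ⟨φ, h0, h1, h2, hr⟩ ⟨ψ, k0, k1, k2, kr⟩
  refine ⟨φ.trans ψ, fun x => ?_, fun x => ?_, fun x => ?_, ?_⟩
  · simp [h0, k0]
  · simp [h1, k1]
  · simp [h2, k2]
  · simp [hr, kr]

/-- Rooted maps are considered up to isomorphism. -/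
instance setoid : Setoid RootedMap := ⟨Iso, Iso.refl, Iso.symm, Iso.trans⟩

/-- The root-edge lies on the boundary of the surface. -/
def IsBoundaryRooted (R : RootedMap) : Prop := R.toMap.OnBoundary R.root

/-- The root-vertex is a leaf, that is, has degree one. -/
def IsLeafRooted (R : RootedMap) : Prop := R.toMap.vertexDegree R.root = 1

/-- Every vertex other than the root-vertex has degree three. -/
def IsCubicExceptRoot (R : RootedMap) : Prop :=
  ∀ x, x ∉ R.toMap.vertex R.root → R.toMap.vertexDegree x = 3

end RootedMap

/-- The boundary-rooted triangular maps on `S` having `n` vertices, all of them lying on the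
boundary (up to isomorphism of rooted maps). -/
def triangularMaps (S : Surface) (n : ℕ) : Set (Quotient RootedMap.setoid) :=
  {q | ∃ R : RootedMap, ⟦R⟧ = q ∧ R.toMap.IsMapOn S ∧ R.IsBoundaryRooted ∧
    R.toMap.IsTriangular ∧ R.toMap.AllVerticesOnBoundary ∧ R.toMap.numVertices = n}

/-- The cubic schemes of `S`: the leaf-rooted maps on the closed surface obtained by gluing a disc
along each of the `β` boundary circles of `S`, with `β` faces and all of whose non-root vertices
have degree three (up to isomorphism of rooted maps). -/
def cubicSchemes (S : Surface) : Set (Quotient RootedMap.setoid) :=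
  {q | ∃ R : RootedMap, ⟦R⟧ = q ∧ R.toMap.IsMapOn S.closure ∧ R.IsLeafRooted ∧
    R.IsCubicExceptRoot ∧ R.toMap.numFaces = S.β}

/-!
Dualising a triangular map with all its vertices on the boundary, and turning each of its boundary
edges into an edge that ends at a leaf, gives a map on the closed surface whose vertices have
degree one or three and each of whose faces, one for each boundary circle, has a leaf. So
`M_S(n)` counts leaf-rooted maps of this kind with `n` leaves, and the cubic schemes are those with
a single leaf, the root.

Drop the condition that each face has a leaf, and let `a n` be the number of maps that remain. A
leaf can be added on either side of any edge, and can be deleted again, so that counting the maps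
with a marked further leaf in two ways gives `n * a (n + 1) = (4 * n - 6 * χ) * a n`. Hence
`a n = a 1 * 4 ^ (n - 1) * Γ(n - 3χ/2) / (Γ(n) * Γ(1 - 3χ/2))`, and the asymptotics of `Γ` give the
main term.

It remains to see that only a proportion `O(n ^ (-1/2))` of these maps has a leafless face. Give a
leafless face of degree `k` the weight `t ^ k`. A leaf is added in a given face with probability
proportional to its degree, so that the total weight `W n t` of all maps with `n` leaves satisfies
a recurrence that involves its derivative in `t`, and `W n 1` bounds the number of these maps.
-/

section Orbits

variable {F : Type*}

theorem mem_orbit_closure_iff {s : Set (Equiv.Perm F)} (hs : ∀ g ∈ s, Function.Involutive g)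
    {x y : F} :
    y ∈ MulAction.orbit (Subgroup.closure s) x ↔
      ∀ P : F → Prop, P x → (∀ z, P z → ∀ g ∈ s, P (g z)) → P y := by
  constructor
  · rintro ⟨⟨g, hg⟩, rfl⟩ P hx hP
    have apply_iff : ∀ z, P (g z) ↔ P z := by
      induction hg using Subgroup.closure_induction with
      | mem g hg => exact fun z => ⟨fun h => by simpa only [hs g hg z] using hP _ h g hg,
          fun h => hP z h g hg⟩
      | one => exact fun z => Iff.rfl
      | mul a b _ _ ha hb => exact fun z => (ha _).trans (hb _)
      | inv a _ ha => exact fun z => by rw [← ha, Equiv.Perm.inv_def, Equiv.apply_symm_apply]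
    exact (apply_iff x).2 hx
  · intro h
    refine h _ (MulAction.mem_orbit_self x) ?_
    rintro z ⟨g, rfl⟩ k hk
    exact ⟨⟨k, Subgroup.subset_closure hk⟩ * g, rfl⟩

variable {p q : Equiv.Perm F}

theorem mem_orbit_closure_pair_iff (hp : Function.Involutive p) (hq : Function.Involutive q)
    {x y : F} :
    y ∈ MulAction.orbit (Subgroup.closure {p, q}) x ↔
      ∀ P : F → Prop, P x → (∀ z, P z → P (p z)) → (∀ z, P z → P (q z)) → P y := by
  rw [mem_orbit_closure_iff (by rintro g (rfl | rfl) <;> assumption)]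
  simp only [Set.mem_insert_iff, Set.mem_singleton_iff, forall_eq_or_imp, forall_eq,
    forall_and, and_imp]

theorem ncard_orbit_zpowers (r : Equiv.Perm F) (x : F) :
    (MulAction.orbit (Subgroup.zpowers r) x).ncard = Function.minimalPeriod r x := by
  rw [← Nat.card_coe_set_eq, Nat.card_congr (MulAction.orbitZPowersEquiv r x), Nat.card_zmod]
  rfl

theorem zpow_mul_apply_of_involutive (hp : Function.Involutive p) (hq : Function.Involutive q)
    (n : ℤ) (x : F) : ((p * q) ^ n) (q (((p * q) ^ n) x)) = q x := by
  have hpp : p * p = 1 := Equiv.ext hp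
  have hqq : q * q = 1 := Equiv.ext hq
  have conj : q * (p * q) * q⁻¹ = (p * q)⁻¹ := by
    rw [mul_inv_rev, inv_eq_of_mul_eq_one_left hpp, mul_assoc, mul_assoc, mul_inv_cancel, mul_one,
      inv_eq_of_mul_eq_one_left hqq]
  have conj_zpow : q * (p * q) ^ n = ((p * q) ^ n)⁻¹ * q := by
    rw [← inv_zpow, ← conj, conj_zpow, inv_mul_cancel_right]
  rw [← Equiv.Perm.mul_apply q, ← Equiv.Perm.mul_apply, conj_zpow, mul_inv_cancel_left]

theorem zpow_mul_apply_ne (hp : Function.Involutive p) (hq : Function.Involutive q)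
    (hp' : ∀ z, p z ≠ z) (hq' : ∀ z, q z ≠ z) (n : ℤ) (x : F) : ((p * q) ^ n) x ≠ q x := by
  intro h
  obtain ⟨m, rfl | rfl⟩ := n.even_or_odd'
  · have hfix : ((p * q) ^ m) (((p * q) ^ m) x) = ((p * q) ^ m) (q (((p * q) ^ m) x)) := by
      rw [zpow_mul_apply_of_involutive hp hq, ← h, two_mul, zpow_add, Equiv.Perm.mul_apply]
    exact hq' _ (Equiv.injective _ hfix).symm
  · have hfix : ((p * q) ^ m) ((p * q) (((p * q) ^ m) x)) =
        ((p * q) ^ m) (q (((p * q) ^ m) x)) := by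
      rw [zpow_mul_apply_of_involutive hp hq, ← h, ← Equiv.Perm.mul_apply, ← Equiv.Perm.mul_apply,
        ← zpow_add_one, ← zpow_add, add_right_comm, ← two_mul]
    exact hp' _ (Equiv.injective _ hfix)

theorem apply_notMem_orbit (hp : Function.Involutive p) (hq : Function.Involutive q)
    (hp' : ∀ z, p z ≠ z) (hq' : ∀ z, q z ≠ z) {x z : F}
    (hz : z ∈ MulAction.orbit (Subgroup.zpowers (p * q)) x) :
    q z ∉ MulAction.orbit (Subgroup.zpowers (p * q)) x := by
  rw [← MulAction.orbit_eq_iff.2 hz]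
  rintro ⟨⟨_, n, rfl⟩, h⟩
  exact zpow_mul_apply_ne hp hq hp' hq' n z h

theorem orbit_closure_pair (hp : Function.Involutive p) (hq : Function.Involutive q) (x : F) :
    MulAction.orbit (Subgroup.closure {p, q}) x =
      MulAction.orbit (Subgroup.zpowers (p * q)) x ∪
        q '' MulAction.orbit (Subgroup.zpowers (p * q)) x := by
  ext y
  constructor
  · refine fun h => (mem_orbit_closure_pair_iff hp hq).1 h
      (· ∈ MulAction.orbit (Subgroup.zpowers (p * q)) x ∪
        q '' MulAction.orbit (Subgroup.zpowers (p * q)) x)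
      (Or.inl (MulAction.mem_orbit_self x)) ?_ ?_
    · rintro z (hz | ⟨z, hz, rfl⟩)
      · refine Or.inr ⟨(p * q)⁻¹ z,
          MulAction.mem_orbit_of_mem_orbit (⟨_, inv_mem (Subgroup.mem_zpowers _)⟩ :
            Subgroup.zpowers (p * q)) hz, ?_⟩
        rw [mul_inv_rev, Equiv.Perm.mul_apply, ← Equiv.Perm.mul_apply q, mul_inv_cancel]
        exact Equiv.Perm.inv_eq_iff_eq.2 (hp z).symm
      · exact Or.inl (MulAction.mem_orbit_of_mem_orbit
          (⟨_, Subgroup.mem_zpowers _⟩ : Subgroup.zpowers (p * q)) hz)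
    · rintro z (hz | ⟨z, hz, rfl⟩)
      · exact Or.inr ⟨z, hz, rfl⟩
      · exact Or.inl (by rwa [hq z])
  · have hpq : p * q ∈ Subgroup.closure {p, q} :=
      mul_mem (Subgroup.subset_closure (by simp)) (Subgroup.subset_closure (by simp))
    have mem_of_mem : ∀ z ∈ MulAction.orbit (Subgroup.zpowers (p * q)) x,
        z ∈ MulAction.orbit (Subgroup.closure {p, q}) x := by
      rintro _ ⟨⟨g, hg⟩, rfl⟩
      exact ⟨⟨g, (Subgroup.zpowers_le.2 hpq) hg⟩, rfl⟩
    rintro (h | ⟨z, h, rfl⟩)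
    · exact mem_of_mem y h
    · exact MulAction.mem_orbit_of_mem_orbit
        (⟨q, Subgroup.subset_closure (by simp)⟩ : Subgroup.closure {p, q}) (mem_of_mem z h)

theorem ncard_orbit_closure_pair [Finite F] (hp : Function.Involutive p)
    (hq : Function.Involutive q) (hp' : ∀ z, p z ≠ z) (hq' : ∀ z, q z ≠ z) (x : F) :
    (MulAction.orbit (Subgroup.closure {p, q}) x).ncard =
      2 * Function.minimalPeriod (p * q) x := by
  rw [orbit_closure_pair hp hq, Set.ncard_union_eq, Set.ncard_image_of_injective _ q.injective,
    ncard_orbit_zpowers, two_mul]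
  rw [Set.disjoint_left]
  rintro _ hz ⟨w, hw, rfl⟩
  exact apply_notMem_orbit hp hq hp' hq' hw hz

theorem ncard_image_pair_orbit_closure_pair (hp : Function.Involutive p)
    (hq : Function.Involutive q) (hp' : ∀ z, p z ≠ z) (hq' : ∀ z, q z ≠ z) (x : F) :
    ((fun z => ({z, q z} : Set F)) '' MulAction.orbit (Subgroup.closure {p, q}) x).ncard =
      Function.minimalPeriod (p * q) x := by
  have pair_apply : (fun z => ({z, q z} : Set F)) ∘ q = fun z => {z, q z} :=
    funext fun z => by rw [Function.comp_apply, hq z, Set.pair_comm]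
  rw [orbit_closure_pair hp hq, Set.image_union, ← Set.image_comp, pair_apply, Set.union_self,
    Set.InjOn.ncard_image, ncard_orbit_zpowers]
  intro z hz w hw (h : {z, q z} = {w, q w})
  have hzw : z ∈ ({w, q w} : Set F) := h ▸ Set.mem_insert z _
  exact hzw.resolve_right fun e => apply_notMem_orbit hp hq hp' hq' hw (e ▸ hz)

theorem minimalPeriod_mul_eq_one_iff (hp : Function.Involutive p) {x : F} :
    Function.minimalPeriod (p * q) x = 1 ↔ p x = q x := by
  rw [Function.minimalPeriod_eq_one_iff_isFixedPt, Function.IsFixedPt, Equiv.Perm.mul_apply]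
  exact ⟨fun h => by rw [← hp (q x), h], fun h => by rw [← h, hp x]⟩

theorem pow_eq_one_iff_minimalPeriod {r : Equiv.Perm F} {n : ℕ} (hn : n.Prime) :
    r ^ n = 1 ↔ ∀ x, Function.minimalPeriod r x = 1 ∨ Function.minimalPeriod r x = n := by
  simp only [← Nat.dvd_prime hn, ← Function.isPeriodicPt_iff_minimalPeriod_dvd,
    Function.IsPeriodicPt, Function.IsFixedPt, ← Equiv.Perm.coe_pow]
  exact Equiv.ext_iff

theorem zpow_apply_eq_zpow_apply_iff (r : Equiv.Perm F) (x : F) {j k : ℤ} :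
    (r ^ j) x = (r ^ k) x ↔ (Function.minimalPeriod r x : ℤ) ∣ j - k := by
  rw [show (Function.minimalPeriod r x : ℤ) ∣ j - k ↔ (r ^ (j - k)) x = x from
    (MulAction.zpow_smul_eq_iff_minimalPeriod_dvd (a := r) (b := x)).symm,
    sub_eq_neg_add, zpow_add, Equiv.Perm.mul_apply, zpow_neg, Equiv.Perm.inv_eq_iff_eq]

section FixedPoint

variable {x : F}

theorem apply_zpow_mul_of_isFixedPt (hp : Function.Involutive p) (hq : Function.Involutive q)
    (hx : q x = x) (k : ℤ) : q (((p * q) ^ k) x) = ((p * q) ^ (-k)) x := by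
  rw [zpow_neg, Equiv.Perm.eq_inv_iff_eq, zpow_mul_apply_of_involutive hp hq, hx]

theorem orbit_closure_pair_of_isFixedPt (hp : Function.Involutive p) (hq : Function.Involutive q)
    (hx : q x = x) : MulAction.orbit (Subgroup.closure {p, q}) x =
      MulAction.orbit (Subgroup.zpowers (p * q)) x := by
  rw [orbit_closure_pair hp hq, Set.union_eq_left]
  rintro _ ⟨_, ⟨⟨_, k, rfl⟩, rfl⟩, rfl⟩
  exact ⟨⟨_, -k, rfl⟩, (apply_zpow_mul_of_isFixedPt hp hq hx k).symm⟩

theorem even_minimalPeriod_mul_of_isFixedPt (hp : Function.Involutive p)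
    (hq : Function.Involutive q) (hp' : ∀ z, p z ≠ z) (hx : q x = x) :
    Even (Function.minimalPeriod (p * q) x) := by
  by_contra hodd
  obtain ⟨m, hm⟩ := Nat.not_even_iff_odd.1 hodd
  refine hp' (((p * q) ^ (-m : ℤ)) x) ?_
  calc p (((p * q) ^ (-m : ℤ)) x)
      = (p * q) (q (((p * q) ^ (-m : ℤ)) x)) := by rw [Equiv.Perm.mul_apply, hq]
    _ = ((p * q) ^ (1 + m : ℤ)) x := by
      rw [apply_zpow_mul_of_isFixedPt hp hq hx, neg_neg, zpow_one_add]; rfl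
    _ = ((p * q) ^ (-m : ℤ)) x := by
      rw [zpow_apply_eq_zpow_apply_iff, hm]
      exact ⟨1, by push_cast; ring⟩

/-- The orbit is a path, and the fixed points are its two ends. -/
theorem ncard_fixed_orbit_closure_pair [Finite F] (hp : Function.Involutive p)
    (hq : Function.Involutive q) (hp' : ∀ z, p z ≠ z) (hx : q x = x) :
    {y ∈ MulAction.orbit (Subgroup.closure {p, q}) x | q y = y}.ncard = 2 := by
  obtain ⟨m, hm⟩ := even_minimalPeriod_mul_of_isFixedPt hp hq hp' hx
  have period_pos := Function.minimalPeriod_pos_of_mem_periodicPts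
    (Function.Injective.mem_periodicPts (p * q).injective x)
  suffices fixed_eq : {y ∈ MulAction.orbit (Subgroup.closure {p, q}) x | q y = y} =
      {((p * q) ^ (0 : ℤ)) x, ((p * q) ^ (m : ℤ)) x} by
    rw [fixed_eq, Set.ncard_pair]
    rw [Ne, zpow_apply_eq_zpow_apply_iff, zero_sub, dvd_neg, Int.natCast_dvd_natCast]
    exact fun h => absurd (Nat.le_of_dvd (by omega) h) (by omega)
  have fixed_iff (k : ℤ) : q (((p * q) ^ k) x) = ((p * q) ^ k) x ↔ (m : ℤ) ∣ k := by
    rw [apply_zpow_mul_of_isFixedPt hp hq hx, zpow_apply_eq_zpow_apply_iff, hm,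
      show -k - k = 2 * -k by ring, ← two_mul, Nat.cast_mul, Nat.cast_ofNat,
      mul_dvd_mul_iff_left two_ne_zero, dvd_neg]
  ext y
  simp only [orbit_closure_pair_of_isFixedPt hp hq hx, Set.mem_ofPred_eq, Set.mem_insert_iff,
    Set.mem_singleton_iff]
  constructor
  · rintro ⟨⟨⟨_, k, rfl⟩, rfl⟩, hfix⟩
    obtain ⟨j, rfl⟩ := (fixed_iff k).1 hfix
    obtain ⟨i, rfl | rfl⟩ := j.even_or_odd'
    · refine Or.inl ((zpow_apply_eq_zpow_apply_iff _ x).2 ⟨i, ?_⟩)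
      rw [hm]; push_cast; ring
    · refine Or.inr ((zpow_apply_eq_zpow_apply_iff _ x).2 ⟨i, ?_⟩)
      rw [hm]; push_cast; ring
  · rintro (rfl | rfl)
    · exact ⟨⟨⟨_, 0, rfl⟩, rfl⟩, (fixed_iff 0).2 (dvd_zero _)⟩
    · exact ⟨⟨⟨_, m, rfl⟩, rfl⟩, (fixed_iff m).2 dvd_rfl⟩

end FixedPoint

end Orbits

theorem ncard_range_eq_sum {X Y : Type*} [Fintype X] (f : X → Y) :
    ((Set.range f).ncard : ℚ) = ∑ x, 1 / ({y | f y = f x}.ncard : ℚ) := by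
  classical
  have ncard_fiber (y : Y) : {x | f x = y}.ncard = ({x | f x = y} : Finset X).card := by
    rw [← Set.ncard_coe_finset, Finset.coe_filter_univ]
  rw [← Set.image_univ, ← Finset.coe_univ, ← Finset.coe_image, Set.ncard_coe_finset,
    Finset.card_eq_sum_ones, Nat.cast_sum,
    ← Finset.sum_fiberwise_of_maps_to fun x _ => Finset.mem_image_of_mem f (Finset.mem_univ x)]
  refine Finset.sum_congr rfl fun y hy => ?_
  obtain ⟨x, -, rfl⟩ := Finset.mem_image.1 hy
  have card_ne_zero : (({z | f z = f x} : Finset X).card : ℚ) ≠ 0 :=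
    Nat.cast_ne_zero.2 (Finset.card_ne_zero_of_mem (Finset.mem_filter.2 ⟨Finset.mem_univ x, rfl⟩))
  rw [Finset.sum_congr rfl fun z hz => by rw [(Finset.mem_filter.1 hz).2, ncard_fiber],
    Finset.sum_const, nsmul_eq_mul, mul_one_div_cancel card_ne_zero, Nat.cast_one]

theorem ncard_range_orbit_eq_sum {G X : Type*} [Group G] [MulAction G X] [Fintype X] :
    ((Set.range fun x : X => MulAction.orbit G x).ncard : ℚ) =
      ∑ x : X, 1 / ((MulAction.orbit G x).ncard : ℚ) := by
  rw [ncard_range_eq_sum]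
  simp only [MulAction.orbit_eq_iff, Set.ofPred_mem_eq]

namespace CombMap

variable {F F' F'' : Type*}

theorem endFlip_involutive (M : CombMap F) : Function.Involutive M.endFlip := M.endFlip_endFlip

theorem cornerFlip_involutive (M : CombMap F) : Function.Involutive M.cornerFlip :=
  M.cornerFlip_cornerFlip

theorem sideFlip_involutive (M : CombMap F) : Function.Involutive M.sideFlip := M.sideFlip_sideFlip

/-- Morphisms of combinatorial maps: the functions between the flags that respect all the
incidences. An isomorphism is an equivalence that is a morphism. -/
structure IsHom (M : CombMap F) (M' : CombMap F') (f : F → F') : Prop where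
  map_endFlip : ∀ x, f (M.endFlip x) = M'.endFlip (f x)
  map_cornerFlip : ∀ x, f (M.cornerFlip x) = M'.cornerFlip (f x)
  map_sideFlip : ∀ x, f (M.sideFlip x) = M'.sideFlip (f x)

namespace IsHom

variable {M : CombMap F} {M' : CombMap F'} {M'' : CombMap F''}

theorem id (M : CombMap F) : M.IsHom M id := ⟨fun _ => rfl, fun _ => rfl, fun _ => rfl⟩

theorem symm {φ : F ≃ F'} (h : M.IsHom M' φ) : M'.IsHom M φ.symm where
  map_endFlip x := by rw [Equiv.symm_apply_eq, h.map_endFlip, Equiv.apply_symm_apply]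
  map_cornerFlip x := by rw [Equiv.symm_apply_eq, h.map_cornerFlip, Equiv.apply_symm_apply]
  map_sideFlip x := by rw [Equiv.symm_apply_eq, h.map_sideFlip, Equiv.apply_symm_apply]

theorem comp {f : F → F'} {g : F' → F''} (hg : M'.IsHom M'' g) (hf : M.IsHom M' f) :
    M.IsHom M'' (g ∘ f) where
  map_endFlip x := by rw [Function.comp_apply, hf.map_endFlip, hg.map_endFlip]; rfl
  map_cornerFlip x := by rw [Function.comp_apply, hf.map_cornerFlip, hg.map_cornerFlip]; rfl
  map_sideFlip x := by rw [Function.comp_apply, hf.map_sideFlip, hg.map_sideFlip]; rfl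

end IsHom

/-- Relabelling of the flags. -/
def relabel (M : CombMap F) (e : F ≃ F') : CombMap F' where
  endFlip := e.permCongr M.endFlip
  cornerFlip := e.permCongr M.cornerFlip
  sideFlip := e.permCongr M.sideFlip
  endFlip_endFlip x := by simp [Equiv.permCongr_apply, M.endFlip_endFlip]
  cornerFlip_cornerFlip x := by simp [Equiv.permCongr_apply, M.cornerFlip_cornerFlip]
  sideFlip_sideFlip x := by simp [Equiv.permCongr_apply, M.sideFlip_sideFlip]
  endFlip_sideFlip x := by simp [Equiv.permCongr_apply, M.endFlip_sideFlip]
  endFlip_ne x := by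
    simpa [Equiv.permCongr_apply, ← Equiv.eq_symm_apply] using M.endFlip_ne (e.symm x)
  cornerFlip_ne x := by
    simpa [Equiv.permCongr_apply, ← Equiv.eq_symm_apply] using M.cornerFlip_ne (e.symm x)
  endFlip_ne_sideFlip x := by
    simpa [Equiv.permCongr_apply] using M.endFlip_ne_sideFlip (e.symm x)

theorem isHom_relabel (M : CombMap F) (e : F ≃ F') : M.IsHom (M.relabel e) e where
  map_endFlip x := by simp [relabel, Equiv.permCongr_apply]
  map_cornerFlip x := by simp [relabel, Equiv.permCongr_apply]
  map_sideFlip x := by simp [relabel, Equiv.permCongr_apply]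

/-- Isomorphism of maps with a distinguished flag. -/
def PointedIso (M : CombMap F) (r : F) (M' : CombMap F') (r' : F') : Prop :=
  ∃ φ : F ≃ F', M.IsHom M' φ ∧ φ r = r'

theorem PointedIso.symm {M : CombMap F} {r : F} {M' : CombMap F'} {r' : F'} :
    M.PointedIso r M' r' → M'.PointedIso r' M r := by
  rintro ⟨φ, hφ, rfl⟩
  exact ⟨φ.symm, hφ.symm, φ.symm_apply_apply r⟩

theorem PointedIso.trans {M : CombMap F} {r : F} {M' : CombMap F'} {r' : F'} {M'' : CombMap F''}
    {r'' : F''} : M.PointedIso r M' r' → M'.PointedIso r' M'' r'' → M.PointedIso r M'' r'' := by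
  rintro ⟨φ, hφ, rfl⟩ ⟨ψ, hψ, rfl⟩
  exact ⟨φ.trans ψ, hψ.comp hφ, rfl⟩

section Connected

variable {M : CombMap F} {M' : CombMap F'}

theorem mem_orbit_closure_flips_iff (M : CombMap F) {x y : F} :
    y ∈ MulAction.orbit (Subgroup.closure {M.endFlip, M.cornerFlip, M.sideFlip}) x ↔
      ∀ P : F → Prop, P x → (∀ z, P z → P (M.endFlip z)) → (∀ z, P z → P (M.cornerFlip z)) →
        (∀ z, P z → P (M.sideFlip z)) → P y := by
  rw [mem_orbit_closure_iff (by
    rintro g (rfl | rfl | rfl)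
    exacts [M.endFlip_involutive, M.cornerFlip_involutive, M.sideFlip_involutive])]
  simp only [Set.mem_insert_iff, Set.mem_singleton_iff, forall_eq_or_imp, forall_eq,
    forall_and, and_imp]

theorem IsConnected.induction (hM : M.IsConnected) {P : F → Prop} {r : F} (root : P r)
    (endFlip : ∀ z, P z → P (M.endFlip z)) (cornerFlip : ∀ z, P z → P (M.cornerFlip z))
    (sideFlip : ∀ z, P z → P (M.sideFlip z)) (x : F) : P x :=
  M.mem_orbit_closure_flips_iff.1 (hM r x) P root endFlip cornerFlip sideFlip

theorem isConnected_of_induction (r : F)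
    (h : ∀ P : F → Prop, P r → (∀ z, P z → P (M.endFlip z)) → (∀ z, P z → P (M.cornerFlip z)) →
      (∀ z, P z → P (M.sideFlip z)) → ∀ z, P z) : M.IsConnected := by
  have mem_orbit_root (x : F) :
      x ∈ MulAction.orbit (Subgroup.closure {M.endFlip, M.cornerFlip, M.sideFlip}) r :=
    M.mem_orbit_closure_flips_iff.2 fun P root hend hcorner hside => h P root hend hcorner hside x
  exact fun x y => by rw [MulAction.orbit_eq_iff.2 (mem_orbit_root x)]; exact mem_orbit_root y

theorem IsHom.isConnected {f : F → F'} (hf : M.IsHom M' f) (hsurj : Function.Surjective f)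
    (hM : M.IsConnected) : M'.IsConnected := by
  rcases isEmpty_or_nonempty F' with _ | ⟨⟨r'⟩⟩
  · exact fun x => isEmptyElim x
  obtain ⟨r, rfl⟩ := hsurj r'
  refine isConnected_of_induction (f r) fun P root hend hcorner hside => hsurj.forall.2 ?_
  refine hM.induction root (fun z hz => ?_) (fun z hz => ?_) fun z hz => ?_
  · exact hf.map_endFlip z ▸ hend _ hz
  · exact hf.map_cornerFlip z ▸ hcorner _ hz
  · exact hf.map_sideFlip z ▸ hside _ hz

theorem IsConnected.isHom_unique (hM : M.IsConnected) {f g : F → F'} (hf : M.IsHom M' f)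
    (hg : M.IsHom M' g) {r : F} (hr : f r = g r) : f = g := by
  refine funext (hM.induction hr (fun z hz => ?_) (fun z hz => ?_) fun z hz => ?_)
  · rw [hf.map_endFlip, hg.map_endFlip, hz]
  · rw [hf.map_cornerFlip, hg.map_cornerFlip, hz]
  · rw [hf.map_sideFlip, hg.map_sideFlip, hz]

theorem IsHom.isOrientable {f : F → F'} (hf : M.IsHom M' f) (hinj : Function.Injective f) :
    M'.IsOrientable → M.IsOrientable := by
  rintro ⟨c, hc⟩
  refine ⟨c ∘ f, fun x => ?_⟩
  simp only [Function.comp_apply, hf.map_endFlip, hf.map_cornerFlip, hf.map_sideFlip]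
  refine ⟨(hc _).1, (hc _).2.1, fun hx => (hc _).2.2 fun hfx => hx (hinj ?_)⟩
  rw [hf.map_sideFlip, hfx]

end Connected

section Face

/-- The type of the faces of a map, as opposed to `CombMap.face`, which is the set of the flags of
one face. -/
abbrev Face (M : CombMap F) : Type _ :=
  MulAction.orbitRel.Quotient (Subgroup.closure {M.endFlip, M.cornerFlip}) F

/-- The face of a flag, as an element of the type of faces. -/
def faceOf (M : CombMap F) (x : F) : M.Face := Quotient.mk _ x

variable (M : CombMap F)

theorem faceOf_surjective : Function.Surjective M.faceOf := Quotient.mk_surjective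

theorem mem_face_iff {x y : F} :
    y ∈ M.face x ↔ ∀ P : F → Prop, P x → (∀ z, P z → P (M.endFlip z)) →
      (∀ z, P z → P (M.cornerFlip z)) → P y :=
  mem_orbit_closure_pair_iff M.endFlip_involutive M.cornerFlip_involutive

theorem faceOf_eq_faceOf_iff {x y : F} : M.faceOf x = M.faceOf y ↔ x ∈ M.face y :=
  Quotient.eq.trans MulAction.orbitRel_apply

@[simp] theorem faceOf_endFlip (x : F) : M.faceOf (M.endFlip x) = M.faceOf x :=
  M.faceOf_eq_faceOf_iff.2 (M.mem_face_iff.2 fun _ hx hend _ => hend _ hx)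

@[simp] theorem faceOf_cornerFlip (x : F) : M.faceOf (M.cornerFlip x) = M.faceOf x :=
  M.faceOf_eq_faceOf_iff.2 (M.mem_face_iff.2 fun _ hx _ hcorner => hcorner _ hx)

theorem faceOf_mul_pow (k : ℕ) (x : F) :
    M.faceOf (((M.cornerFlip * M.endFlip) ^ k) x) = M.faceOf x := by
  induction k generalizing x with
  | zero => rfl
  | succ k ih =>
    rw [pow_succ, Equiv.Perm.mul_apply, ih, Equiv.Perm.mul_apply, faceOf_cornerFlip,
      faceOf_endFlip]

theorem numFaces_eq : M.numFaces = Nat.card M.Face := by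
  have range_face : Set.range M.face = Set.range fun f : M.Face => f.orbit :=
    M.faceOf_surjective.range_comp fun f : M.Face => f.orbit
  rw [numFaces, range_face, ← Nat.card_coe_set_eq,
    Nat.card_range_of_injective MulAction.orbitRel.Quotient.orbit_injective]

variable {M}

/-- Functions on the faces from the functions on the flags that are constant along each face. -/
def Face.lift {α : Sort*} (f : F → α) (hend : ∀ x, f (M.endFlip x) = f x)
    (hcorner : ∀ x, f (M.cornerFlip x) = f x) : M.Face → α :=
  Quotient.lift f fun _ y h => M.mem_face_iff.1 h (f · = f y) rfl (fun z hz => (hend z).trans hz)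
    fun z hz => (hcorner z).trans hz

@[simp] theorem Face.lift_faceOf {α : Sort*} (f : F → α) (hend : ∀ x, f (M.endFlip x) = f x)
    (hcorner : ∀ x, f (M.cornerFlip x) = f x) (x : F) :
    Face.lift f hend hcorner (M.faceOf x) = f x := rfl

/-- The action of an isomorphism on the faces. -/
def IsHom.faceEquiv {M' : CombMap F'} {φ : F ≃ F'} (h : M.IsHom M' φ) : M.Face ≃ M'.Face where
  toFun := Face.lift (fun x => M'.faceOf (φ x)) (fun x => by rw [h.map_endFlip, faceOf_endFlip])
    (fun x => by rw [h.map_cornerFlip, faceOf_cornerFlip])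
  invFun := Face.lift (fun x => M.faceOf (φ.symm x))
    (fun x => by rw [h.symm.map_endFlip, faceOf_endFlip])
    (fun x => by rw [h.symm.map_cornerFlip, faceOf_cornerFlip])
  left_inv := M.faceOf_surjective.forall.2 fun x => by
    rw [Face.lift_faceOf, Face.lift_faceOf, φ.symm_apply_apply]
  right_inv := M'.faceOf_surjective.forall.2 fun x => by
    rw [Face.lift_faceOf, Face.lift_faceOf, φ.apply_symm_apply]

@[simp] theorem IsHom.faceEquiv_faceOf {M' : CombMap F'} {φ : F ≃ F'} (h : M.IsHom M' φ) (x : F) :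
    h.faceEquiv (M.faceOf x) = M'.faceOf (φ x) := rfl

end Face

/-- The surface has no boundary. -/
def IsBoundaryless (M : CombMap F) : Prop := ∀ x, ¬M.OnBoundary x

/-- In a map without boundary, all vertices have degree one or three. -/
def IsSubcubic (M : CombMap F) : Prop := (M.cornerFlip * M.sideFlip) ^ 3 = 1

/-- In a map without boundary, the flag is at a vertex of degree one. -/
def IsLeaf (M : CombMap F) (x : F) : Prop := M.cornerFlip x = M.sideFlip x

section Degree

variable {M : CombMap F}

theorem isSubcubic_iff : M.IsSubcubic ↔ ∀ x, M.cornerFlip (M.sideFlip (M.cornerFlip (M.sideFlip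
    (M.cornerFlip (M.sideFlip x))))) = x :=
  Equiv.ext_iff

theorem isSubcubic_iff_minimalPeriod : M.IsSubcubic ↔ ∀ x,
    Function.minimalPeriod (M.cornerFlip * M.sideFlip) x = 1 ∨
      Function.minimalPeriod (M.cornerFlip * M.sideFlip) x = 3 :=
  pow_eq_one_iff_minimalPeriod Nat.prime_three

theorem isLeaf_iff_minimalPeriod {x : F} :
    M.IsLeaf x ↔ Function.minimalPeriod (M.cornerFlip * M.sideFlip) x = 1 :=
  (minimalPeriod_mul_eq_one_iff M.cornerFlip_involutive).symm

theorem IsBoundaryless.vertexDegree_eq (hM : M.IsBoundaryless) (x : F) :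
    M.vertexDegree x = Function.minimalPeriod (M.cornerFlip * M.sideFlip) x :=
  ncard_image_pair_orbit_closure_pair M.cornerFlip_involutive M.sideFlip_involutive
    M.cornerFlip_ne hM x

theorem IsBoundaryless.ncard_vertex [Finite F] (hM : M.IsBoundaryless) (x : F) :
    (M.vertex x).ncard = 2 * M.vertexDegree x := by
  rw [hM.vertexDegree_eq]
  exact ncard_orbit_closure_pair M.cornerFlip_involutive M.sideFlip_involutive M.cornerFlip_ne hM x

theorem IsBoundaryless.vertexDegree_eq_one_iff (hM : M.IsBoundaryless) {x : F} :
    M.vertexDegree x = 1 ↔ M.IsLeaf x := by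
  rw [hM.vertexDegree_eq, isLeaf_iff_minimalPeriod]

theorem faceDegree_eq (M : CombMap F) (x : F) :
    M.faceDegree x = Function.minimalPeriod (M.cornerFlip * M.endFlip) x := by
  rw [faceDegree, face, Set.pair_comm]
  exact ncard_image_pair_orbit_closure_pair M.cornerFlip_involutive M.endFlip_involutive
    M.cornerFlip_ne M.endFlip_ne x

theorem IsLeaf.sideFlip {x : F} (h : M.IsLeaf x) : M.IsLeaf (M.sideFlip x) := by
  rw [IsLeaf, M.sideFlip_sideFlip, ← h, M.cornerFlip_cornerFlip]

theorem IsHom.isLeaf_iff {M' : CombMap F'} {f : F → F'} (h : M.IsHom M' f)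
    (hinj : Function.Injective f) (x : F) : M'.IsLeaf (f x) ↔ M.IsLeaf x := by
  rw [IsLeaf, IsLeaf, ← h.map_cornerFlip, ← h.map_sideFlip, hinj.eq_iff]

end Degree

/-- The maps without boundary whose vertices have degree one or three, of which `n` of degree one,
with as many faces, edges and sides as a map on `S.closure` with `S.β` faces, rooted at a leaf.
The Euler characteristic is prescribed through the number of flags. -/
structure IsLeafyCubic (M : CombMap F) (S : Surface) (n : ℕ) (r : F) : Prop where
  boundaryless : M.IsBoundaryless
  connected : M.IsConnected
  subcubic : M.IsSubcubic
  root : M.IsLeaf r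
  card_leaf : Nat.card {x // M.IsLeaf x} = 2 * n
  card_flag : (Nat.card F : ℤ) = 8 * n - 12 * S.eulerChar
  card_face : Nat.card M.Face = S.β
  orientable : M.IsOrientable ↔ S.IsOrientable

theorem IsLeafyCubic.of_pointedIso {S : Surface} {n : ℕ} {M : CombMap F} {r : F}
    {M' : CombMap F'} {r' : F'} (hM : M.IsLeafyCubic S n r) (h : M.PointedIso r M' r') :
    M'.IsLeafyCubic S n r' := by
  obtain ⟨φ, hφ, rfl⟩ := h
  exact
    { boundaryless := φ.surjective.forall.2 fun x hx =>
        hM.boundaryless x (φ.injective ((hφ.map_sideFlip x).trans hx))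
      connected := hφ.isConnected φ.surjective hM.connected
      subcubic := isSubcubic_iff.2 <| φ.surjective.forall.2 fun x => by
        simp only [← hφ.map_sideFlip, ← hφ.map_cornerFlip, isSubcubic_iff.1 hM.subcubic]
      root := (hφ.isLeaf_iff φ.injective r).2 hM.root
      card_leaf := by
        rw [← hM.card_leaf]
        exact Nat.card_congr (φ.subtypeEquiv fun x => (hφ.isLeaf_iff φ.injective x).symm).symm
      card_flag := by rw [← hM.card_flag, Nat.card_congr φ]
      card_face := by rw [← hM.card_face, Nat.card_congr hφ.faceEquiv]
      orientable := by
        rw [← hM.orientable]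
        exact ⟨hφ.isOrientable φ.injective, hφ.symm.isOrientable φ.symm.injective⟩ }

end CombMap

namespace RootedMap

open CombMap

theorem mk_eq_mk_iff {R R' : RootedMap} :
    (⟦R⟧ : Quotient RootedMap.setoid) = ⟦R'⟧ ↔ R.toMap.PointedIso R.root R'.toMap R'.root := by
  rw [Quotient.eq]
  exact ⟨fun ⟨φ, hend, hcorner, hside, hr⟩ => ⟨φ, ⟨hend, hcorner, hside⟩, hr⟩,
    fun ⟨φ, hφ, hr⟩ => ⟨φ, hφ.map_endFlip, hφ.map_cornerFlip, hφ.map_sideFlip, hr⟩⟩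

/-- The rooted map given by a map on any finite type of flags, numbered arbitrarily. -/
noncomputable def ofMap {F : Type*} [Finite F] (M : CombMap F) (r : F) : RootedMap :=
  ⟨Nat.card F, M.relabel (Finite.equivFin F), Finite.equivFin F r⟩

theorem pointedIso_ofMap {F : Type*} [Finite F] (M : CombMap F) (r : F) :
    M.PointedIso r (ofMap M r).toMap (ofMap M r).root :=
  ⟨Finite.equivFin F, isHom_relabel M _, rfl⟩

theorem mk_ofMap_eq_iff {F F' : Type*} [Finite F] [Finite F'] {M : CombMap F} {r : F}
    {M' : CombMap F'} {r' : F'} :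
    (⟦ofMap M r⟧ : Quotient RootedMap.setoid) = ⟦ofMap M' r'⟧ ↔ M.PointedIso r M' r' := by
  rw [mk_eq_mk_iff]
  exact ⟨fun h => (pointedIso_ofMap M r).trans (h.trans (pointedIso_ofMap M' r').symm),
    fun h => (pointedIso_ofMap M r).symm.trans (h.trans (pointedIso_ofMap M' r'))⟩

theorem mk_ofMap_toMap (R : RootedMap) :
    (⟦ofMap R.toMap R.root⟧ : Quotient RootedMap.setoid) = ⟦R⟧ :=
  mk_eq_mk_iff.2 (pointedIso_ofMap _ _).symm

/-- The isomorphism classes of the rooted maps with a given property. -/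
def classes (P : RootedMap → Prop) : Set (Quotient RootedMap.setoid) := {q | ∃ R, ⟦R⟧ = q ∧ P R}

theorem finite_combMap (N : ℕ) : Finite (CombMap (Fin N)) := by
  refine Finite.of_injective (fun M => (M.endFlip, M.cornerFlip, M.sideFlip)) ?_
  rintro ⟨_, _, _, _⟩ ⟨_, _, _, _⟩ h
  simp only [Prod.mk.injEq] at h
  obtain ⟨rfl, rfl, rfl⟩ := h
  rfl

theorem classes_finite {P : RootedMap → Prop} {N : ℕ} (h : ∀ R, P R → R.numFlags = N) :
    (classes P).Finite := by
  have := finite_combMap N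
  refine (Set.finite_range fun p : CombMap (Fin N) × Fin N =>
    (⟦⟨N, p.1, p.2⟩⟧ : Quotient RootedMap.setoid)).subset ?_
  rintro q ⟨⟨k, M, r⟩, rfl, hR⟩
  obtain rfl : k = N := h _ hR
  exact ⟨(M, r), rfl⟩

end RootedMap

namespace CombMap

variable {F F' G : Type*}

theorem ext {M N : CombMap F} (endFlip : ∀ x, M.endFlip x = N.endFlip x)
    (cornerFlip : ∀ x, M.cornerFlip x = N.cornerFlip x)
    (sideFlip : ∀ x, M.sideFlip x = N.sideFlip x) : M = N := by
  cases M
  cases N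
  congr
  exacts [Equiv.ext endFlip, Equiv.ext cornerFlip, Equiv.ext sideFlip]

/-- Disjoint union of two maps. -/
def sum (M : CombMap F) (N : CombMap G) : CombMap (F ⊕ G) where
  endFlip := Equiv.sumCongr M.endFlip N.endFlip
  cornerFlip := Equiv.sumCongr M.cornerFlip N.cornerFlip
  sideFlip := Equiv.sumCongr M.sideFlip N.sideFlip
  endFlip_endFlip := by simp [M.endFlip_endFlip, N.endFlip_endFlip]
  cornerFlip_cornerFlip := by simp [M.cornerFlip_cornerFlip, N.cornerFlip_cornerFlip]
  sideFlip_sideFlip := by simp [M.sideFlip_sideFlip, N.sideFlip_sideFlip]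
  endFlip_sideFlip := by simp [M.endFlip_sideFlip, N.endFlip_sideFlip]
  endFlip_ne := by simp [M.endFlip_ne, N.endFlip_ne]
  cornerFlip_ne := by simp [M.cornerFlip_ne, N.cornerFlip_ne]
  endFlip_ne_sideFlip := by simp [M.endFlip_ne_sideFlip, N.endFlip_ne_sideFlip]

theorem IsBoundaryless.sum {M : CombMap F} {N : CombMap G} (hM : M.IsBoundaryless)
    (hN : N.IsBoundaryless) : (M.sum N).IsBoundaryless := by
  rintro (z | i) h
  exacts [hM z (Sum.inl_injective h), hN i (Sum.inr_injective h)]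

theorem IsHom.sumCongr {M : CombMap F} {M' : CombMap F'} {φ : F ≃ F'} (h : M.IsHom M' φ)
    (N : CombMap G) : (M.sum N).IsHom (M'.sum N) (Equiv.sumCongr φ (Equiv.refl G)) where
  map_endFlip := by rintro (z | i); exacts [congrArg Sum.inl (h.map_endFlip z), rfl]
  map_cornerFlip := by rintro (z | i); exacts [congrArg Sum.inl (h.map_cornerFlip z), rfl]
  map_sideFlip := by rintro (z | i); exacts [congrArg Sum.inl (h.map_sideFlip z), rfl]

section Cross

open scoped Classical in
/-- The permutation that exchanges the edge-end of `x` with the edge-end of `y`. -/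
noncomputable def swapEnds (M : CombMap F) (x y : F) : Equiv.Perm F :=
  Equiv.swap x y * Equiv.swap (M.sideFlip x) (M.sideFlip y)

variable {M : CombMap F} {x y : F}

theorem swapEnds_apply [DecidableEq F] (x y z : F) :
    M.swapEnds x y z = Equiv.swap x y (Equiv.swap (M.sideFlip x) (M.sideFlip y) z) := by
  rw [swapEnds, Equiv.Perm.mul_apply]
  congr!

theorem IsBoundaryless.commute_swap (hM : M.IsBoundaryless) [DecidableEq F] (x y : F) :
    Commute (Equiv.swap x y) (Equiv.swap (M.sideFlip x) (M.sideFlip y)) := by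
  have hx : M.sideFlip x ≠ x := hM x
  have hy : M.sideFlip y ≠ y := hM y
  rcases eq_or_ne y x with rfl | hyx
  · simp only [Equiv.swap_self]
    exact Commute.refl _
  rcases eq_or_ne y (M.sideFlip x) with rfl | hysx
  · rw [M.sideFlip_sideFlip, Equiv.swap_comm]
  have hxsy : x ≠ M.sideFlip y := fun h => hysx (by rw [h, M.sideFlip_sideFlip])
  refine (Equiv.Perm.disjoint_iff_eq_or_eq.2 fun z => ?_).commute
  by_cases hzx : z = x
  · subst hzx
    exact Or.inr (Equiv.swap_apply_of_ne_of_ne hx.symm hxsy)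
  by_cases hzy : z = y
  · subst hzy
    exact Or.inr (Equiv.swap_apply_of_ne_of_ne hysx hy.symm)
  exact Or.inl (Equiv.swap_apply_of_ne_of_ne hzx hzy)

theorem IsBoundaryless.swapEnds_sideFlip (hM : M.IsBoundaryless) (x y z : F) :
    M.swapEnds x y (M.sideFlip z) = M.sideFlip (M.swapEnds x y z) := by
  classical
  rw [swapEnds_apply, swapEnds_apply, M.sideFlip.injective.map_swap,
    M.sideFlip.injective.map_swap, M.sideFlip_sideFlip, M.sideFlip_sideFlip]
  exact Equiv.congr_fun (hM.commute_swap x y).eq (M.sideFlip z)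

theorem IsBoundaryless.swapEnds_swapEnds (hM : M.IsBoundaryless) (x y z : F) :
    M.swapEnds x y (M.swapEnds x y z) = z := by
  classical
  have sq : M.swapEnds x y * M.swapEnds x y = 1 := by
    rw [swapEnds, (hM.commute_swap x y).symm.mul_mul_mul_comm, Equiv.swap_mul_self,
      Equiv.swap_mul_self, one_mul]
  exact Equiv.congr_fun sq z

/-- Cut the edges of `x` and `y` in their middle and reglue the four halves with the end of `x` and
the end of `y` exchanged. -/
noncomputable def cross (M : CombMap F) (hM : M.IsBoundaryless) (x y : F) : CombMap F where
  endFlip := M.swapEnds x y * M.endFlip * M.swapEnds x y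
  cornerFlip := M.cornerFlip
  sideFlip := M.sideFlip
  endFlip_endFlip z := by
    simp only [Equiv.Perm.mul_apply, hM.swapEnds_swapEnds, M.endFlip_endFlip]
  cornerFlip_cornerFlip := M.cornerFlip_cornerFlip
  sideFlip_sideFlip := M.sideFlip_sideFlip
  endFlip_sideFlip z := by
    simp only [Equiv.Perm.mul_apply, hM.swapEnds_sideFlip, M.endFlip_sideFlip]
  endFlip_ne z h := M.endFlip_ne (M.swapEnds x y z) <| (M.swapEnds x y).injective <| by
    rw [hM.swapEnds_swapEnds]; exact h
  cornerFlip_ne := M.cornerFlip_ne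
  endFlip_ne_sideFlip z h := M.endFlip_ne_sideFlip (M.swapEnds x y z) <|
    (M.swapEnds x y).injective <| by
      rw [hM.swapEnds_sideFlip, hM.swapEnds_swapEnds]; exact h

theorem cross_endFlip (hM : M.IsBoundaryless) (z : F) :
    (M.cross hM x y).endFlip z = M.swapEnds x y (M.endFlip (M.swapEnds x y z)) := rfl

theorem isBoundaryless_cross (hM : M.IsBoundaryless) : (M.cross hM x y).IsBoundaryless := hM

theorem cross_cross (hM : M.IsBoundaryless) :
    (M.cross hM x y).cross (isBoundaryless_cross hM) x y = M := by
  have swapEnds_cross : (M.cross hM x y).swapEnds x y = M.swapEnds x y := rfl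
  refine CombMap.ext (fun z => ?_) (fun _ => rfl) fun _ => rfl
  rw [cross_endFlip, cross_endFlip, swapEnds_cross, hM.swapEnds_swapEnds, hM.swapEnds_swapEnds]

theorem IsHom.map_swapEnds {M' : CombMap F'} {φ : F ≃ F'} (h : M.IsHom M' φ) (x y z : F) :
    φ (M.swapEnds x y z) = M'.swapEnds (φ x) (φ y) (φ z) := by
  classical
  rw [swapEnds_apply, swapEnds_apply, φ.injective.map_swap,
    φ.injective.map_swap, h.map_sideFlip, h.map_sideFlip]

theorem IsHom.cross {M' : CombMap F'} {φ : F ≃ F'} (h : M.IsHom M' φ) (hM : M.IsBoundaryless)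
    (hM' : M'.IsBoundaryless) (x y : F) :
    (M.cross hM x y).IsHom (M'.cross hM' (φ x) (φ y)) φ where
  map_endFlip z := by
    rw [cross_endFlip, cross_endFlip, h.map_swapEnds, h.map_endFlip, h.map_swapEnds]
  map_cornerFlip := h.map_cornerFlip
  map_sideFlip := h.map_sideFlip

end Cross

end CombMap

/-- The flags that a new leaf adds to a map: `a0` and `a1` at the leaf, `b0` and `b1` at the other
end of its edge, and the four others at the two ends created in the middle of the edge to which the
leaf is attached. -/
inductive Spur : Type
  | a0 | a1 | b0 | b1 | x0 | x1 | y0 | y1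
  deriving DecidableEq

namespace Spur

instance : Fintype Spur :=
  ⟨{a0, a1, b0, b1, x0, x1, y0, y1}, by rintro (_ | _) <;> decide⟩

/-- The action of `CombMap.endFlip` on the lollipop. -/
def endFlip : Spur → Spur
  | a0 => b0 | b0 => a0 | a1 => b1 | b1 => a1
  | x0 => y0 | y0 => x0 | x1 => y1 | y1 => x1

/-- The action of `CombMap.cornerFlip` on the lollipop. -/
def cornerFlip : Spur → Spur
  | a0 => a1 | a1 => a0 | b0 => x0 | x0 => b0
  | b1 => y0 | y0 => b1 | x1 => y1 | y1 => x1

/-- The action of `CombMap.sideFlip` on the lollipop. -/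
def sideFlip : Spur → Spur
  | a0 => a1 | a1 => a0 | b0 => b1 | b1 => b0
  | x0 => x1 | x1 => x0 | y0 => y1 | y1 => y0

end Spur

section Sum

variable {α α' β β' : Type*}

theorem exists_apply_inl_eq {f : α ⊕ β → α' ⊕ β'} (h : ∀ z, (f z).isRight → z.isRight) (a : α) :
    ∃ a', f (.inl a) = .inl a' := by
  rcases ha : f (.inl a) with a' | b
  · exact ⟨a', rfl⟩
  · exact absurd (h (.inl a) (by rw [ha]; rfl)) Bool.false_ne_true

theorem exists_forall_apply_inl_eq {Φ : α ⊕ β ≃ α' ⊕ β'} (h : ∀ z, (Φ z).isRight ↔ z.isRight) :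
    ∃ φ : α ≃ α', ∀ a, Φ (.inl a) = .inl (φ a) := by
  choose f hf using exists_apply_inl_eq fun z => (h z).1
  choose g hg using exists_apply_inl_eq (f := Φ.symm) fun z hz =>
    Φ.apply_symm_apply z ▸ (h (Φ.symm z)).2 hz
  refine ⟨⟨f, g, fun a => Sum.inl_injective (β := β) ?_, fun a => Sum.inl_injective (β := β') ?_⟩,
    hf⟩
  · rw [← hg, ← hf, Φ.symm_apply_apply]
  · rw [← hf, ← hg, Φ.apply_symm_apply]

theorem exists_eq_sumCongr_refl {Φ : α ⊕ β ≃ α' ⊕ β} (h : ∀ b, Φ (.inr b) = .inr b) :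
    ∃ φ : α ≃ α', Φ = Equiv.sumCongr φ (Equiv.refl β) := by
  obtain ⟨φ, hφ⟩ := exists_forall_apply_inl_eq (Φ := Φ) fun z => by
    refine ⟨fun hz => ?_, fun hz => ?_⟩
    · obtain ⟨b, hb⟩ := Sum.isRight_iff.1 hz
      rw [Φ.injective (hb.trans (h b).symm)]
      rfl
    · obtain ⟨b, rfl⟩ := Sum.isRight_iff.1 hz
      rw [h]
      rfl
  refine ⟨φ, Equiv.ext ?_⟩
  rintro (a | b)
  exacts [hφ a, h b]

end Sum

namespace CombMap

/-- The map on the sphere with two edges: one joins a leaf to a vertex of degree three, the other is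
a loop at this vertex. -/
def lollipop : CombMap Spur where
  endFlip := Function.Involutive.toPerm Spur.endFlip (by unfold Function.Involutive; decide)
  cornerFlip := Function.Involutive.toPerm Spur.cornerFlip (by unfold Function.Involutive; decide)
  sideFlip := Function.Involutive.toPerm Spur.sideFlip (by unfold Function.Involutive; decide)
  endFlip_endFlip := by decide
  cornerFlip_cornerFlip := by decide
  sideFlip_sideFlip := by decide
  endFlip_sideFlip := by decide
  endFlip_ne := by decide
  cornerFlip_ne := by decide
  endFlip_ne_sideFlip := by decide

theorem isBoundaryless_lollipop : lollipop.IsBoundaryless := by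
  unfold IsBoundaryless OnBoundary
  decide

section AddLeaf

variable {F F' : Type*} (M : CombMap F) (hM : M.IsBoundaryless) (x : F)

/-- `M` with a new leaf, whose edge is attached in the middle of the edge of `x`, on the side of
`x`: it is obtained by exchanging an end of the loop of a lollipop with the end of `x`. -/
noncomputable def addLeaf : CombMap (F ⊕ Spur) :=
  (M.sum lollipop).cross (hM.sum isBoundaryless_lollipop) (.inl x) (.inr .y0)

theorem isBoundaryless_addLeaf : (M.addLeaf hM x).IsBoundaryless :=
  isBoundaryless_cross (hM.sum isBoundaryless_lollipop)

theorem addLeaf_cornerFlip_inl (z : F) :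
    (M.addLeaf hM x).cornerFlip (.inl z) = .inl (M.cornerFlip z) := rfl

theorem addLeaf_cornerFlip_inr (i : Spur) :
    (M.addLeaf hM x).cornerFlip (.inr i) = .inr i.cornerFlip := rfl

theorem addLeaf_sideFlip_inl (z : F) :
    (M.addLeaf hM x).sideFlip (.inl z) = .inl (M.sideFlip z) := rfl

theorem addLeaf_sideFlip_inr (i : Spur) :
    (M.addLeaf hM x).sideFlip (.inr i) = .inr i.sideFlip := rfl

open scoped Classical in
theorem addLeaf_endFlip (z : F ⊕ Spur) : (M.addLeaf hM x).endFlip z =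
    Equiv.swap (.inl x) (.inr .y0) (Equiv.swap (.inl (M.sideFlip x)) (.inr .y1)
      ((M.sum lollipop).endFlip (Equiv.swap (.inl x) (.inr .y0)
        (Equiv.swap (.inl (M.sideFlip x)) (.inr .y1) z)))) := by
  rw [addLeaf, cross_endFlip, swapEnds_apply, swapEnds_apply]
  rfl

theorem addLeaf_endFlip_a0 : (M.addLeaf hM x).endFlip (.inr .a0) = .inr .b0 := by
  simp [addLeaf_endFlip, Equiv.swap_apply_def, sum, lollipop, Spur.endFlip]

theorem addLeaf_endFlip_a1 : (M.addLeaf hM x).endFlip (.inr .a1) = .inr .b1 := by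
  simp [addLeaf_endFlip, Equiv.swap_apply_def, sum, lollipop, Spur.endFlip]

theorem addLeaf_endFlip_b0 : (M.addLeaf hM x).endFlip (.inr .b0) = .inr .a0 := by
  simp [addLeaf_endFlip, Equiv.swap_apply_def, sum, lollipop, Spur.endFlip]

theorem addLeaf_endFlip_x0 : (M.addLeaf hM x).endFlip (.inr .x0) = .inl x := by
  simp [addLeaf_endFlip, Equiv.swap_apply_def, sum, lollipop, Spur.endFlip]

theorem addLeaf_endFlip_x1 : (M.addLeaf hM x).endFlip (.inr .x1) = .inl (M.sideFlip x) := by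
  have side_ne : M.sideFlip x ≠ x := hM x
  simp [addLeaf_endFlip, Equiv.swap_apply_def, sum, lollipop, Spur.endFlip, side_ne]

theorem addLeaf_endFlip_y0 : (M.addLeaf hM x).endFlip (.inr .y0) = .inl (M.endFlip x) := by
  simp [addLeaf_endFlip, Equiv.swap_apply_def, sum, M.endFlip_ne, M.endFlip_ne_sideFlip]

theorem addLeaf_endFlip_inl {z : F} (hx : z ≠ x) (hsx : z ≠ M.sideFlip x) (hex : M.endFlip z ≠ x)
    (hesx : M.endFlip z ≠ M.sideFlip x) :
    (M.addLeaf hM x).endFlip (.inl z) = .inl (M.endFlip z) := by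
  simp [addLeaf_endFlip, Equiv.swap_apply_def, sum, hx, hsx, hex, hesx]

/-- Each flag of `M` with a new leaf lies along an edge of `M`, and `retract` chooses a flag of that
edge on the same side. -/
def retract : F ⊕ Spur → F
  | .inl z => z
  | .inr .b0 | .inr .a1 | .inr .y0 => x
  | .inr .a0 | .inr .b1 | .inr .x0 => M.endFlip x
  | .inr .y1 => M.sideFlip x
  | .inr .x1 => M.endFlip (M.sideFlip x)

theorem retract_endFlip (z : F ⊕ Spur) :
    M.retract x ((M.addLeaf hM x).endFlip z) = M.endFlip (M.retract x z) := by
  classical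
  have retract_swap (w : F ⊕ Spur) : M.retract x (Equiv.swap (.inl x) (.inr .y0)
      (Equiv.swap (.inl (M.sideFlip x)) (.inr .y1) w)) = M.retract x w := by
    rw [Equiv.apply_swap_eq_self (v := M.retract x) (i := .inl x) (j := .inr .y0) rfl,
      Equiv.apply_swap_eq_self (v := M.retract x) (i := .inl (M.sideFlip x)) (j := .inr .y1) rfl]
  have retract_endFlip_sum (w : F ⊕ Spur) :
      M.retract x ((M.sum lollipop).endFlip w) = M.endFlip (M.retract x w) := by
    rcases w with w | (_ | _) <;>
      simp [sum, lollipop, Spur.endFlip, retract, M.endFlip_endFlip]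
  rw [addLeaf_endFlip, retract_swap, retract_endFlip_sum, retract_swap]

theorem retract_cornerFlip_inr (i : Spur) :
    M.retract x (.inr i.cornerFlip) = M.endFlip (M.retract x (.inr i)) := by
  cases i <;> simp [Spur.cornerFlip, retract, M.endFlip_endFlip]

theorem retract_sideFlip_inr (i : Spur) :
    M.retract x (.inr i.sideFlip) = M.endFlip (M.retract x (.inr i)) ∨
      M.retract x (.inr i.sideFlip) = M.sideFlip (M.retract x (.inr i)) := by
  cases i <;>
    simp [Spur.sideFlip, retract, M.endFlip_endFlip, M.endFlip_sideFlip, M.sideFlip_sideFlip]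

theorem exists_inl_endFlip_eq (z : F) : ∃ k : ℕ, .inl (M.endFlip z) = (M.addLeaf hM x).endFlip
    ((((M.addLeaf hM x).cornerFlip * (M.addLeaf hM x).endFlip) ^ k) (.inl z)) := by
  have endFlip_x : (M.addLeaf hM x).endFlip (.inl x) = .inr .x0 := by
    rw [← M.addLeaf_endFlip_x0 hM, endFlip_endFlip]
  have endFlip_sx : (M.addLeaf hM x).endFlip (.inl (M.sideFlip x)) = .inr .x1 := by
    rw [← M.addLeaf_endFlip_x1 hM, endFlip_endFlip]
  have endFlip_ex : (M.addLeaf hM x).endFlip (.inl (M.endFlip x)) = .inr .y0 := by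
    rw [← M.addLeaf_endFlip_y0 hM, endFlip_endFlip]
  have endFlip_esx : (M.addLeaf hM x).endFlip (.inl (M.endFlip (M.sideFlip x))) = .inr .y1 := by
    rw [M.endFlip_sideFlip, ← M.addLeaf_sideFlip_inl hM x, endFlip_sideFlip, endFlip_ex]; rfl
  have endFlip_y1 : (M.addLeaf hM x).endFlip (.inr .y1) = .inl (M.endFlip (M.sideFlip x)) := by
    rw [← endFlip_esx, endFlip_endFlip]
  have endFlip_b1 : (M.addLeaf hM x).endFlip (.inr .b1) = .inr .a1 := by
    rw [← M.addLeaf_endFlip_a1 hM, endFlip_endFlip]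
  by_cases hx : z = x
  · exact ⟨3, by simp [hx, pow_succ, endFlip_x, addLeaf_cornerFlip_inr, Spur.cornerFlip,
      addLeaf_endFlip_b0, addLeaf_endFlip_a1, addLeaf_endFlip_y0]⟩
  by_cases hex : M.endFlip z = x
  · obtain rfl : z = M.endFlip x := by rw [← hex, M.endFlip_endFlip]
    exact ⟨3, by simp [hex, pow_succ, endFlip_ex, addLeaf_cornerFlip_inr, Spur.cornerFlip,
      endFlip_b1, addLeaf_endFlip_a0, addLeaf_endFlip_x0]⟩
  by_cases hsx : z = M.sideFlip x
  · exact ⟨1, by simp [hsx, endFlip_sx, addLeaf_cornerFlip_inr, Spur.cornerFlip, endFlip_y1]⟩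
  by_cases hesx : M.endFlip z = M.sideFlip x
  · obtain rfl : z = M.endFlip (M.sideFlip x) := by rw [← hesx, M.endFlip_endFlip]
    exact ⟨1, by simp [hesx, endFlip_esx, addLeaf_cornerFlip_inr, Spur.cornerFlip,
      addLeaf_endFlip_x1]⟩
  · exact ⟨0, (M.addLeaf_endFlip_inl hM x hx hsx hex hesx).symm⟩

theorem faceOf_addLeaf_inl_endFlip (z : F) : (M.addLeaf hM x).faceOf (.inl (M.endFlip z)) =
    (M.addLeaf hM x).faceOf (.inl z) := by
  obtain ⟨k, hk⟩ := M.exists_inl_endFlip_eq hM x z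
  rw [hk, faceOf_endFlip, faceOf_mul_pow]

theorem faceOf_addLeaf_inl_retract (z : F ⊕ Spur) :
    (M.addLeaf hM x).faceOf (.inl (M.retract x z)) = (M.addLeaf hM x).faceOf z := by
  have corner (i : Spur) :
      (M.addLeaf hM x).faceOf (.inr i.cornerFlip) = (M.addLeaf hM x).faceOf (.inr i) :=
    faceOf_cornerFlip (M.addLeaf hM x) (.inr i)
  have x0 : (M.addLeaf hM x).faceOf (.inr .x0) = (M.addLeaf hM x).faceOf (.inl x) := by
    rw [← M.addLeaf_endFlip_x0 hM, faceOf_endFlip]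
  have x1 : (M.addLeaf hM x).faceOf (.inr .x1) =
      (M.addLeaf hM x).faceOf (.inl (M.sideFlip x)) := by
    rw [← M.addLeaf_endFlip_x1 hM, faceOf_endFlip]
  have y0 : (M.addLeaf hM x).faceOf (.inr .y0) = (M.addLeaf hM x).faceOf (.inl x) := by
    rw [← M.faceOf_addLeaf_inl_endFlip hM x x, ← M.addLeaf_endFlip_y0 hM, faceOf_endFlip]
  have b0 := (corner .x0).trans x0
  have b1 := (corner .y0).trans y0
  have a0 : (M.addLeaf hM x).faceOf (.inr .a0) = (M.addLeaf hM x).faceOf (.inl x) := by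
    rw [← M.addLeaf_endFlip_b0 hM x, faceOf_endFlip]; exact b0
  have a1 := (corner .a0).trans a0
  have y1 := (corner .x1).trans x1
  rcases z with z | (_ | _) <;>
    simp only [retract, faceOf_addLeaf_inl_endFlip]
  exacts [a0.symm, a1.symm, b0.symm, b1.symm, x0.symm, x1.symm, y0.symm, y1.symm]

/-- Adding a leaf keeps the faces. -/
noncomputable def addLeafFaceEquiv : (M.addLeaf hM x).Face ≃ M.Face where
  toFun := Face.lift (fun z => M.faceOf (M.retract x z))
    (fun z => by rw [retract_endFlip, faceOf_endFlip]) (by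
      rintro (z | i)
      · exact M.faceOf_cornerFlip z
      · rw [addLeaf_cornerFlip_inr, retract_cornerFlip_inr, faceOf_endFlip])
  invFun := Face.lift (fun z => (M.addLeaf hM x).faceOf (.inl z))
    (M.faceOf_addLeaf_inl_endFlip hM x) fun z => faceOf_cornerFlip (M.addLeaf hM x) (.inl z)
  left_inv := (faceOf_surjective _).forall.2 (M.faceOf_addLeaf_inl_retract hM x)
  right_inv := M.faceOf_surjective.forall.2 fun _ => rfl

theorem addLeafFaceEquiv_faceOf (z : F ⊕ Spur) :
    M.addLeafFaceEquiv hM x ((M.addLeaf hM x).faceOf z) = M.faceOf (M.retract x z) := rfl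

theorem isConnected_addLeaf_iff : (M.addLeaf hM x).IsConnected ↔ M.IsConnected := by
  constructor
  · refine fun h => isConnected_of_induction x fun P root hend hcorner hside z =>
      h.induction (P := fun w => P (M.retract x w)) (r := .inl x) root (fun w hw => ?_)
        (fun w hw => ?_) (fun w hw => ?_) (.inl z)
    · rw [retract_endFlip]
      exact hend _ hw
    · rcases w with w | i
      · exact hcorner _ hw
      · rw [addLeaf_cornerFlip_inr, retract_cornerFlip_inr]
        exact hend _ hw
    · rcases w with w | i
      · exact hside _ hw
      · rw [addLeaf_sideFlip_inr]
        rcases M.retract_sideFlip_inr x i with h | h <;> rw [h]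
        exacts [hend _ hw, hside _ hw]
  · refine fun h => isConnected_of_induction (.inl x) fun P root hend hcorner hside => ?_
    have of_faceOf_eq {w w' : F ⊕ Spur} (hw : P w)
        (hww' : (M.addLeaf hM x).faceOf w' = (M.addLeaf hM x).faceOf w) : P w' :=
      (mem_face_iff _).1 ((faceOf_eq_faceOf_iff _).1 hww') P hw hend hcorner
    have inl (z : F) : P (.inl z) :=
      h.induction (P := fun z => P (.inl z)) root
        (fun z hz => of_faceOf_eq hz (M.faceOf_addLeaf_inl_endFlip hM x z))
        (fun z => hcorner (.inl z)) (fun z => hside (.inl z)) z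
    exact fun z => of_faceOf_eq (inl _) (M.faceOf_addLeaf_inl_retract hM x z).symm

theorem isOrientable_addLeaf_iff : (M.addLeaf hM x).IsOrientable ↔ M.IsOrientable := by
  constructor
  · rintro ⟨c, hc⟩
    refine ⟨fun z => c (.inl z), fun z => ⟨?_, (hc (.inl z)).2.1, fun _ => (hc (.inl z)).2.2
      (M.isBoundaryless_addLeaf hM x _)⟩⟩
    have mul_pow (k : ℕ) (w : F ⊕ Spur) :
        c ((((M.addLeaf hM x).cornerFlip * (M.addLeaf hM x).endFlip) ^ k) w) = c w := by
      induction k generalizing w with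
      | zero => rfl
      | succ k ih =>
        rw [pow_succ, Equiv.Perm.mul_apply, ih, Equiv.Perm.mul_apply,
          Bool.eq_not_of_ne (hc _).2.1, Bool.eq_not_of_ne (hc w).1, Bool.not_not]
    obtain ⟨k, hk⟩ := M.exists_inl_endFlip_eq hM x z
    beta_reduce
    rw [hk, ← mul_pow k (.inl z)]
    exact (hc _).1
  · rintro ⟨c, hc⟩
    refine ⟨fun w => c (M.retract x w), fun w => ⟨?_, ?_, fun _ => ?_⟩⟩ <;> beta_reduce
    · rw [retract_endFlip]
      exact (hc _).1
    · rcases w with w | i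
      · exact (hc w).2.1
      · rw [addLeaf_cornerFlip_inr, retract_cornerFlip_inr]
        exact (hc _).1
    · rcases w with w | i
      · exact (hc w).2.2 (hM w)
      · rw [addLeaf_sideFlip_inr]
        rcases M.retract_sideFlip_inr x i with h | h <;> rw [h]
        exacts [(hc _).1, (hc _).2.2 (hM _)]

theorem isLeaf_addLeaf_inl (z : F) : (M.addLeaf hM x).IsLeaf (.inl z) ↔ M.IsLeaf z :=
  Sum.inl_injective.eq_iff

theorem isLeaf_addLeaf_inr (i : Spur) : (M.addLeaf hM x).IsLeaf (.inr i) ↔ i = .a0 ∨ i = .a1 := by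
  refine Sum.inr_injective.eq_iff.trans ?_
  revert i
  decide

theorem card_isLeaf_addLeaf [Finite F] :
    Nat.card {z // (M.addLeaf hM x).IsLeaf z} = Nat.card {z // M.IsLeaf z} + 2 := by
  have e : {z // (M.addLeaf hM x).IsLeaf z} ≃
      {z // M.IsLeaf z} ⊕ {i : Spur // i = .a0 ∨ i = .a1} :=
    Equiv.subtypeSum.trans (Equiv.sumCongr
      (Equiv.subtypeEquivRight (M.isLeaf_addLeaf_inl hM x))
      (Equiv.subtypeEquivRight (M.isLeaf_addLeaf_inr hM x)))
  rw [Nat.card_congr e, Nat.card_sum, Nat.card_eq_fintype_card (α := {i : Spur // _})]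
  rfl

theorem isSubcubic_addLeaf_iff : (M.addLeaf hM x).IsSubcubic ↔ M.IsSubcubic := by
  simp only [isSubcubic_iff, Sum.forall, addLeaf_cornerFlip_inl, addLeaf_sideFlip_inl,
    addLeaf_cornerFlip_inr, addLeaf_sideFlip_inr, Sum.inl_injective.eq_iff,
    Sum.inr_injective.eq_iff]
  exact and_iff_left (by decide)

theorem isLeafyCubic_addLeaf_iff [Finite F] {S : Surface} {n : ℕ} {r : F} :
    (M.addLeaf hM x).IsLeafyCubic S (n + 1) (.inl r) ↔ M.IsLeafyCubic S n r := by
  have card_flag : Nat.card (F ⊕ Spur) = Nat.card F + 8 := by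
    rw [Nat.card_sum, Nat.card_eq_fintype_card (α := Spur)]; rfl
  have card_face := Nat.card_congr (M.addLeafFaceEquiv hM x)
  have card_leaf := M.card_isLeaf_addLeaf hM x
  constructor <;> rintro ⟨-, h₁, h₂, h₃, h₄, h₅, h₆, h₇⟩
  · exact ⟨hM, (M.isConnected_addLeaf_iff hM x).1 h₁, (M.isSubcubic_addLeaf_iff hM x).1 h₂,
      (M.isLeaf_addLeaf_inl hM x r).1 h₃, by lia, by push_cast at h₅; lia,
      card_face ▸ h₆, by rw [← M.isOrientable_addLeaf_iff hM x, h₇]⟩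
  · exact ⟨M.isBoundaryless_addLeaf hM x, (M.isConnected_addLeaf_iff hM x).2 h₁,
      (M.isSubcubic_addLeaf_iff hM x).2 h₂, (M.isLeaf_addLeaf_inl hM x r).2 h₃, by lia,
      by push_cast; lia, card_face ▸ h₆, by rw [M.isOrientable_addLeaf_iff hM x, h₇]⟩

variable {M} {M' : CombMap F'}

theorem IsHom.addLeaf {φ : F ≃ F'} (h : M.IsHom M' φ) (hM' : M'.IsBoundaryless) :
    (M.addLeaf hM x).IsHom (M'.addLeaf hM' (φ x)) (Equiv.sumCongr φ (Equiv.refl Spur)) :=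
  (h.sumCongr lollipop).cross (hM.sum isBoundaryless_lollipop)
    (hM'.sum isBoundaryless_lollipop) (.inl x) (.inr .y0)

theorem IsHom.of_addLeaf {x' : F'} {hM : M.IsBoundaryless} {hM' : M'.IsBoundaryless}
    {Φ : F ⊕ Spur ≃ F' ⊕ Spur} (h : (M.addLeaf hM x).IsHom (M'.addLeaf hM' x') Φ)
    (ha : Φ (.inr .a0) = .inr .a0) :
    ∃ φ : F ≃ F', M.IsHom M' φ ∧ (∀ z, Φ (.inl z) = .inl (φ z)) ∧ φ x = x' := by
  have corner {i : Spur} (hi : Φ (.inr i) = .inr i) :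
      Φ (.inr i.cornerFlip) = .inr i.cornerFlip := by
    rw [← M.addLeaf_cornerFlip_inr hM x, h.map_cornerFlip, hi, addLeaf_cornerFlip_inr]
  have side {i : Spur} (hi : Φ (.inr i) = .inr i) : Φ (.inr i.sideFlip) = .inr i.sideFlip := by
    rw [← M.addLeaf_sideFlip_inr hM x, h.map_sideFlip, hi, addLeaf_sideFlip_inr]
  have b0 : Φ (.inr .b0) = .inr .b0 := by
    rw [← M.addLeaf_endFlip_a0 hM x, h.map_endFlip, ha, addLeaf_endFlip_a0]
  have x0 : Φ (.inr .x0) = .inr .x0 := corner b0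
  obtain ⟨φ, rfl⟩ := exists_eq_sumCongr_refl (Φ := Φ) <| by
    rintro (_ | _)
    exacts [ha, side ha, b0, side b0, x0, side x0, corner (side b0), side (corner (side b0))]
  have map_x : φ x = x' := Sum.inl_injective <| by
    have := h.map_endFlip (.inr .x0)
    rwa [x0, addLeaf_endFlip_x0, addLeaf_endFlip_x0] at this
  have h_sum : (M.sum lollipop).IsHom (M'.sum lollipop) (Equiv.sumCongr φ (Equiv.refl Spur)) := by
    have := h.cross (M.isBoundaryless_addLeaf hM x) (M'.isBoundaryless_addLeaf hM' x')
      (.inl x) (.inr .y0)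
    rw [Equiv.sumCongr_apply, Sum.map_inl, map_x] at this
    rwa [← cross_cross (M := M.sum lollipop) (x := .inl x) (y := .inr .y0)
      (hM.sum isBoundaryless_lollipop), ← cross_cross (M := M'.sum lollipop) (x := .inl x')
      (y := .inr .y0) (hM'.sum isBoundaryless_lollipop)]
  exact ⟨φ, ⟨fun z => Sum.inl_injective (h_sum.map_endFlip (.inl z)),
    fun z => Sum.inl_injective (h_sum.map_cornerFlip (.inl z)),
    fun z => Sum.inl_injective (h_sum.map_sideFlip (.inl z))⟩, fun z => rfl, map_x⟩

end AddLeaf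

section DeleteLeaf

variable {F G : Type*} {M : CombMap F} {a : F}

/-- The restriction of a map to the complement of a union of components, which is given as the image
of an embedding of another map. -/
def restrictCompl (M : CombMap F) {N : CombMap G} {f : G → F} (hf : N.IsHom M f) :
    CombMap ↥(Set.range f)ᶜ where
  endFlip := Function.Involutive.toPerm (fun z => ⟨M.endFlip z, by
    rintro ⟨i, hi⟩
    exact z.2 ⟨N.endFlip i, by rw [hf.map_endFlip, hi, M.endFlip_endFlip]⟩⟩)
    fun z => Subtype.ext (M.endFlip_endFlip z)
  cornerFlip := Function.Involutive.toPerm (fun z => ⟨M.cornerFlip z, by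
    rintro ⟨i, hi⟩
    exact z.2 ⟨N.cornerFlip i, by rw [hf.map_cornerFlip, hi, M.cornerFlip_cornerFlip]⟩⟩)
    fun z => Subtype.ext (M.cornerFlip_cornerFlip z)
  sideFlip := Function.Involutive.toPerm (fun z => ⟨M.sideFlip z, by
    rintro ⟨i, hi⟩
    exact z.2 ⟨N.sideFlip i, by rw [hf.map_sideFlip, hi, M.sideFlip_sideFlip]⟩⟩)
    fun z => Subtype.ext (M.sideFlip_sideFlip z)
  endFlip_endFlip z := Subtype.ext (M.endFlip_endFlip z)
  cornerFlip_cornerFlip z := Subtype.ext (M.cornerFlip_cornerFlip z)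
  sideFlip_sideFlip z := Subtype.ext (M.sideFlip_sideFlip z)
  endFlip_sideFlip z := Subtype.ext (M.endFlip_sideFlip z)
  endFlip_ne z h := M.endFlip_ne z (congrArg Subtype.val h)
  cornerFlip_ne z h := M.cornerFlip_ne z (congrArg Subtype.val h)
  endFlip_ne_sideFlip z h := M.endFlip_ne_sideFlip z (congrArg Subtype.val h)

theorem isHom_sumElim_restrictCompl {N : CombMap G} {f : G → F} (hf : N.IsHom M f) :
    ((M.restrictCompl hf).sum N).IsHom M (Sum.elim Subtype.val f) where
  map_endFlip := Sum.forall.2 ⟨fun _ => rfl, hf.map_endFlip⟩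
  map_cornerFlip := Sum.forall.2 ⟨fun _ => rfl, hf.map_cornerFlip⟩
  map_sideFlip := Sum.forall.2 ⟨fun _ => rfl, hf.map_sideFlip⟩

theorem bijective_sumElim_compl_range {f : G → F} (hf : Function.Injective f) :
    Function.Bijective (Sum.elim (Subtype.val : ↥(Set.range f)ᶜ → F) f) := by
  refine ⟨Subtype.val_injective.sumElim hf fun z i h => z.2 ⟨i, h.symm⟩, fun z => ?_⟩
  by_cases hz : z ∈ Set.range f
  · exact hz.imp' .inr fun _ => id
  · exact ⟨.inl ⟨z, hz⟩, rfl⟩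

/-- The flags of a leaf `a` of a map whose other vertices have degree three, labelled as those that
`CombMap.addLeaf` would have added. -/
def spurAt (M : CombMap F) (a : F) : Spur → F
  | .a0 => a
  | .a1 => M.sideFlip a
  | .b0 => M.endFlip a
  | .b1 => M.endFlip (M.sideFlip a)
  | .x0 => M.cornerFlip (M.endFlip a)
  | .x1 => M.sideFlip (M.cornerFlip (M.endFlip a))
  | .y0 => M.cornerFlip (M.endFlip (M.sideFlip a))
  | .y1 => M.sideFlip (M.cornerFlip (M.endFlip (M.sideFlip a)))

theorem spurAt_sideFlip (i : Spur) : M.spurAt a i.sideFlip = M.sideFlip (M.spurAt a i) := by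
  cases i <;> simp [spurAt, Spur.sideFlip, M.sideFlip_sideFlip, M.endFlip_sideFlip]

theorem spurAt_cornerFlip (hM : M.IsSubcubic) (ha : M.IsLeaf a) (i : Spur) :
    M.spurAt a i.cornerFlip = M.cornerFlip (M.spurAt a i) := by
  have corner_a0 : M.cornerFlip a = M.sideFlip a := ha
  have corner_a1 : M.cornerFlip (M.sideFlip a) = a := by rw [← ha, M.cornerFlip_cornerFlip]
  have corner_y1 : M.cornerFlip (M.sideFlip (M.cornerFlip (M.sideFlip (M.endFlip a)))) =
      M.sideFlip (M.cornerFlip (M.endFlip a)) := by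
    rw [← M.sideFlip_involutive.eq_iff, ← M.cornerFlip_involutive.eq_iff]
    exact isSubcubic_iff.1 hM _
  have corner_x1 : M.cornerFlip (M.sideFlip (M.cornerFlip (M.endFlip a))) =
      M.sideFlip (M.cornerFlip (M.sideFlip (M.endFlip a))) := by
    rw [← corner_y1, M.cornerFlip_cornerFlip]
  cases i <;> simp [spurAt, Spur.cornerFlip, M.cornerFlip_cornerFlip, M.endFlip_sideFlip,
    corner_a0, corner_a1, corner_x1, corner_y1]

theorem vertex_spurAt_subset (hM : M.IsSubcubic) (ha : M.IsLeaf a) (i : Spur) :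
    M.vertex (M.spurAt a i) ⊆ Set.range (M.spurAt a) := fun _ hz =>
  (mem_orbit_closure_pair_iff M.cornerFlip_involutive M.sideFlip_involutive).1 hz
    (· ∈ Set.range (M.spurAt a)) ⟨i, rfl⟩
    (Set.forall_mem_range.2 fun i => ⟨_, spurAt_cornerFlip hM ha i⟩)
    (Set.forall_mem_range.2 fun i => ⟨_, spurAt_sideFlip i⟩)

theorem spurAt_injective [Finite F] (hM : M.IsBoundaryless) (hc : M.IsSubcubic) (ha : M.IsLeaf a)
    (hb : ¬M.IsLeaf (M.endFlip a)) : Function.Injective (M.spurAt a) := by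
  have degree_a : M.vertexDegree a = 1 := hM.vertexDegree_eq_one_iff.2 ha
  have degree_b : M.vertexDegree (M.endFlip a) = 3 := by
    rw [isLeaf_iff_minimalPeriod] at hb
    exact (hM.vertexDegree_eq _).trans ((isSubcubic_iff_minimalPeriod.1 hc _).resolve_left hb)
  have disjoint : Disjoint (M.vertex a) (M.vertex (M.endFlip a)) := by
    refine (MulAction.orbit.eq_or_disjoint _ _).resolve_left fun h => ?_
    have := congrArg Set.ncard h
    rw [← vertex, ← vertex, hM.ncard_vertex, hM.ncard_vertex, degree_a, degree_b] at this
    lia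
  have card_le : 8 ≤ (Set.range (M.spurAt a)).ncard :=
    calc 8 = (M.vertex a ∪ M.vertex (M.endFlip a)).ncard := by
          rw [Set.ncard_union_eq disjoint, hM.ncard_vertex, hM.ncard_vertex, degree_a, degree_b]
      _ ≤ (Set.range (M.spurAt a)).ncard := Set.ncard_le_ncard <|
          Set.union_subset (vertex_spurAt_subset hc ha .a0) (vertex_spurAt_subset hc ha .b0)
  rw [← Set.image_univ] at card_le
  have card_univ : (Set.univ : Set Spur).ncard = 8 := by
    rw [Set.ncard_univ, Nat.card_eq_fintype_card]; rfl
  exact Set.injOn_univ.1 <|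
    Set.injOn_of_ncard_image_eq ((Set.ncard_image_le).antisymm (card_univ.trans_le card_le))

theorem isLeaf_spurAt_iff (hM : M.IsSubcubic) (ha : M.IsLeaf a)
    (hinj : Function.Injective (M.spurAt a)) (i : Spur) :
    M.IsLeaf (M.spurAt a i) ↔ i = .a0 ∨ i = .a1 := by
  rw [IsLeaf, ← spurAt_sideFlip, ← spurAt_cornerFlip hM ha, hinj.eq_iff]
  revert i
  decide

theorem endFlip_y0_mem_range_spurAt (hinj : Function.Injective (M.spurAt a))
    (hx : M.endFlip (M.spurAt a .x0) ∈ Set.range (M.spurAt a)) :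
    M.endFlip (M.spurAt a .y0) ∈ Set.range (M.spurAt a) := by
  obtain ⟨j, hj⟩ := hx
  have x0_eq : M.spurAt a .x0 = M.endFlip (M.spurAt a j) := by rw [hj, M.endFlip_endFlip]
  cases j with
  | a0 => exact absurd (hinj (a₂ := .b0) x0_eq) nofun
  | a1 => exact absurd (hinj (a₂ := .b1) x0_eq) nofun
  | b0 => exact absurd (hinj (a₂ := .a0) (x0_eq.trans (M.endFlip_endFlip _))) nofun
  | b1 => exact absurd (hinj (a₂ := .a1) (x0_eq.trans (M.endFlip_endFlip _))) nofun
  | x0 => exact absurd hj.symm (M.endFlip_ne _)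
  | x1 => exact absurd hj.symm (M.endFlip_ne_sideFlip _)
  | y0 => exact ⟨.x0, x0_eq⟩
  | y1 =>
    refine ⟨.x1, ?_⟩
    rw [show Spur.x1 = Spur.sideFlip .x0 from rfl, spurAt_sideFlip, x0_eq, ← M.endFlip_sideFlip,
      ← spurAt_sideFlip]
    rfl

theorem endFlip_x0_notMem_range_spurAt (hM : M.IsSubcubic) (hconn : M.IsConnected)
    (ha : M.IsLeaf a) (hinj : Function.Injective (M.spurAt a)) {r : F}
    (hr : r ∉ Set.range (M.spurAt a)) :
    M.endFlip (M.spurAt a .x0) ∉ Set.range (M.spurAt a) := by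
  intro hx0
  have hy0 := endFlip_y0_mem_range_spurAt hinj hx0
  have side {z : F} (hz : M.endFlip z ∈ Set.range (M.spurAt a)) :
      M.endFlip (M.sideFlip z) ∈ Set.range (M.spurAt a) := by
    obtain ⟨i, hi⟩ := hz
    exact ⟨i.sideFlip, by rw [spurAt_sideFlip, hi, M.endFlip_sideFlip]⟩
  refine hr (hconn.induction (P := (· ∈ Set.range (M.spurAt a))) ⟨.a0, rfl⟩
    (Set.forall_mem_range.2 ?_) (Set.forall_mem_range.2 fun i => ⟨_, spurAt_cornerFlip hM ha i⟩)
    (Set.forall_mem_range.2 fun i => ⟨_, spurAt_sideFlip i⟩) r)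
  rintro (_ | _)
  exacts [⟨.b0, rfl⟩, ⟨.b1, rfl⟩, ⟨.a0, (M.endFlip_endFlip _).symm⟩,
    ⟨.a1, (M.endFlip_endFlip _).symm⟩, hx0, side hx0, hy0, side hy0]

theorem isHom_spurAt_cross (hM : M.IsBoundaryless) (hc : M.IsSubcubic) (ha : M.IsLeaf a)
    (hinj : Function.Injective (M.spurAt a))
    (hx : M.endFlip (M.spurAt a .x0) ∉ Set.range (M.spurAt a)) :
    lollipop.IsHom (M.cross hM (M.endFlip (M.spurAt a .x0)) (M.spurAt a .y0)) (M.spurAt a) := by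
  classical
  set u := M.endFlip (M.spurAt a .x0) with hu
  have hsu (i : Spur) : M.spurAt a i ≠ M.sideFlip u := fun h =>
    hx ⟨i.sideFlip, by rw [spurAt_sideFlip, h, M.sideFlip_sideFlip]⟩
  have swap_y0 : M.swapEnds u (M.spurAt a .y0) (M.spurAt a .y0) = u := by
    rw [swapEnds_apply, Equiv.swap_apply_of_ne_of_ne (hsu _) fun h => hM _ h.symm,
      Equiv.swap_apply_right]
  have swap_u : M.swapEnds u (M.spurAt a .y0) u = M.spurAt a .y0 := by
    nth_rw 2 [← swap_y0]
    exact hM.swapEnds_swapEnds _ _ _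
  have swap_of_ne {i : Spur} (h0 : i ≠ .y0) (h1 : i ≠ .y1) :
      M.swapEnds u (M.spurAt a .y0) (M.spurAt a i) = M.spurAt a i := by
    rw [swapEnds_apply, Equiv.swap_apply_of_ne_of_ne (hsu i) fun h =>
        h1 (hinj (h.trans (spurAt_sideFlip .y0).symm)),
      Equiv.swap_apply_of_ne_of_ne (fun h => hx ⟨i, h⟩) (hinj.ne h0)]
  have side {i j : Spur}
      (h : M.spurAt a j = (M.cross hM u (M.spurAt a .y0)).endFlip (M.spurAt a i)) :
      M.spurAt a j.sideFlip =
        (M.cross hM u (M.spurAt a .y0)).endFlip (M.spurAt a i.sideFlip) := by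
    rw [spurAt_sideFlip, spurAt_sideFlip]
    exact (congrArg _ h).trans ((M.cross hM u _).endFlip_sideFlip _).symm
  refine ⟨?_, spurAt_cornerFlip hc ha, spurAt_sideFlip⟩
  have a0 : M.spurAt a .b0 = (M.cross hM u (M.spurAt a .y0)).endFlip (M.spurAt a .a0) := by
    rw [cross_endFlip, swap_of_ne (i := .a0) nofun nofun]
    exact (swap_of_ne (i := .b0) nofun nofun).symm
  have b0 : M.spurAt a .a0 = (M.cross hM u (M.spurAt a .y0)).endFlip (M.spurAt a .b0) := by
    rw [a0, endFlip_endFlip]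
  have x0 : M.spurAt a .y0 = (M.cross hM u (M.spurAt a .y0)).endFlip (M.spurAt a .x0) := by
    rw [cross_endFlip, swap_of_ne (i := .x0) nofun nofun, ← hu, swap_u]
  have y0 : M.spurAt a .x0 = (M.cross hM u (M.spurAt a .y0)).endFlip (M.spurAt a .y0) := by
    rw [← endFlip_endFlip _ (M.spurAt a .x0), ← x0]
  rintro (_ | _)
  exacts [a0, side a0, b0, side b0, x0, side x0, y0, side y0]

theorem exists_isHom_addLeaf [Finite F] (hM : M.IsBoundaryless) (hc : M.IsSubcubic)
    (hconn : M.IsConnected) (ha : M.IsLeaf a) (hb : ¬M.IsLeaf (M.endFlip a)) {r : F}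
    (hr : M.IsLeaf r) (hra : r ≠ a) (hrsa : r ≠ M.sideFlip a) :
    ∃ (s : Set F) (M₀ : CombMap s) (hM₀ : M₀.IsBoundaryless) (x r₀ : s) (Φ : s ⊕ Spur ≃ F),
      (M₀.addLeaf hM₀ x).IsHom M Φ ∧ Φ (.inr .a0) = a ∧ Φ (.inl r₀) = r := by
  have hinj := spurAt_injective hM hc ha hb
  have r_notMem : r ∉ Set.range (M.spurAt a) := by
    rintro ⟨i, rfl⟩
    rcases (isLeaf_spurAt_iff hc ha hinj i).1 hr with rfl | rfl
    exacts [hra rfl, hrsa rfl]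
  have hx := endFlip_x0_notMem_range_spurAt hc hconn ha hinj r_notMem
  have hN := isHom_spurAt_cross hM hc ha hinj hx
  have hM₀ : (restrictCompl _ hN).IsBoundaryless := fun z h => hM z (congrArg Subtype.val h)
  let Φ := Equiv.ofBijective _ (bijective_sumElim_compl_range hinj)
  have hΦ : ((restrictCompl _ hN).addLeaf hM₀ ⟨_, hx⟩).IsHom
      ((M.cross hM _ _).cross (isBoundaryless_cross hM) (M.endFlip (M.spurAt a .x0))
        (M.spurAt a .y0)) Φ :=
    IsHom.cross (φ := Φ) (isHom_sumElim_restrictCompl hN) _ _ (.inl ⟨_, hx⟩) (.inr .y0)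
  rw [cross_cross] at hΦ
  exact ⟨_, restrictCompl _ hN, hM₀, ⟨_, hx⟩, ⟨r, r_notMem⟩, Φ, hΦ, rfl, rfl⟩

theorem IsConnected.card_le_four (hM : M.IsConnected) (ha : M.IsLeaf a)
    (hb : M.IsLeaf (M.endFlip a)) : Nat.card F ≤ 4 := by
  have corner_sideFlip {z : F} (hz : M.IsLeaf z) : M.cornerFlip (M.sideFlip z) = z := by
    rw [← hz, M.cornerFlip_cornerFlip]
  have eq_univ : ({a, M.sideFlip a, M.endFlip a, M.sideFlip (M.endFlip a)} : Set F) = Set.univ :=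
    Set.eq_univ_of_forall <| hM.induction (r := a) (by simp)
      (by rintro z (rfl | rfl | rfl | rfl) <;> simp [M.endFlip_endFlip, M.endFlip_sideFlip])
      (by
        rintro z (rfl | rfl | rfl | rfl)
        · exact .inr (.inl ha)
        · exact .inl (corner_sideFlip ha)
        · exact .inr (.inr (.inr hb))
        · exact .inr (.inr (.inl (corner_sideFlip hb))))
      (by rintro z (rfl | rfl | rfl | rfl) <;> simp [M.sideFlip_sideFlip])
  rw [← Set.ncard_univ, ← eq_univ]
  exact (Set.ncard_insert_le _ _).trans (Nat.succ_le_succ ((Set.ncard_insert_le _ _).trans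
    (Nat.succ_le_succ ((Set.ncard_insert_le _ _).trans (by simp)))))

theorem IsLeafyCubic.not_isLeaf_endFlip [Finite F] {S : Surface} {n : ℕ} {r : F}
    (h : M.IsLeafyCubic S n r) (hS : S.eulerChar ≤ 0) (ha : M.IsLeaf a) :
    ¬M.IsLeaf (M.endFlip a) := by
  intro hb
  have card_le := h.connected.card_le_four ha hb
  have card_flag := h.card_flag
  have card_leaf := h.card_leaf
  have : Nonempty {x // M.IsLeaf x} := ⟨⟨r, h.root⟩⟩
  have card_pos := Nat.card_pos (α := {x // M.IsLeaf x})
  lia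

theorem IsLeafyCubic.exists_isHom_addLeaf [Finite F] {S : Surface} {n : ℕ} {r : F}
    (h : M.IsLeafyCubic S (n + 1) r) (hS : S.eulerChar ≤ 0) (ha : M.IsLeaf a) (hra : r ≠ a)
    (hrsa : r ≠ M.sideFlip a) :
    ∃ (s : Set F) (M₀ : CombMap s) (hM₀ : M₀.IsBoundaryless) (x r₀ : s) (Φ : s ⊕ Spur ≃ F),
      (M₀.addLeaf hM₀ x).IsHom M Φ ∧ Φ (.inr .a0) = a ∧ Φ (.inl r₀) = r := by
  exact CombMap.exists_isHom_addLeaf h.boundaryless h.subcubic h.connected ha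
    (h.not_isLeaf_endFlip hS ha) h.root hra hrsa

end DeleteLeaf

end CombMap

section LeafyCount

open CombMap RootedMap

variable {S : Surface} {n : ℕ}

/-- The isomorphism classes of the maps of `CombMap.IsLeafyCubic S n`. -/
def leafyClasses (S : Surface) (n : ℕ) : Set (Quotient RootedMap.setoid) :=
  classes fun R => R.toMap.IsLeafyCubic S n R.root

theorem leafyClasses_finite (S : Surface) (n : ℕ) : (leafyClasses S n).Finite :=
  classes_finite (N := (8 * n - 12 * S.eulerChar).toNat) fun R h => by
    have := h.card_flag
    rw [Nat.card_fin] at this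
    lia

noncomputable instance (S : Surface) (n : ℕ) : Fintype (leafyClasses S n) :=
  (leafyClasses_finite S n).fintype

theorem isLeafyCubic_out (q : leafyClasses S n) :
    q.1.out.toMap.IsLeafyCubic S n q.1.out.root := by
  obtain ⟨R, hR, h⟩ := q.2
  exact h.of_pointedIso (mk_eq_mk_iff.1 (by rw [hR, Quotient.out_eq]))

/-- The number of flags of the maps of `CombMap.IsLeafyCubic S n`. -/
def flagCount (S : Surface) (n : ℕ) : ℝ := 8 * n - 12 * S.eulerChar

theorem numFlags_out (q : leafyClasses S n) : q.1.out.numFlags = flagCount S n := by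
  have := (isLeafyCubic_out q).card_flag
  rw [Nat.card_fin] at this
  rw [flagCount]
  exact_mod_cast this

theorem mk_ofMap_mem_leafyClasses {F : Type*} [Finite F] {M : CombMap F} {r : F}
    (h : M.IsLeafyCubic S n r) : ⟦ofMap M r⟧ ∈ leafyClasses S n :=
  ⟨_, rfl, h.of_pointedIso (pointedIso_ofMap M r)⟩

theorem pointedIso_out_iff {F : Type*} [Finite F] {M : CombMap F} {r : F}
    {q : Quotient RootedMap.setoid} :
    M.PointedIso r q.out.toMap q.out.root ↔ q = ⟦ofMap M r⟧ := by
  rw [← mk_ofMap_eq_iff, mk_ofMap_toMap, Quotient.out_eq, eq_comm]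

/-- The isomorphism class of the map obtained from a representative of `q` by growing a leaf at
the flag `x`. -/
noncomputable def grow (q : leafyClasses S n) (x : Fin q.1.out.numFlags) :
    Quotient RootedMap.setoid :=
  ⟦ofMap (q.1.out.toMap.addLeaf (isLeafyCubic_out q).boundaryless x) (.inl q.1.out.root)⟧

/-- The flags at the leaves other than the root-vertex. -/
def NonrootLeaf {F : Type*} (M : CombMap F) (r : F) : Type _ :=
  {y // M.IsLeaf y ∧ r ≠ y ∧ r ≠ M.sideFlip y}

noncomputable instance {F : Type*} [Finite F] (M : CombMap F) (r : F) : Fintype (NonrootLeaf M r) :=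
  @Fintype.ofFinite _ (inferInstanceAs (Finite {y // M.IsLeaf y ∧ r ≠ y ∧ r ≠ M.sideFlip y}))

theorem card_nonrootLeaf {F : Type*} [Finite F] {M : CombMap F} {r : F}
    (h : M.IsLeafyCubic S (n + 1) r) : Fintype.card (NonrootLeaf M r) = 2 * n := by
  have card_eq : Fintype.card (NonrootLeaf M r) = ({y | M.IsLeaf y} \ {r, M.sideFlip r}).ncard := by
    rw [← Nat.card_eq_fintype_card, ← Nat.card_coe_set_eq]
    refine Nat.card_congr (Equiv.subtypeEquivRight fun y => ?_)
    have eq_sideFlip_comm : r = M.sideFlip y ↔ y = M.sideFlip r :=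
      ⟨fun e => by rw [e, M.sideFlip_sideFlip], fun e => by rw [e, M.sideFlip_sideFlip]⟩
    simp only [Set.mem_sdiff, Set.mem_ofPred_eq, Set.mem_insert_iff, Set.mem_singleton_iff, not_or]
    rw [Ne, Ne, eq_sideFlip_comm, eq_comm]
  have card_leaf : {y | M.IsLeaf y}.ncard = 2 * (n + 1) := h.card_leaf
  rw [card_eq, Set.ncard_sdiff, Set.ncard_pair (Ne.symm (h.boundaryless r)), card_leaf]
  · lia
  · rintro y (rfl | rfl)
    exacts [h.root, h.root.sideFlip]

/-- The map of `b`, with its marked leaf, is obtained from the map of `a` by growing a leaf at the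
marked flag. -/
def IsGrowth (a : Σ q : leafyClasses S n, Fin q.1.out.numFlags)
    (b : Σ q : leafyClasses S (n + 1), NonrootLeaf q.1.out.toMap q.1.out.root) : Prop :=
  ∃ Φ : Fin a.1.1.out.numFlags ⊕ Spur ≃ Fin b.1.1.out.numFlags,
    (a.1.1.out.toMap.addLeaf (isLeafyCubic_out a.1).boundaryless a.2).IsHom b.1.1.out.toMap Φ ∧
      Φ (.inl a.1.1.out.root) = b.1.1.out.root ∧ Φ (.inr .a0) = b.2.1

section IsGrowth

variable {a a' : Σ q : leafyClasses S n, Fin q.1.out.numFlags}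
  {b b' : Σ q : leafyClasses S (n + 1), NonrootLeaf q.1.out.toMap q.1.out.root}

theorem IsGrowth.eq_grow (h : IsGrowth a b) : b.1.1 = grow a.1 a.2 := by
  obtain ⟨Φ, hΦ, hroot, -⟩ := h
  exact pointedIso_out_iff.1 ⟨Φ, hΦ, hroot⟩

theorem exists_isGrowth (a : Σ q : leafyClasses S n, Fin q.1.out.numFlags) :
    ∃ b, IsGrowth a b := by
  obtain ⟨q, x⟩ := a
  have hq := isLeafyCubic_out q
  obtain ⟨Φ, hΦ, hroot⟩ := pointedIso_out_iff.2 (Eq.refl (grow q x))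
  have hmem : grow q x ∈ leafyClasses S (n + 1) :=
    mk_ofMap_mem_leafyClasses ((isLeafyCubic_addLeaf_iff _ _ _).2 hq)
  refine ⟨⟨⟨_, hmem⟩, Φ (.inr .a0), ?_, fun h => ?_, fun h => ?_⟩, Φ, hΦ, hroot, rfl⟩
  · exact (hΦ.isLeaf_iff Φ.injective _).2 ((isLeaf_addLeaf_inr _ _ _ _).2 (.inl rfl))
  · exact Sum.inl_ne_inr (Φ.injective (hroot.trans h))
  · exact Sum.inl_ne_inr (Φ.injective (hroot.trans (h.trans (hΦ.map_sideFlip (.inr .a0)).symm)))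

theorem IsGrowth.right_unique (h : IsGrowth a b) (h' : IsGrowth a b') : b = b' := by
  obtain ⟨q, y⟩ := b
  obtain ⟨q', y'⟩ := b'
  obtain rfl : q = q' := Subtype.ext (h.eq_grow.trans h'.eq_grow.symm)
  obtain ⟨Φ, hΦ, hroot, hy⟩ := h
  obtain ⟨Φ', hΦ', hroot', hy'⟩ := h'
  have h_conn := (isConnected_addLeaf_iff _ (isLeafyCubic_out a.1).boundaryless a.2).2
    (isLeafyCubic_out a.1).connected
  have h_eq := h_conn.isHom_unique hΦ hΦ' (hroot.trans hroot'.symm)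
  exact congrArg (Sigma.mk q) (Subtype.ext (by rw [← hy, ← hy', h_eq]))

theorem IsGrowth.left_unique (h : IsGrowth a b) (h' : IsGrowth a' b) : a = a' := by
  obtain ⟨q, x⟩ := a
  obtain ⟨q', x'⟩ := a'
  obtain ⟨Φ, hΦ, hroot, hy⟩ := h
  obtain ⟨Φ', hΦ', hroot', hy'⟩ := h'
  obtain ⟨φ, hφ, h_inl, hx⟩ := IsHom.of_addLeaf (Φ := Φ.trans Φ'.symm) _ (hΦ'.symm.comp hΦ)
    (by rw [Equiv.trans_apply, hy, ← hy', Equiv.symm_apply_apply])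
  have map_root : φ q.1.out.root = q'.1.out.root := Sum.inl_injective <| by
    rw [← h_inl, Equiv.trans_apply, hroot, ← hroot', Equiv.symm_apply_apply]
  obtain rfl : q = q' := Subtype.ext <| by
    rw [← Quotient.out_eq q.1, ← Quotient.out_eq q'.1]
    exact mk_eq_mk_iff.2 ⟨φ, hφ, map_root⟩
  have φ_eq := (isLeafyCubic_out q).connected.isHom_unique hφ (IsHom.id _) map_root
  exact congrArg (Sigma.mk q) ((congrFun φ_eq x).symm.trans hx)

theorem exists_isGrowth_of_eulerChar_nonpos (hS : S.eulerChar ≤ 0)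
    (b : Σ q : leafyClasses S (n + 1), NonrootLeaf q.1.out.toMap q.1.out.root) :
    ∃ a, IsGrowth a b := by
  obtain ⟨q', y, hy, hry, hrsy⟩ := b
  have hq' := isLeafyCubic_out q'
  obtain ⟨s, M, hM, x, r, Φ, hΦ, hΦy, hΦr⟩ := hq'.exists_isHom_addLeaf hS hy hry hrsy
  have hMn : M.IsLeafyCubic S n r := by
    rw [← M.isLeafyCubic_addLeaf_iff hM x]
    exact hq'.of_pointedIso (PointedIso.symm ⟨Φ, hΦ, hΦr⟩)
  obtain ⟨ψ, hψ, hψr⟩ := pointedIso_out_iff.2 (Eq.refl ⟦ofMap M r⟧)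
  let q : leafyClasses S n := ⟨_, mk_ofMap_mem_leafyClasses hMn⟩
  let Ψ := Equiv.sumCongr ψ (Equiv.refl Spur)
  have hΨ : (M.addLeaf hM x).IsHom
      (q.1.out.toMap.addLeaf (isLeafyCubic_out q).boundaryless (ψ x)) Ψ := hψ.addLeaf hM x _
  refine ⟨⟨q, ψ x⟩, Ψ.symm.trans Φ, hΦ.comp hΨ.symm, ?_, ?_⟩
  · have : Ψ.symm (.inl q.1.out.root) = .inl r := Ψ.symm_apply_eq.2 (congrArg Sum.inl hψr.symm)
    rw [Equiv.trans_apply, this, hΦr]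
  · exact hΦy

end IsGrowth

theorem sum_leafyClasses_succ (hS : S.eulerChar ≤ 0) (n : ℕ) (g : Quotient RootedMap.setoid → ℝ) :
    2 * n * ∑ q : leafyClasses S (n + 1), g q =
      ∑ q : leafyClasses S n, ∑ x : Fin q.1.out.numFlags, g (grow q x) := by
  choose e he using exists_isGrowth (S := S) (n := n)
  have e_bijective : Function.Bijective e := by
    refine ⟨fun a a' h => (he a).left_unique (h ▸ he a'), fun b => ?_⟩
    obtain ⟨a, ha⟩ := exists_isGrowth_of_eulerChar_nonpos hS b
    exact ⟨a, (he a).right_unique ha⟩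
  have sum_eq : ∑ a : Σ q : leafyClasses S n, Fin q.1.out.numFlags, g (grow a.1 a.2) =
      ∑ b : Σ q : leafyClasses S (n + 1), NonrootLeaf q.1.out.toMap q.1.out.root, g b.1.1 :=
    Fintype.sum_bijective e e_bijective _ _ fun a => by rw [(he a).eq_grow]
  rw [Fintype.sum_sigma, Fintype.sum_sigma] at sum_eq
  simp only [sum_eq, Finset.sum_const, Finset.card_univ, card_nonrootLeaf (isLeafyCubic_out _),
    nsmul_eq_mul, Finset.mul_sum, Nat.cast_mul, Nat.cast_ofNat]

theorem card_leafyClasses_succ (hS : S.eulerChar ≤ 0) (n : ℕ) :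
    2 * n * (Fintype.card (leafyClasses S (n + 1)) : ℝ) =
      flagCount S n * Fintype.card (leafyClasses S n) := by
  have h := sum_leafyClasses_succ hS n fun _ => 1
  simp only [Finset.sum_const, Finset.card_univ, nsmul_eq_mul, mul_one, Fintype.card_fin,
    numFlags_out] at h
  rw [h, mul_comm]

end LeafyCount

namespace CombMap

section LeaflessWeight

variable {F F' : Type*} {M : CombMap F}

noncomputable instance [Finite F] (M : CombMap F) : Fintype M.Face := Fintype.ofFinite _

/-- There is no vertex of degree one along the face. -/
def IsLeafless (M : CombMap F) (f : M.Face) : Prop := ∀ z, M.faceOf z = f → ¬M.IsLeaf z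

/-- The number of flags of the face whose edge has another face on its other side. -/
noncomputable def outerDegree (M : CombMap F) (f : M.Face) : ℕ :=
  {z | M.faceOf z = f ∧ M.faceOf (M.sideFlip z) ≠ f}.ncard

open Classical in
/-- The generating polynomial of the outer degrees of the faces without leaves. -/
noncomputable def leaflessWeight [Finite F] (M : CombMap F) (t : ℝ) : ℝ :=
  ∑ f with M.IsLeafless f, t ^ M.outerDegree f

theorem leaflessWeight_mono [Finite F] (M : CombMap F) {t u : ℝ} (ht : 0 ≤ t) (htu : t ≤ u) :
    M.leaflessWeight t ≤ M.leaflessWeight u :=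
  Finset.sum_le_sum fun _ _ => pow_le_pow_left₀ ht htu _

theorem one_le_leaflessWeight_one [Finite F] {f : M.Face} (hf : M.IsLeafless f) :
    1 ≤ M.leaflessWeight 1 := by
  classical
  rw [leaflessWeight]
  simp only [one_pow, Finset.sum_const, nsmul_eq_mul, mul_one, Nat.one_le_cast]
  exact Finset.card_pos.2 ⟨f, by simp [hf]⟩

section IsHom

variable {M' : CombMap F'} {φ : F ≃ F'}

theorem IsHom.faceOf_apply_eq_iff (h : M.IsHom M' φ) {f : M.Face} {z : F} :
    M'.faceOf (φ z) = h.faceEquiv f ↔ M.faceOf z = f := by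
  rw [← h.faceEquiv_faceOf, h.faceEquiv.apply_eq_iff_eq]

theorem IsHom.isLeafless_iff (h : M.IsHom M' φ) {f : M.Face} :
    M'.IsLeafless (h.faceEquiv f) ↔ M.IsLeafless f :=
  (φ.forall_congr fun {z} => by rw [h.faceOf_apply_eq_iff, h.isLeaf_iff φ.injective]).symm

theorem IsHom.leaflessWeight_eq [Finite F] [Finite F'] (h : M.IsHom M' φ) (t : ℝ) :
    M.leaflessWeight t = M'.leaflessWeight t := by
  refine Finset.sum_equiv h.faceEquiv (fun f => ?_) fun f _ => congrArg (t ^ ·) ?_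
  · simp only [Finset.mem_filter_univ, h.isLeafless_iff]
  · refine Nat.card_congr (φ.subtypeEquiv fun z => ?_)
    simp only [Set.mem_ofPred_eq, ← h.map_sideFlip, h.faceOf_apply_eq_iff, ne_eq]

end IsHom

theorem ncard_sideFlip_mem_eq_outerDegree (M : CombMap F) (f : M.Face) :
    {z | M.faceOf z ≠ f ∧ M.faceOf (M.sideFlip z) = f}.ncard = M.outerDegree f :=
  Nat.card_congr (M.sideFlip.subtypeEquiv fun z => by
    simp only [Set.mem_ofPred_eq, M.sideFlip_sideFlip, and_comm])

theorem two_le_outerDegree [Finite F] (hM : M.IsConnected) {a : F} (ha : M.IsLeaf a) {f : M.Face}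
    (hf : M.IsLeafless f) : 2 ≤ M.outerDegree f := by
  obtain ⟨z, hz, hz'⟩ : ∃ z, M.faceOf z = f ∧ M.faceOf (M.sideFlip z) ≠ f := by
    by_contra! hside
    obtain ⟨z₀, hz₀⟩ := M.faceOf_surjective f
    exact hf a (hM.induction (P := fun z => M.faceOf z = f) hz₀
      (fun z hz => by rw [faceOf_endFlip, hz]) (fun z hz => by rw [faceOf_cornerFlip, hz])
      hside a) ha
  refine (Set.one_lt_ncard_iff).2 ⟨z, M.endFlip z, ⟨hz, hz'⟩, ⟨?_, ?_⟩, (M.endFlip_ne z).symm⟩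
  · rw [faceOf_endFlip, hz]
  · rwa [← M.endFlip_sideFlip, faceOf_endFlip]

theorem leaflessWeight_le [Finite F] (hM : M.IsConnected) {a : F} (ha : M.IsLeaf a) {t : ℝ}
    (ht₀ : 0 ≤ t) (ht₁ : t ≤ 1) : M.leaflessWeight t ≤ Nat.card M.Face * t ^ 2 := by
  classical
  calc M.leaflessWeight t ≤ ∑ f with M.IsLeafless f, t ^ 2 :=
        Finset.sum_le_sum fun f hf => pow_le_pow_of_le_one ht₀ ht₁
          (two_le_outerDegree hM ha (Finset.mem_filter_univ f |>.1 hf))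
    _ ≤ ∑ _f : M.Face, t ^ 2 :=
        Finset.sum_le_univ_sum_of_nonneg fun _ => sq_nonneg t
    _ = Nat.card M.Face * t ^ 2 := by
        rw [Finset.sum_const, Finset.card_univ, nsmul_eq_mul, Nat.card_eq_fintype_card]

section AddLeaf

variable (M) (hM : M.IsBoundaryless) (x : F)

theorem isLeafless_addLeaf_iff (f : (M.addLeaf hM x).Face) : (M.addLeaf hM x).IsLeafless f ↔
    M.IsLeafless (M.addLeafFaceEquiv hM x f) ∧ M.addLeafFaceEquiv hM x f ≠ M.faceOf x := by
  simp only [IsLeafless, ← (M.addLeafFaceEquiv hM x).apply_eq_iff_eq (y := f),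
    addLeafFaceEquiv_faceOf, Sum.forall, isLeaf_addLeaf_inl, isLeaf_addLeaf_inr, retract]
  refine and_congr_right fun _ => ⟨fun h hf => h .a0 ?_ (.inl rfl), ?_⟩
  · rw [hf, faceOf_endFlip]
  · rintro hf _ hi (rfl | rfl) <;> simp only [faceOf_endFlip] at hi <;> exact hf hi.symm

open Classical in
theorem outerDegree_addLeaf [Finite F] (f : (M.addLeaf hM x).Face)
    (hx : M.faceOf x ≠ M.addLeafFaceEquiv hM x f) :
    (M.addLeaf hM x).outerDegree f = M.outerDegree (M.addLeafFaceEquiv hM x f) +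
      if M.faceOf (M.sideFlip x) = M.addLeafFaceEquiv hM x f then 2 else 0 := by
  have faceOf_eq_iff (z) : (M.addLeaf hM x).faceOf z = f ↔
      M.faceOf (M.retract x z) = M.addLeafFaceEquiv hM x f := by
    rw [← addLeafFaceEquiv_faceOf _ hM, (M.addLeafFaceEquiv hM x).apply_eq_iff_eq]
  set f' := M.addLeafFaceEquiv hM x f
  have card_spur : {i | M.faceOf (M.retract x (.inr i)) = f' ∧
      M.faceOf (M.retract x (.inr i.sideFlip)) ≠ f'}.ncard =
        if M.faceOf (M.sideFlip x) = f' then 2 else 0 := by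
    split_ifs with h
    · convert Set.ncard_pair (a := Spur.x1) (b := .y1) nofun
      ext i
      cases i <;> simp [retract, Spur.sideFlip, hx, h]
    · convert Set.ncard_empty Spur
      ext i
      cases i <;> simp [retract, hx, h]
  rw [← card_spur, outerDegree, outerDegree, ← Nat.card_coe_set_eq, ← Nat.card_coe_set_eq,
    ← Nat.card_coe_set_eq, ← Nat.card_sum]
  refine Nat.card_congr (Equiv.subtypeSum.trans (Equiv.sumCongr
    (Equiv.subtypeEquivRight fun z => ?_) (Equiv.subtypeEquivRight fun i => ?_)))
  · simp only [Set.mem_ofPred_eq, ne_eq, faceOf_eq_iff, addLeaf_sideFlip_inl, retract]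
  · simp only [Set.mem_ofPred_eq, ne_eq, faceOf_eq_iff, addLeaf_sideFlip_inr]

open Classical in
theorem leaflessWeight_addLeaf [Finite F] (t : ℝ) : (M.addLeaf hM x).leaflessWeight t =
    ∑ f with M.IsLeafless f, if M.faceOf x = f then 0 else
      t ^ (M.outerDegree f + if M.faceOf (M.sideFlip x) = f then 2 else 0) := by
  simp only [leaflessWeight, Finset.sum_filter]
  refine Fintype.sum_equiv (M.addLeafFaceEquiv hM x) _ _ fun f => ?_
  by_cases hx : M.faceOf x = M.addLeafFaceEquiv hM x f
  · simp [isLeafless_addLeaf_iff, hx]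
  · simp [isLeafless_addLeaf_iff, hx, Ne.symm hx, outerDegree_addLeaf]

end AddLeaf

open Classical in
theorem sum_pow_outerDegree_le [Fintype F] [Nonempty F] (M : CombMap F) (f : M.Face) {t : ℝ}
    (ht : 0 ≤ t) :
    (∑ x, if M.faceOf x = f then 0 else
      t ^ (M.outerDegree f + if M.faceOf (M.sideFlip x) = f then 2 else 0)) ≤
        Fintype.card F * (t * (1 - (2 - t ^ 2) / Fintype.card F)) ^ M.outerDegree f := by
  set d := M.outerDegree f with hd
  set N : ℝ := (Fintype.card F : ℝ)
  have one_le_N : 1 ≤ N := Nat.one_le_cast.2 Fintype.card_pos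
  have sum_outer : (∑ x, if M.faceOf x = f ∧ M.faceOf (M.sideFlip x) ≠ f then (1 : ℝ) else 0) =
      d := by
    rw [Finset.sum_boole, hd, outerDegree, ← Set.ncard_coe_finset, Finset.coe_filter_univ]
  have sum_inner : (∑ x, if M.faceOf x ≠ f ∧ M.faceOf (M.sideFlip x) = f then (1 : ℝ) else 0) =
      d := by
    rw [Finset.sum_boole, hd, ← ncard_sideFlip_mem_eq_outerDegree, ← Set.ncard_coe_finset,
      Finset.coe_filter_univ]
  have bernoulli : 1 + d * -((2 - t ^ 2) / N) ≤ (1 + -((2 - t ^ 2) / N)) ^ d := by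
    refine one_add_mul_le_pow (neg_le_neg ?_) d
    rw [div_le_iff₀ (by linarith)]
    linarith [sq_nonneg t]
  calc _ ≤ ∑ x, t ^ d * (1 -
          (if M.faceOf x = f ∧ M.faceOf (M.sideFlip x) ≠ f then (1 : ℝ) else 0) -
          (1 - t ^ 2) * if M.faceOf x ≠ f ∧ M.faceOf (M.sideFlip x) = f then (1 : ℝ) else 0) := by
        refine Finset.sum_le_sum fun x _ => ?_
        have := pow_nonneg ht d
        by_cases h₁ : M.faceOf x = f <;> by_cases h₂ : M.faceOf (M.sideFlip x) = f <;>
          simp [h₁, h₂, pow_add, this]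
    _ = t ^ d * (N - d - (1 - t ^ 2) * d) := by
        rw [← Finset.mul_sum, Finset.sum_sub_distrib, Finset.sum_sub_distrib, ← Finset.mul_sum,
          sum_outer, sum_inner, Finset.sum_const, Finset.card_univ, nsmul_one]
    _ = N * (t ^ d * (1 + d * -((2 - t ^ 2) / N))) := by field
    _ ≤ N * (t ^ d * (1 + -((2 - t ^ 2) / N)) ^ d) := by gcongr
    _ = N * (t * (1 - (2 - t ^ 2) / N)) ^ d := by rw [mul_pow, ← sub_eq_add_neg]

theorem sum_leaflessWeight_addLeaf_le [Fintype F] [Nonempty F] (M : CombMap F)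
    (hM : M.IsBoundaryless) {t : ℝ} (ht : 0 ≤ t) :
    ∑ x, (M.addLeaf hM x).leaflessWeight t ≤
      Fintype.card F * M.leaflessWeight (t * (1 - (2 - t ^ 2) / Fintype.card F)) := by
  classical
  simp only [leaflessWeight_addLeaf]
  rw [Finset.sum_comm, leaflessWeight, Finset.mul_sum]
  exact Finset.sum_le_sum fun f _ => M.sum_pow_outerDegree_le f ht

end LeaflessWeight

end CombMap

section TotalWeight

open CombMap RootedMap

variable {S : Surface} {n : ℕ}

theorem flagCount_succ (S : Surface) (n : ℕ) : flagCount S (n + 1) = flagCount S n + 8 := by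
  simp only [flagCount]
  push_cast
  ring

theorem eight_mul_le_flagCount (hS : S.eulerChar ≤ 0) (n : ℕ) : 8 * n ≤ flagCount S n := by
  have : (S.eulerChar : ℝ) ≤ 0 := by exact_mod_cast hS
  rw [flagCount]
  linarith

/-- The sum of `CombMap.leaflessWeight` over the maps of `CombMap.IsLeafyCubic S n`. -/
noncomputable def totalWeight (S : Surface) (n : ℕ) (t : ℝ) : ℝ :=
  ∑ q : leafyClasses S n, q.1.out.toMap.leaflessWeight t

theorem totalWeight_mono (S : Surface) (n : ℕ) {t u : ℝ} (ht : 0 ≤ t) (htu : t ≤ u) :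
    totalWeight S n t ≤ totalWeight S n u :=
  Finset.sum_le_sum fun q _ => q.1.out.toMap.leaflessWeight_mono ht htu

theorem totalWeight_le {t : ℝ} (ht₀ : 0 ≤ t) (ht₁ : t ≤ 1) :
    totalWeight S n t ≤ S.β * Fintype.card (leafyClasses S n) * t ^ 2 := by
  calc totalWeight S n t ≤ ∑ _q : leafyClasses S n, S.β * t ^ 2 :=
        Finset.sum_le_sum fun q _ => (isLeafyCubic_out q).card_face ▸
          leaflessWeight_le (isLeafyCubic_out q).connected (isLeafyCubic_out q).root ht₀ ht₁
    _ = S.β * Fintype.card (leafyClasses S n) * t ^ 2 := by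
        rw [Finset.sum_const, Finset.card_univ, nsmul_eq_mul]
        ring

theorem totalWeight_succ_le (hS : S.eulerChar ≤ 0) (n : ℕ) {t : ℝ} (ht : 0 ≤ t) :
    2 * n * totalWeight S (n + 1) t ≤
      flagCount S n * totalWeight S n (t * (1 - (2 - t ^ 2) / flagCount S n)) := by
  have leaflessWeight_grow (q : leafyClasses S n) (x : Fin q.1.out.numFlags) :
      (grow q x).out.toMap.leaflessWeight t =
        (q.1.out.toMap.addLeaf (isLeafyCubic_out q).boundaryless x).leaflessWeight t := by
    obtain ⟨Φ, hΦ, -⟩ := pointedIso_out_iff.2 (Eq.refl (grow q x))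
    exact (hΦ.leaflessWeight_eq t).symm
  rw [totalWeight, sum_leafyClasses_succ hS n fun q => q.out.toMap.leaflessWeight t, totalWeight,
    Finset.mul_sum]
  refine Finset.sum_le_sum fun q _ => ?_
  have : Nonempty (Fin q.1.out.numFlags) := ⟨q.1.out.root⟩
  have h := q.1.out.toMap.sum_leaflessWeight_addLeaf_le (isLeafyCubic_out q).boundaryless ht
  simpa only [leaflessWeight_grow, Fintype.card_fin, numFlags_out] using h

/-- A supersolution of the recursion `t (G + 8) ↦ t (G + 8) * (1 - (2 - t (G + 8) ^ 2) / G)` for the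
argument in `totalWeight_succ_le`, with value `1` at `G = T`. It comes from solving the differential
equation `8 * t' = t * (2 - t ^ 2) / G`. -/
noncomputable def barrier (T G : ℝ) : ℝ := √(2 / (1 + √(T / G)))

theorem barrier_nonneg (T G : ℝ) : 0 ≤ barrier T G := Real.sqrt_nonneg _

theorem barrier_sq (T G : ℝ) : barrier T G ^ 2 = 2 / (1 + √(T / G)) :=
  Real.sq_sqrt (by positivity)

theorem barrier_le_one {T G : ℝ} (hG : 0 < G) (hT : G ≤ T) : barrier T G ≤ 1 := by
  have : 1 ≤ √(T / G) := Real.one_le_sqrt.2 ((one_le_div hG).2 hT)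
  rw [barrier, Real.sqrt_le_one, div_le_one (by positivity)]
  linarith

theorem barrier_self {G : ℝ} (hG : G ≠ 0) : barrier G G = 1 := by
  norm_num [barrier, div_self hG]

theorem barrier_step {T G : ℝ} (hG : 8 ≤ G) (hT : 0 ≤ T) :
    barrier T (G + 8) * (1 - (2 - barrier T (G + 8) ^ 2) / G) ≤ barrier T G := by
  set w := √(T / (G + 8)) with hw
  have hw₀ : 0 ≤ w := Real.sqrt_nonneg _
  have sqrt_le : √(T / G) ≤ w * (1 + 4 / G) := by
    refine Real.sqrt_le_iff.2 ⟨by positivity, ?_⟩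
    have : (G + 8) / G ≤ (1 + 4 / G) ^ 2 := by
      have : (1 + 4 / G) ^ 2 = (G + 8) / G + 16 / G ^ 2 := by field
      linarith [show 0 ≤ 16 / G ^ 2 by positivity]
    calc T / G = T / (G + 8) * ((G + 8) / G) := by field
      _ ≤ T / (G + 8) * (1 + 4 / G) ^ 2 := by gcongr
      _ = (w * (1 + 4 / G)) ^ 2 := by rw [mul_pow, hw, Real.sq_sqrt (by positivity)]
  set u := 4 * w / (G * (1 + w)) with u_def
  have hu : 0 < 1 + u := by positivity
  have hu₁ : u ≤ 1 := by
    rw [u_def, div_le_one (by positivity)]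
    nlinarith
  have sq_mul_le : (1 - u / 2) ^ 2 * (1 + u) ≤ 1 := by
    nlinarith [mul_nonneg (sq_nonneg u) (sub_nonneg.2 hu₁)]
  refine Real.le_sqrt_of_sq_le ?_
  calc (barrier T (G + 8) * (1 - (2 - barrier T (G + 8) ^ 2) / G)) ^ 2
      = 2 / (1 + w) * (1 - u / 2) ^ 2 := by
        rw [mul_pow, barrier_sq, ← hw, u_def]
        field
    _ ≤ 2 / (1 + w) * (1 / (1 + u)) := by
        gcongr
        exact (le_div_iff₀ hu).2 sq_mul_le
    _ = 2 / (1 + w * (1 + 4 / G)) := by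
        rw [u_def]
        field
    _ ≤ 2 / (1 + √(T / G)) := by gcongr

theorem totalWeight_barrier_le (hS : S.eulerChar ≤ 0) (hn : 1 ≤ n) {T : ℝ}
    (hT : flagCount S n ≤ T) : totalWeight S n (barrier T (flagCount S n)) ≤
      S.β * Fintype.card (leafyClasses S n) * barrier T (flagCount S 1) ^ 2 := by
  have flagCount_ge {n : ℕ} (hn : 1 ≤ n) : 8 ≤ flagCount S n := by
    have : (1 : ℝ) ≤ n := Nat.one_le_cast.2 hn
    linarith [eight_mul_le_flagCount hS n]
  have barrier_le_one {n : ℕ} (hn : 1 ≤ n) (hT : flagCount S n ≤ T) :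
      barrier T (flagCount S n) ≤ 1 := barrier_le_one (by linarith [flagCount_ge hn]) hT
  induction n, hn using Nat.le_induction with
  | base => exact totalWeight_le (barrier_nonneg _ _) (barrier_le_one le_rfl hT)
  | succ n hn ih =>
    have hG := flagCount_ge hn
    have hG' := flagCount_succ S n
    set t := barrier T (flagCount S (n + 1)) with ht
    set K := S.β * barrier T (flagCount S 1) ^ 2
    have ht₀ : 0 ≤ t := barrier_nonneg _ _
    have step_nonneg : 0 ≤ t * (1 - (2 - t ^ 2) / flagCount S n) := by
      refine mul_nonneg ht₀ (sub_nonneg.2 ((div_le_one (by linarith)).2 ?_))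
      nlinarith
    have step_le : t * (1 - (2 - t ^ 2) / flagCount S n) ≤ barrier T (flagCount S n) := by
      rw [ht, hG']
      exact barrier_step hG (by linarith)
    have hn' : (0 : ℝ) < 2 * n := by positivity
    refine le_of_mul_le_mul_left ?_ hn'
    calc 2 * n * totalWeight S (n + 1) t
        ≤ flagCount S n * totalWeight S n (t * (1 - (2 - t ^ 2) / flagCount S n)) :=
          totalWeight_succ_le hS n ht₀
      _ ≤ flagCount S n * totalWeight S n (barrier T (flagCount S n)) := by
          gcongr
          exact totalWeight_mono S n step_nonneg step_le
      _ ≤ flagCount S n * (S.β * Fintype.card (leafyClasses S n) *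
            barrier T (flagCount S 1) ^ 2) := by
          gcongr
          exact ih (by linarith)
      _ = K * (flagCount S n * Fintype.card (leafyClasses S n)) := by ring
      _ = 2 * n * (S.β * Fintype.card (leafyClasses S (n + 1)) *
            barrier T (flagCount S 1) ^ 2) := by
          rw [← card_leafyClasses_succ hS n]
          ring

theorem totalWeight_one_le (hS : S.eulerChar ≤ 0) (hn : 1 ≤ n) :
    totalWeight S n 1 ≤
      S.β * Fintype.card (leafyClasses S n) * (2 * √(flagCount S 1) / √n) := by
  have hn' : (1 : ℝ) ≤ n := Nat.one_le_cast.2 hn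
  have hG := eight_mul_le_flagCount hS n
  have hG₁ := eight_mul_le_flagCount hS 1
  rw [Nat.cast_one] at hG₁
  have h := totalWeight_barrier_le hS hn le_rfl
  rw [barrier_self (by linarith), barrier_sq] at h
  refine h.trans (mul_le_mul_of_nonneg_left ?_ (by positivity))
  have : 0 < √(flagCount S 1) := Real.sqrt_pos.2 (by linarith)
  calc 2 / (1 + √(flagCount S n / flagCount S 1))
      ≤ 2 / (√n / √(flagCount S 1)) := by
        rw [Real.sqrt_div' _ (by linarith)]
        gcongr
        have : √n / √(flagCount S 1) ≤ √(flagCount S n) / √(flagCount S 1) := by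
          gcongr
          linarith
        linarith
    _ = 2 * √(flagCount S 1) / √n := by field

end TotalWeight

section GammaAsymptotics

/-- The ratio of `Γ(x + s)` to its leading term `x ^ s * Γ(x)` as `x → ∞`. -/
noncomputable def gammaRatio (s x : ℝ) : ℝ :=
  Real.Gamma (x + s) / (x ^ s * Real.Gamma x)

theorem gamma_add_le {s x : ℝ} (hx : 0 < x) (hs₀ : 0 ≤ s) (hs₁ : s ≤ 1) :
    Real.Gamma (x + s) ≤ x ^ s * Real.Gamma x := by
  rcases hs₀.eq_or_lt with rfl | hs₀
  · simp
  rcases hs₁.eq_or_lt with rfl | hs₁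
  · simp [Real.Gamma_add_one hx.ne']
  have Gamma_pos := Real.Gamma_pos_of_pos hx
  calc Real.Gamma (x + s) = Real.Gamma ((1 - s) * x + s * (x + 1)) := by ring_nf
    _ ≤ Real.Gamma x ^ (1 - s) * Real.Gamma (x + 1) ^ s :=
      Real.Gamma_mul_add_mul_le_rpow_Gamma_mul_rpow_Gamma hx (by linarith) (by linarith) hs₀
        (by ring)
    _ = x ^ s * (Real.Gamma x ^ (1 - s) * Real.Gamma x ^ s) := by
      rw [Real.Gamma_add_one hx.ne', Real.mul_rpow hx.le Gamma_pos.le]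
      ring
    _ = x ^ s * Real.Gamma x := by
      rw [← Real.rpow_add Gamma_pos, sub_add_cancel, Real.rpow_one]

theorem gammaRatio_le_one {s x : ℝ} (hx : 0 < x) (hs₀ : 0 ≤ s) (hs₁ : s ≤ 1) :
    gammaRatio s x ≤ 1 :=
  (div_le_one (by positivity)).2 (gamma_add_le hx hs₀ hs₁)

theorem one_sub_div_le_gammaRatio {s x : ℝ} (hx : 0 < x) (hs₀ : 0 ≤ s) (hs₁ : s ≤ 1) :
    1 - s / x ≤ gammaRatio s x := by
  have hxs : 0 < x + s := by linarith
  have mul_Gamma_le : x * Real.Gamma x ≤ (x + s) ^ (1 - s) * Real.Gamma (x + s) := by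
    simpa [Real.Gamma_add_one hx.ne'] using gamma_add_le hxs (sub_nonneg.2 hs₁) (by linarith)
  calc 1 - s / x ≤ x / (x + s) := by
        rw [le_div_iff₀ hxs]
        have : (1 - s / x) * (x + s) = x - s ^ 2 / x := by field
        linarith [show 0 ≤ s ^ 2 / x by positivity]
    _ ≤ (x / (x + s)) ^ (1 - s) :=
        Real.self_le_rpow_of_le_one (by positivity) ((div_le_one hxs).2 (by linarith))
          (by linarith)
    _ ≤ gammaRatio s x := by
        rw [gammaRatio, Real.div_rpow hx.le hxs.le, div_le_div_iff₀ (by positivity) (by positivity),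
          ← mul_assoc, ← Real.rpow_add hx, sub_add_cancel, Real.rpow_one]
        linarith

theorem gammaRatio_add_one {s x : ℝ} (hx : 0 < x) (hs : 0 ≤ s) :
    gammaRatio (s + 1) x = gammaRatio s x * (1 + s / x) := by
  rw [gammaRatio, gammaRatio, ← add_assoc, Real.Gamma_add_one (by positivity),
    Real.rpow_add_one hx.ne']
  field

theorem isBigO_gammaRatio_sub_one {s : ℝ} (hs : 0 ≤ s) :
    (fun x => gammaRatio s x - 1) =O[atTop] fun x => x⁻¹ := by
  suffices ∀ (k : ℕ) (t : ℝ), 0 ≤ t → t ≤ 1 →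
      (fun x => gammaRatio (t + k) x - 1) =O[atTop] fun x => x⁻¹ by
    have := this ⌊s⌋₊ (s - ⌊s⌋₊) (sub_nonneg.2 (Nat.floor_le hs))
      (by linarith [Nat.lt_floor_add_one s])
    rwa [sub_add_cancel] at this
  intro k t ht₀ ht₁
  induction k with
  | zero =>
    refine IsBigO.of_bound t ?_
    filter_upwards [eventually_gt_atTop 0] with x hx
    have upper := gammaRatio_le_one hx ht₀ ht₁
    have lower := one_sub_div_le_gammaRatio hx ht₀ ht₁
    rw [Nat.cast_zero, add_zero, Real.norm_of_nonpos (by linarith),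
      Real.norm_of_nonneg (by positivity), ← div_eq_mul_inv]
    linarith
  | succ k ih =>
    have inv_isBigO_one : (fun x : ℝ => x⁻¹) =O[atTop] fun _ => (1 : ℝ) :=
      tendsto_inv_atTop_zero.isBigO_one ℝ
    have succ_isBigO : (fun x : ℝ => (gammaRatio (t + k) x - 1) * (1 + (t + k) * x⁻¹) +
        (t + k) * x⁻¹) =O[atTop] fun x => x⁻¹ := by
      refine IsBigO.add ?_ ((isBigO_refl _ _).const_mul_left _)
      simpa using ih.mul ((isBigO_refl (fun _ : ℝ => (1 : ℝ)) atTop).add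
        (inv_isBigO_one.const_mul_left (t + k)))
    refine EventuallyEq.trans_isBigO ?_ succ_isBigO
    filter_upwards [eventually_gt_atTop 0] with x hx
    rw [Nat.cast_succ, ← add_assoc, gammaRatio_add_one hx (by positivity)]
    ring

theorem eq_gammaRatio_of_recurrence {u : ℕ → ℝ} {c s : ℝ} (hc : c ≠ 0) (hs : 0 ≤ s)
    (h : ∀ n : ℕ, 1 ≤ n → n * u (n + 1) = c * (n + s) * u n) {n : ℕ} (hn : 1 ≤ n) :
    u n = u 1 / (c * Real.Gamma (1 + s)) * (n : ℝ) ^ s * c ^ n * gammaRatio s n := by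
  have hn₀ : (0 : ℝ) < n := Nat.cast_pos.2 hn
  suffices u n * (c * Real.Gamma (1 + s) * Real.Gamma n) = u 1 * c ^ n * Real.Gamma (n + s) by
    rw [gammaRatio]
    field_simp
    linear_combination this
  clear hn₀
  induction n, hn using Nat.le_induction with
  | base =>
    rw [Nat.cast_one, Real.Gamma_one]
    ring
  | succ n hn ih =>
    have hn₀ : (0 : ℝ) < n := Nat.cast_pos.2 hn
    rw [Nat.cast_succ, Real.Gamma_add_one hn₀.ne', add_right_comm,
      Real.Gamma_add_one (by positivity), pow_succ]
    linear_combination (c * Real.Gamma (1 + s) * Real.Gamma n) * h n hn + (c * (n + s)) * ih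

theorem exists_eq_mul_one_add_of_isBigO {α : Type*} {l : Filter α} {m g u v r : α → ℝ}
    (hr : r =O[l] fun _ => (1 : ℝ)) (hg : (fun x => g x - 1) =O[l] r)
    (hu : ∀ᶠ x in l, u x = m x * g x) (hv : (fun x => v x - u x) =O[l] fun x => u x * r x) :
    ∃ ε : α → ℝ, ε =O[l] r ∧ ∀ᶠ x in l, v x = m x * (1 + ε x) := by
  obtain ⟨φ, hφ, eq_mul⟩ := isBigO_iff_exists_eq_mul.1 hv
  have g_isBigO_one : g =O[l] fun _ => (1 : ℝ) := by
    simpa using (hg.trans hr).add (isBigO_refl (fun _ => (1 : ℝ)) l)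
  have φ_isBigO_one : φ =O[l] fun _ => (1 : ℝ) := (isBigO_one_iff ℝ).2 hφ
  refine ⟨fun x => (g x - 1) + g x * φ x * r x, hg.add ?_, ?_⟩
  · simpa using (g_isBigO_one.mul φ_isBigO_one).mul (isBigO_refl r l)
  · filter_upwards [hu, eq_mul] with x hux hx
    simp only [Pi.mul_apply] at hx
    linear_combination hx + (1 + φ x * r x) * hux

theorem asymptotics_of_recurrence {u v : ℕ → ℝ} {c s : ℝ} (hc : c ≠ 0) (hs : 0 ≤ s)
    (hu : ∀ n : ℕ, 1 ≤ n → n * u (n + 1) = c * (n + s) * u n)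
    (hv : (fun n => v n - u n) =O[atTop] fun n => u n * (n : ℝ) ^ (-(1 / 2) : ℝ)) :
    ∃ ε : ℕ → ℝ, ε =O[atTop] (fun n : ℕ => (n : ℝ) ^ (-(1 / 2) : ℝ)) ∧
      ∀ᶠ n : ℕ in atTop,
        v n = u 1 / (c * Real.Gamma (1 + s)) * (n : ℝ) ^ s * c ^ n * (1 + ε n) := by
  have rpow_isBigO_one : (fun n : ℕ => (n : ℝ) ^ (-(1 / 2) : ℝ)) =O[atTop] fun _ => (1 : ℝ) :=
    ((tendsto_rpow_neg_atTop (by norm_num)).comp tendsto_natCast_atTop_atTop).isBigO_one ℝ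
  have inv_isBigO_rpow : (fun n : ℕ => (n : ℝ)⁻¹) =O[atTop] fun n => (n : ℝ) ^ (-(1 / 2) : ℝ) := by
    refine IsBigO.of_norm_eventuallyLE ?_
    filter_upwards [eventually_ge_atTop 1] with n hn
    rw [Real.norm_of_nonneg (by positivity), ← Real.rpow_neg_one]
    exact Real.rpow_le_rpow_of_exponent_le (Nat.one_le_cast.2 hn) (by norm_num)
  exact exists_eq_mul_one_add_of_isBigO rpow_isBigO_one
    (((isBigO_gammaRatio_sub_one hs).comp_tendsto tendsto_natCast_atTop_atTop).trans
      inv_isBigO_rpow)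
    ((eventually_ge_atTop 1).mono fun n hn => eq_gammaRatio_of_recurrence hc hs hu hn) hv

end GammaAsymptotics

theorem mul_ncard_range_orbit {G X : Type*} [Group G] [MulAction G X] [Finite X] {P : X → Prop}
    {N c : ℕ} (hN : N ≠ 0) (hP : ∀ x, P x → N = (1 + c) * (MulAction.orbit G x).ncard)
    (hP' : ∀ x, ¬P x → N = (MulAction.orbit G x).ncard) :
    N * (Set.range fun x : X => MulAction.orbit G x).ncard =
      Nat.card X + c * Nat.card {x // P x} := by
  classical
  have := Fintype.ofFinite X
  have term_eq (x : X) : N * (1 / ((MulAction.orbit G x).ncard : ℚ)) =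
      1 + c * if P x then 1 else 0 := by
    have hN' : (N : ℚ) ≠ 0 := Nat.cast_ne_zero.2 hN
    split_ifs with hx
    · rw [hP x hx, Nat.cast_mul] at hN' ⊢
      rw [mul_one, mul_assoc, mul_one_div_cancel (right_ne_zero_of_mul hN'), mul_one]
      push_cast
      rfl
    · rw [← hP' x hx, mul_one_div_cancel hN', mul_zero, add_zero]
  rw [← Nat.cast_inj (R := ℚ), Nat.cast_mul, ncard_range_orbit_eq_sum, Finset.mul_sum]
  simp only [term_eq, Finset.sum_add_distrib, ← Finset.mul_sum, Finset.sum_boole]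
  rw [Nat.card_eq_fintype_card, Nat.card_eq_fintype_card, Fintype.card_subtype]
  simp

namespace CombMap

variable {F : Type*} (M : CombMap F)

section EulerChar

theorem numBoundaries_eq_zero_iff [Finite F] : M.numBoundaries = 0 ↔ M.IsBoundaryless := by
  rw [numBoundaries, Finite.card_eq_zero_iff]
  exact ⟨fun h x hx => h.false (Quot.mk _ ⟨x, hx⟩), fun h => ⟨Quot.ind fun x => h x.1 x.2⟩⟩

theorem edge_eq (x : F) : M.edge x = M.edgeEnd x ∪ M.endFlip '' M.edgeEnd x := by
  ext y
  rw [edge, edgeEnd, Set.image_pair,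
    mem_orbit_closure_pair_iff M.endFlip_involutive M.sideFlip_involutive]
  constructor
  · refine fun h => h (· ∈ ({x, M.sideFlip x} ∪ {M.endFlip x, M.endFlip (M.sideFlip x)} : Set F))
      (by simp) ?_ ?_
    · rintro z ((rfl | rfl) | (rfl | rfl)) <;> simp [M.endFlip_endFlip]
    · rintro z ((rfl | rfl) | (rfl | rfl)) <;> simp [M.sideFlip_sideFlip, ← M.endFlip_sideFlip]
  · rintro ((rfl | rfl) | (rfl | rfl)) P hx hend hside
    exacts [hx, hside _ hx, hend _ hx, hend _ (hside _ hx)]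

theorem ncard_edge [Finite F] (x : F) : (M.edge x).ncard = 2 * (M.edgeEnd x).ncard := by
  rw [edge_eq, Set.ncard_union_eq, Set.ncard_image_of_injective _ M.endFlip.injective, two_mul]
  rw [edgeEnd, Set.image_pair, Set.disjoint_left]
  rintro y hy (h | h)
  · rcases hy with rfl | rfl
    · exact M.endFlip_ne _ h.symm
    · exact M.endFlip_ne_sideFlip _ h.symm
  · rcases hy with rfl | rfl
    · exact M.endFlip_ne_sideFlip _ ((congrArg M.endFlip h).trans (M.endFlip_endFlip _))
    · exact M.endFlip_ne _ (Eq.symm h)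

theorem four_mul_numEdges [Finite F] :
    4 * M.numEdges = Nat.card F + Nat.card {x // M.OnBoundary x} := by
  have ncard_edge_of_onBoundary (x : F) (hx : M.OnBoundary x) :
      4 = (1 + 1) * (M.edge x).ncard := by
    rw [ncard_edge, edgeEnd, hx, Set.pair_eq_singleton, Set.ncard_singleton]
  have ncard_edge_of_not_onBoundary (x : F) (hx : ¬M.OnBoundary x) : 4 = (M.edge x).ncard := by
    rw [ncard_edge, edgeEnd, Set.ncard_pair (Ne.symm hx)]
  rw [← one_mul (Nat.card {x // M.OnBoundary x})]
  exact mul_ncard_range_orbit four_ne_zero ncard_edge_of_onBoundary ncard_edge_of_not_onBoundary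

variable {M}

theorem IsBoundaryless.six_mul_numVertices [Finite F] (hM : M.IsBoundaryless)
    (hc : M.IsSubcubic) : 6 * M.numVertices = Nat.card F + 2 * Nat.card {x // M.IsLeaf x} := by
  have ncard_vertex_of_isLeaf (x : F) (hx : M.IsLeaf x) : 6 = (1 + 2) * (M.vertex x).ncard := by
    rw [hM.ncard_vertex, hM.vertexDegree_eq_one_iff.2 hx]
  have ncard_vertex_of_not_isLeaf (x : F) (hx : ¬M.IsLeaf x) : 6 = (M.vertex x).ncard := by
    rw [hM.ncard_vertex, hM.vertexDegree_eq, (isSubcubic_iff_minimalPeriod.1 hc x).resolve_left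
      (mt isLeaf_iff_minimalPeriod.2 hx)]
  exact mul_ncard_range_orbit (by norm_num) ncard_vertex_of_isLeaf ncard_vertex_of_not_isLeaf

theorem IsBoundaryless.twelve_mul_eulerChar [Finite F] (hM : M.IsBoundaryless)
    (hc : M.IsSubcubic) : 12 * M.eulerChar =
      4 * Nat.card {x // M.IsLeaf x} - Nat.card F + 12 * Nat.card M.Face := by
  have hV := hM.six_mul_numVertices hc
  have hE := M.four_mul_numEdges
  rw [show Nat.card {x // M.OnBoundary x} = 0 from
    Finite.card_eq_zero_iff.2 ⟨fun x => hM x.1 x.2⟩] at hE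
  rw [eulerChar, numFaces_eq]
  lia

end EulerChar

section CubicScheme

theorem mem_vertex_iff (M : CombMap F) {x y : F} :
    y ∈ M.vertex x ↔ ∀ P : F → Prop, P x → (∀ z, P z → P (M.cornerFlip z)) →
      (∀ z, P z → P (M.sideFlip z)) → P y :=
  mem_orbit_closure_pair_iff M.cornerFlip_involutive M.sideFlip_involutive

variable {M} {r : F}

theorem IsBoundaryless.forall_vertexDegree_eq_three_iff [Finite F] (hM : M.IsBoundaryless)
    (hr : M.IsLeaf r) : (∀ x ∉ M.vertex r, M.vertexDegree x = 3) ↔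
      M.IsSubcubic ∧ Nat.card {x // M.IsLeaf x} = 2 := by
  have vertex_subset : M.vertex r ⊆ {x | M.IsLeaf x} := by
    intro x hx
    refine M.mem_vertex_iff.1 hx M.IsLeaf hr (fun z hz => ?_) fun z hz => hz.sideFlip
    exact hz.symm ▸ hz.sideFlip
  have ncard_vertex : (M.vertex r).ncard = 2 := by
    rw [hM.ncard_vertex, hM.vertexDegree_eq_one_iff.2 hr]
  have card_leaf_iff : Nat.card {x // M.IsLeaf x} = 2 ↔ M.vertex r = {x | M.IsLeaf x} := by
    rw [← ncard_vertex]
    refine ⟨fun h => Set.eq_of_subset_of_ncard_le vertex_subset h.le, fun h => ?_⟩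
    rw [h]
    rfl
  rw [card_leaf_iff]
  constructor
  · intro h
    refine ⟨isSubcubic_iff_minimalPeriod.2 fun x => ?_, vertex_subset.antisymm fun x hx => ?_⟩
    · rw [← hM.vertexDegree_eq]
      by_cases hx : x ∈ M.vertex r
      · exact Or.inl (hM.vertexDegree_eq_one_iff.2 (vertex_subset hx))
      · exact Or.inr (h x hx)
    · by_contra hx'
      have := h x hx'
      rw [hM.vertexDegree_eq_one_iff.2 hx] at this
      contradiction
  · rintro ⟨hc, vertex_eq⟩ x hx
    rw [vertex_eq] at hx
    rw [hM.vertexDegree_eq]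
    exact (isSubcubic_iff_minimalPeriod.1 hc x).resolve_left (mt isLeaf_iff_minimalPeriod.2 hx)

theorem isCubicScheme_iff [Finite F] {S : Surface} :
    (M.IsMapOn S.closure ∧ M.vertexDegree r = 1 ∧ (∀ x, x ∉ M.vertex r → M.vertexDegree x = 3) ∧
      M.numFaces = S.β) ↔ M.IsLeafyCubic S 1 r := by
  have eulerChar_closure : S.closure.eulerChar = S.eulerChar + S.β := by
    simp [Surface.closure, Surface.eulerChar]
  rw [IsMapOn, eulerChar_closure, numFaces_eq]
  constructor
  · rintro ⟨⟨connected, eulerChar_eq, hb, orientable⟩, degree_root, degree_eq, card_face⟩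
    have hM := M.numBoundaries_eq_zero_iff.1 hb
    have hr := hM.vertexDegree_eq_one_iff.1 degree_root
    obtain ⟨hc, card_leaf⟩ := (hM.forall_vertexDegree_eq_three_iff hr).1 degree_eq
    have := hM.twelve_mul_eulerChar hc
    exact ⟨hM, connected, hc, hr, card_leaf, by lia, card_face, orientable⟩
  · rintro ⟨hM, connected, hc, hr, card_leaf, card_flag, card_face, orientable⟩
    have := hM.twelve_mul_eulerChar hc
    exact ⟨⟨connected, by lia, M.numBoundaries_eq_zero_iff.2 hM, orientable⟩,
      hM.vertexDegree_eq_one_iff.2 hr, (hM.forall_vertexDegree_eq_three_iff hr).2 ⟨hc, card_leaf⟩,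
      card_face⟩

end CubicScheme

end CombMap

theorem cubicSchemes_eq (S : Surface) : cubicSchemes S = leafyClasses S 1 :=
  Set.ext fun _ => exists_congr fun _ => and_congr_right fun _ => CombMap.isCubicScheme_iff

namespace CombMap

variable {F : Type*} (M : CombMap F)

/-- The flags of the edges on the boundary. -/
abbrev BdFlag : Type _ := {x // M.OnBoundary x}

variable {M} in
theorem OnBoundary.endFlip {x : F} (hx : M.OnBoundary x) : M.OnBoundary (M.endFlip x) := by
  rw [OnBoundary, ← M.endFlip_sideFlip, hx]

theorem onBoundary_endFlip_iff {x : F} : M.OnBoundary (M.endFlip x) ↔ M.OnBoundary x :=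
  ⟨fun h => M.endFlip_endFlip x ▸ h.endFlip, OnBoundary.endFlip⟩

theorem onBoundary_sideFlip_iff {x : F} : M.OnBoundary (M.sideFlip x) ↔ M.OnBoundary x :=
  M.sideFlip.injective.eq_iff

/-- The action of `endFlip` on the flags of the boundary. -/
def bdFlip : Equiv.Perm M.BdFlag := M.endFlip.subtypePerm fun _ => M.onBoundary_endFlip_iff

theorem bdFlip_bdFlip (b : M.BdFlag) : M.bdFlip (M.bdFlip b) = b :=
  Subtype.ext (M.endFlip_endFlip b)

theorem bdFlip_ne (b : M.BdFlag) : M.bdFlip b ≠ b :=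
  fun h => M.endFlip_ne b (congrArg Subtype.val h)

open Classical in
/-- The end flip of the dual map: it exchanges the two sides of an inner edge, and the single side
of a boundary edge with the new leaf across it. -/
noncomputable def dualEnd : F ⊕ M.BdFlag → F ⊕ M.BdFlag
  | .inl x => if h : M.OnBoundary x then .inr ⟨x, h⟩ else .inl (M.sideFlip x)
  | .inr b => .inl b

theorem dualEnd_coe (b : M.BdFlag) : M.dualEnd (.inl b) = .inr b := dif_pos b.2

theorem dualEnd_of_not_onBoundary {x : F} (h : ¬M.OnBoundary x) :
    M.dualEnd (.inl x) = .inl (M.sideFlip x) := dif_neg h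

theorem dualEnd_involutive : Function.Involutive M.dualEnd := by
  rintro (x | b)
  · by_cases h : M.OnBoundary x
    · rw [M.dualEnd_coe ⟨x, h⟩]
      rfl
    · rw [M.dualEnd_of_not_onBoundary h,
        M.dualEnd_of_not_onBoundary (mt M.onBoundary_sideFlip_iff.1 h), M.sideFlip_sideFlip]
  · exact M.dualEnd_coe b

/-- The dual map without boundary: a vertex for each face of `M`, and a leaf across each edge on the
boundary of `M`, whose flags are the `Sum.inr b`. Its faces are the vertices of `M`, those on the
same boundary component being merged. -/
noncomputable def dual : CombMap (F ⊕ M.BdFlag) where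
  endFlip := M.dualEnd_involutive.toPerm
  cornerFlip := Equiv.sumCongr M.cornerFlip M.bdFlip
  sideFlip := Equiv.sumCongr M.endFlip M.bdFlip
  endFlip_endFlip := M.dualEnd_involutive
  cornerFlip_cornerFlip := by rintro (x | b) <;> simp [M.cornerFlip_cornerFlip, M.bdFlip_bdFlip]
  sideFlip_sideFlip := by rintro (x | b) <;> simp [M.endFlip_endFlip, M.bdFlip_bdFlip]
  endFlip_sideFlip := by
    rintro (x | b)
    · by_cases h : M.OnBoundary x
      · exact (M.dualEnd_coe ⟨_, h.endFlip⟩).trans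
          (congrArg (Sum.map M.endFlip M.bdFlip) (M.dualEnd_coe ⟨x, h⟩)).symm
      · simp [M.dualEnd_of_not_onBoundary h, M.endFlip_sideFlip,
          M.dualEnd_of_not_onBoundary (mt M.onBoundary_endFlip_iff.1 h)]
    · rfl
  endFlip_ne := by
    rintro (x | b)
    · by_cases h : M.OnBoundary x
      · simp [M.dualEnd_coe ⟨x, h⟩]
      · simpa [M.dualEnd_of_not_onBoundary h, OnBoundary] using h
    · simp [dualEnd]
  cornerFlip_ne := by rintro (x | b) <;> simp [M.cornerFlip_ne, M.bdFlip_ne]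
  endFlip_ne_sideFlip := by
    rintro (x | b)
    · by_cases h : M.OnBoundary x
      · simp [M.dualEnd_coe ⟨x, h⟩]
      · simpa [M.dualEnd_of_not_onBoundary h] using (M.endFlip_ne_sideFlip x).symm
    · simp [dualEnd]

@[simp] theorem dual_cornerFlip_inl (x : F) :
    M.dual.cornerFlip (.inl x) = .inl (M.cornerFlip x) := rfl

@[simp] theorem dual_cornerFlip_inr (b : M.BdFlag) :
    M.dual.cornerFlip (.inr b) = .inr (M.bdFlip b) := rfl

@[simp] theorem dual_sideFlip_inl (x : F) : M.dual.sideFlip (.inl x) = .inl (M.endFlip x) := rfl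

@[simp] theorem dual_sideFlip_inr (b : M.BdFlag) :
    M.dual.sideFlip (.inr b) = .inr (M.bdFlip b) := rfl

@[simp] theorem dual_endFlip_inr (b : M.BdFlag) : M.dual.endFlip (.inr b) = .inl b := rfl

theorem dual_endFlip_coe (b : M.BdFlag) : M.dual.endFlip (.inl b) = .inr b := M.dualEnd_coe b

theorem dual_endFlip_of_not_onBoundary {x : F} (h : ¬M.OnBoundary x) :
    M.dual.endFlip (.inl x) = .inl (M.sideFlip x) := M.dualEnd_of_not_onBoundary h

theorem isBoundaryless_dual : M.dual.IsBoundaryless := by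
  rintro (x | b) h
  · exact M.endFlip_ne x (Sum.inl_injective h)
  · exact M.bdFlip_ne b (Sum.inr_injective h)

/-- The retraction of the flags of the dual map onto those of `M`. -/
def undual : F ⊕ M.BdFlag → F := Sum.elim id Subtype.val

theorem undual_dual_endFlip (z : F ⊕ M.BdFlag) :
    M.undual (M.dual.endFlip z) = M.sideFlip (M.undual z) := by
  rcases z with x | b
  · by_cases h : M.OnBoundary x
    · rw [M.dual_endFlip_coe ⟨x, h⟩]
      exact Eq.symm h
    · rw [M.dual_endFlip_of_not_onBoundary h]
      rfl
  · exact b.2.symm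

theorem undual_dual_sideFlip (z : F ⊕ M.BdFlag) :
    M.undual (M.dual.sideFlip z) = M.endFlip (M.undual z) := by
  rcases z with x | b <;> rfl

theorem isConnected_dual_iff : M.dual.IsConnected ↔ M.IsConnected := by
  constructor
  · refine fun h x => isConnected_of_induction x (fun P root hend hcorner hside y => ?_) x
    refine h.induction (P := P ∘ M.undual) (r := .inl x) root (fun z hz => ?_) ?_ (fun z hz => ?_)
      (.inl y)
    · rw [Function.comp_apply, undual_dual_endFlip]
      exact hside _ hz
    · rintro (z | b) hz
      exacts [hcorner _ hz, hend _ hz]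
    · rw [Function.comp_apply, undual_dual_sideFlip]
      exact hend _ hz
  · refine fun h z => isConnected_of_induction (.inl (M.undual z))
      (fun P root hend hcorner hside => ?_) z
    have hinl : ∀ x, P (.inl x) := by
      refine h.induction root (fun x hx => hside _ hx) (fun x hx => hcorner _ hx) fun x hx => ?_
      by_cases hb : M.OnBoundary x
      · rwa [show M.sideFlip x = x from hb]
      · exact M.dual_endFlip_of_not_onBoundary hb ▸ hend _ hx
    exact Sum.rec hinl fun b => M.dual_endFlip_coe b ▸ hend _ (hinl b)

theorem isOrientable_dual_iff : M.dual.IsOrientable ↔ M.IsOrientable := by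
  constructor
  · rintro ⟨c, hc⟩
    refine ⟨fun x => c (.inl x), fun x => ⟨(hc (.inl x)).2.2 (M.isBoundaryless_dual _),
      (hc (.inl x)).2.1, fun hx => ?_⟩⟩
    have := (hc (.inl x)).1
    rwa [M.dual_endFlip_of_not_onBoundary hx] at this
  · rintro ⟨c, hc⟩
    refine ⟨Sum.elim c fun b => !c b, Sum.rec (fun x => ?_) fun b => ?_⟩
    · refine ⟨?_, (hc x).2.1, fun _ => (hc x).1⟩
      by_cases hx : M.OnBoundary x
      · simp [M.dual_endFlip_coe ⟨x, hx⟩]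
      · rw [M.dual_endFlip_of_not_onBoundary hx]
        exact (hc x).2.2 hx
    · have bdFlip_sign : (!c (M.endFlip b)) ≠ !c b := fun h => (hc b).1 (Bool.not_inj h)
      exact ⟨by simp, bdFlip_sign, fun _ => bdFlip_sign⟩

theorem isSubcubic_dual_iff : M.dual.IsSubcubic ↔ (M.cornerFlip * M.endFlip) ^ 3 = 1 := by
  rw [isSubcubic_iff, Equiv.ext_iff]
  constructor
  · exact fun h x => Sum.inl_injective (h (.inl x))
  · rintro h (x | b)
    · exact congrArg Sum.inl (h x)
    · simp [M.bdFlip_bdFlip]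

/-- No face has degree one. -/
def IsMonogonFree : Prop := ∀ x, M.cornerFlip x ≠ M.endFlip x

theorem isTriangular_iff : M.IsTriangular ↔ M.dual.IsSubcubic ∧ M.IsMonogonFree := by
  simp only [IsTriangular, isSubcubic_dual_iff, pow_eq_one_iff_minimalPeriod Nat.prime_three,
    IsMonogonFree, Ne, ← minimalPeriod_mul_eq_one_iff M.cornerFlip_involutive, faceDegree_eq,
    ← forall_and]
  exact forall_congr' fun x => by lia

theorem isLeaf_dual_inr (b : M.BdFlag) : M.dual.IsLeaf (.inr b) := rfl

section IsMonogonFree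

variable {M}

theorem IsMonogonFree.not_isLeaf_dual_inl (hM : M.IsMonogonFree) (x : F) :
    ¬M.dual.IsLeaf (.inl x) := fun h => hM x (Sum.inl_injective h)

theorem IsMonogonFree.card_isLeaf_dual (hM : M.IsMonogonFree) :
    Nat.card {z // M.dual.IsLeaf z} = Nat.card M.BdFlag := by
  have setOf_isLeaf : {z | M.dual.IsLeaf z} = Set.range Sum.inr := by
    ext (x | b)
    · simpa using hM.not_isLeaf_dual_inl x
    · simpa using M.isLeaf_dual_inr b
  exact (Nat.card_congr (Equiv.setCongr setOf_isLeaf)).trans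
    (Nat.card_range_of_injective Sum.inr_injective)

theorem faceOf_dual_inr (b : M.BdFlag) :
    M.dual.faceOf (.inr b) = M.dual.faceOf (.inl (b : F)) :=
  (faceOf_endFlip M.dual (.inr b)).symm

theorem vertex_eq_vertex_iff {x y : F} : M.vertex x = M.vertex y ↔ x ∈ M.vertex y :=
  MulAction.orbit_eq_iff

@[simp] theorem vertex_sideFlip (x : F) : M.vertex (M.sideFlip x) = M.vertex x :=
  vertex_eq_vertex_iff.2 (M.mem_vertex_iff.2 fun _ hx _ hside => hside _ hx)

@[simp] theorem vertex_cornerFlip (x : F) : M.vertex (M.cornerFlip x) = M.vertex x :=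
  vertex_eq_vertex_iff.2 (M.mem_vertex_iff.2 fun _ hx hcorner _ => hcorner _ hx)

theorem faceOf_dual_eq_of_mem_vertex {x y : F} (h : y ∈ M.vertex x) :
    M.dual.faceOf (.inl y) = M.dual.faceOf (.inl x) := by
  refine M.mem_vertex_iff.1 h (fun z => M.dual.faceOf (.inl z) = M.dual.faceOf (.inl x)) rfl
    (fun z hz => ?_) fun z hz => ?_
  · rw [← hz, ← dual_cornerFlip_inl, faceOf_cornerFlip]
  · by_cases hb : M.OnBoundary z
    · rw [show M.sideFlip z = z from hb, hz]
    · rw [← M.dual_endFlip_of_not_onBoundary hb, faceOf_endFlip, hz]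

theorem exists_mem_vertex_of_faceOf_dual_eq {x : F} (hx : ∀ y ∈ M.vertex x, ¬M.OnBoundary y)
    {z : F ⊕ M.BdFlag} (hz : M.dual.faceOf z = M.dual.faceOf (.inl x)) :
    ∃ y ∈ M.vertex x, .inl y = z := by
  refine M.dual.mem_face_iff.1 (M.dual.faceOf_eq_faceOf_iff.1 hz)
    (fun z => ∃ y ∈ M.vertex x, .inl y = z) ⟨x, MulAction.mem_orbit_self x, rfl⟩ ?_ ?_
  · rintro _ ⟨y, hy, rfl⟩
    refine ⟨M.sideFlip y, ?_, (M.dual_endFlip_of_not_onBoundary (hx y hy)).symm⟩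
    rwa [← vertex_eq_vertex_iff, vertex_sideFlip, vertex_eq_vertex_iff]
  · rintro _ ⟨y, hy, rfl⟩
    refine ⟨M.cornerFlip y, ?_, rfl⟩
    rwa [← vertex_eq_vertex_iff, vertex_cornerFlip, vertex_eq_vertex_iff]

theorem faceOf_dual_undual (z : F ⊕ M.BdFlag) :
    M.dual.faceOf (.inl (M.undual z)) = M.dual.faceOf z := by
  rcases z with x | b
  exacts [rfl, (M.faceOf_dual_inr b).symm]

theorem IsMonogonFree.forall_not_isLeafless_dual_iff (hM : M.IsMonogonFree) :
    (∀ f, ¬M.dual.IsLeafless f) ↔ M.AllVerticesOnBoundary := by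
  constructor
  · intro h x
    by_contra! hx
    refine h (M.dual.faceOf (.inl x)) fun z hz => ?_
    obtain ⟨y, -, rfl⟩ := M.exists_mem_vertex_of_faceOf_dual_eq hx hz
    exact hM.not_isLeaf_dual_inl y
  · refine fun h => M.dual.faceOf_surjective.forall.2 fun z hz => ?_
    obtain ⟨y, hy, hb⟩ := h (M.undual z)
    refine hz (.inr ⟨y, hb⟩) ?_ (M.isLeaf_dual_inr _)
    rw [faceOf_dual_inr, M.faceOf_dual_eq_of_mem_vertex hy, faceOf_dual_undual]

theorem edge_bdFlag (b : M.BdFlag) : M.edge b = {(b : F), (M.bdFlip b : F)} := by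
  rw [edge_eq, edgeEnd, show M.sideFlip b = b from b.2, Set.pair_eq_singleton, Set.image_singleton]
  rfl

/-- The relation on the flags of the boundary whose classes `CombMap.numBoundaries` counts. -/
def SameEdgeOrVertex (b b' : M.BdFlag) : Prop := (b' : F) ∈ M.edge b ∨ (b' : F) ∈ M.vertex b

theorem SameEdgeOrVertex.faceOf_dual_eq {b b' : M.BdFlag} (h : M.SameEdgeOrVertex b b') :
    M.dual.faceOf (.inr b) = M.dual.faceOf (.inr b') := by
  rcases h with h | h
  · rw [edge_bdFlag] at h
    rcases h with h | h <;> rw [Subtype.ext h]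
    exact (M.dual.faceOf_cornerFlip (.inr b)).symm
  · rw [faceOf_dual_inr, faceOf_dual_inr, M.faceOf_dual_eq_of_mem_vertex h]

theorem mk_sameEdgeOrVertex_eq {b : M.BdFlag} {z : F ⊕ M.BdFlag} (hz : z ∈ M.dual.face (.inr b)) :
    ∀ b' : M.BdFlag, M.vertex b' = M.vertex (M.undual z) →
      Quot.mk M.SameEdgeOrVertex b = Quot.mk _ b' := by
  have mk_eq_of_vertex_eq {b b' : M.BdFlag} (h : M.vertex b' = M.vertex b) :
      Quot.mk M.SameEdgeOrVertex b = Quot.mk _ b' :=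
    Quot.sound (.inr (vertex_eq_vertex_iff.1 h))
  refine M.dual.mem_face_iff.1 hz (fun z => ∀ b' : M.BdFlag, M.vertex b' = M.vertex (M.undual z) →
    Quot.mk M.SameEdgeOrVertex b = Quot.mk _ b') (fun b' => mk_eq_of_vertex_eq)
    (fun z hz b' hb' => ?_) ?_
  · rw [undual_dual_endFlip, vertex_sideFlip] at hb'
    exact hz b' hb'
  · rintro (x | b₁) hz b' hb'
    · exact hz b' (hb'.trans (M.vertex_cornerFlip x))
    · have mk_bdFlip : Quot.mk M.SameEdgeOrVertex b₁ = Quot.mk _ (M.bdFlip b₁) :=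
        Quot.sound (.inl (by simp [edge_bdFlag]))
      exact ((hz b₁ rfl).trans mk_bdFlip).trans (mk_eq_of_vertex_eq hb')

theorem numBoundaries_eq_card_face_dual (h : M.AllVerticesOnBoundary) :
    M.numBoundaries = Nat.card M.dual.Face := by
  refine Nat.card_congr (Equiv.ofBijective (Quot.lift (r := M.SameEdgeOrVertex)
    (fun b => M.dual.faceOf (.inr b)) fun _ _ => SameEdgeOrVertex.faceOf_dual_eq) ⟨?_, ?_⟩)
  · refine Quot.ind fun b => Quot.ind fun b' hb => ?_
    exact M.mk_sameEdgeOrVertex_eq (M.dual.faceOf_eq_faceOf_iff.1 hb.symm) b' rfl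
  · refine M.dual.faceOf_surjective.forall.2 fun z => ?_
    obtain ⟨y, hy, hb⟩ := h (M.undual z)
    refine ⟨Quot.mk _ ⟨y, hb⟩, ?_⟩
    change M.dual.faceOf (.inr ⟨y, hb⟩) = M.dual.faceOf z
    rw [faceOf_dual_inr, M.faceOf_dual_eq_of_mem_vertex hy, faceOf_dual_undual]

end IsMonogonFree

section EulerChar

variable {M} [Finite F]

theorem AllVerticesOnBoundary.card_bdFlag (h : M.AllVerticesOnBoundary) :
    Nat.card M.BdFlag = 2 * M.numVertices := by
  have := Fintype.ofFinite M.BdFlag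
  have range_vertex : (Set.range fun b : M.BdFlag => M.vertex b) = Set.range M.vertex := by
    refine Set.Subset.antisymm (Set.range_comp_subset_range _ M.vertex) ?_
    rintro _ ⟨x, rfl⟩
    obtain ⟨y, hy, hb⟩ := h x
    exact ⟨⟨y, hb⟩, vertex_eq_vertex_iff.2 hy⟩
  have ncard_bdFlag (b : M.BdFlag) : {b' : M.BdFlag | M.vertex b' = M.vertex b}.ncard = 2 := by
    rw [← ncard_fixed_orbit_closure_pair M.cornerFlip_involutive M.sideFlip_involutive
      M.cornerFlip_ne b.2, ← Set.ncard_image_of_injective _ Subtype.val_injective]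
    congr 1
    ext y
    constructor
    · rintro ⟨b', hb', rfl⟩
      exact ⟨vertex_eq_vertex_iff.1 hb', b'.2⟩
    · rintro ⟨hy, hb⟩
      exact ⟨⟨y, hb⟩, vertex_eq_vertex_iff.2 hy, rfl⟩
  have sum_eq := ncard_range_eq_sum fun b : M.BdFlag => M.vertex b
  simp only [ncard_bdFlag, range_vertex, Finset.sum_const, Finset.card_univ, nsmul_eq_mul,
    ← Nat.card_eq_fintype_card] at sum_eq
  rw [← Nat.cast_inj (R := ℚ), Nat.cast_mul, numVertices, sum_eq]
  push_cast
  ring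

theorem IsTriangular.six_mul_numFaces (h : M.IsTriangular) : 6 * M.numFaces = Nat.card F := by
  have ncard_face (x : F) : 6 = (M.face x).ncard := by
    rw [face, Set.pair_comm, ncard_orbit_closure_pair M.cornerFlip_involutive M.endFlip_involutive
      M.cornerFlip_ne M.endFlip_ne, ← faceDegree_eq, h x]
  have := mul_ncard_range_orbit (P := fun _ => False) (c := 0) (by norm_num)
    (fun _ => False.elim) fun x _ => ncard_face x
  rwa [zero_mul, add_zero] at this

theorem IsTriangular.twelve_mul_eulerChar (h : M.IsTriangular) (hv : M.AllVerticesOnBoundary) :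
    12 * M.eulerChar = 6 * M.numVertices - Nat.card F := by
  have hE := M.four_mul_numEdges
  have hF := h.six_mul_numFaces
  have hV := hv.card_bdFlag
  rw [eulerChar]
  lia

theorem isTriangularMap_iff_dual {S : Surface} {n : ℕ} (r : M.BdFlag) :
    (M.IsMapOn S ∧ M.IsTriangular ∧ M.AllVerticesOnBoundary ∧ M.numVertices = n) ↔
      M.dual.IsLeafyCubic S n (.inr r) ∧ (∀ f, ¬M.dual.IsLeafless f) ∧ M.IsMonogonFree := by
  have card_flag : Nat.card (F ⊕ M.BdFlag) = Nat.card F + Nat.card M.BdFlag := Nat.card_sum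
  constructor
  · rintro ⟨⟨connected, eulerChar_eq, numBoundaries_eq, orientable⟩, ht, hv, rfl⟩
    obtain ⟨subcubic, hM⟩ := M.isTriangular_iff.1 ht
    have card_bdFlag := hv.card_bdFlag
    have := ht.twelve_mul_eulerChar hv
    exact
      ⟨{ boundaryless := M.isBoundaryless_dual
         connected := M.isConnected_dual_iff.2 connected
         subcubic
         root := M.isLeaf_dual_inr r
         card_leaf := hM.card_isLeaf_dual.trans card_bdFlag
         card_flag := by lia
         card_face := (M.numBoundaries_eq_card_face_dual hv).symm.trans numBoundaries_eq
         orientable := M.isOrientable_dual_iff.trans orientable },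
        hM.forall_not_isLeafless_dual_iff.2 hv, hM⟩
  · rintro ⟨h, hf, hM⟩
    have hv := hM.forall_not_isLeafless_dual_iff.1 hf
    have ht := M.isTriangular_iff.2 ⟨h.subcubic, hM⟩
    have numVertices_eq : M.numVertices = n := by
      have := hM.card_isLeaf_dual
      have := h.card_leaf
      have := hv.card_bdFlag
      lia
    have eulerChar_eq : M.eulerChar = S.eulerChar := by
      have := ht.twelve_mul_eulerChar hv
      have := hv.card_bdFlag
      have := h.card_flag
      lia
    exact ⟨⟨M.isConnected_dual_iff.1 h.connected, eulerChar_eq,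
      (M.numBoundaries_eq_card_face_dual hv).trans h.card_face,
      M.isOrientable_dual_iff.symm.trans h.orientable⟩, ht, hv, numVertices_eq⟩

end EulerChar

variable {F F' : Type*}

section DualIso

variable {M : CombMap F} {M' : CombMap F'}

theorem IsHom.onBoundary_iff {f : F → F'} (h : M.IsHom M' f) (hinj : Function.Injective f)
    (x : F) : M'.OnBoundary (f x) ↔ M.OnBoundary x := by
  rw [OnBoundary, OnBoundary, ← h.map_sideFlip, hinj.eq_iff]

/-- The action of an isomorphism on the flags of the dual map. -/
def IsHom.dualEquiv {φ : F ≃ F'} (h : M.IsHom M' φ) : F ⊕ M.BdFlag ≃ F' ⊕ M'.BdFlag :=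
  Equiv.sumCongr φ (φ.subtypeEquiv fun x => (h.onBoundary_iff φ.injective x).symm)

theorem IsHom.isHom_dualEquiv {φ : F ≃ F'} (h : M.IsHom M' φ) :
    M.dual.IsHom M'.dual h.dualEquiv where
  map_endFlip := by
    rintro (x | b)
    · by_cases hx : M.OnBoundary x
      · rw [M.dual_endFlip_coe ⟨x, hx⟩]
        exact (M'.dual_endFlip_coe ⟨φ x, (h.onBoundary_iff φ.injective x).2 hx⟩).symm
      · rw [M.dual_endFlip_of_not_onBoundary hx]
        exact (congrArg Sum.inl (h.map_sideFlip x)).trans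
          (M'.dual_endFlip_of_not_onBoundary (mt (h.onBoundary_iff φ.injective x).1 hx)).symm
    · rfl
  map_cornerFlip := by
    rintro (x | b)
    · exact congrArg Sum.inl (h.map_cornerFlip x)
    · exact congrArg Sum.inr (Subtype.ext (h.map_endFlip b))
  map_sideFlip := by
    rintro (x | b)
    · exact congrArg Sum.inl (h.map_endFlip x)
    · exact congrArg Sum.inr (Subtype.ext (h.map_endFlip b))

theorem IsMonogonFree.isLeaf_dual_iff (hM : M.IsMonogonFree) {z : F ⊕ M.BdFlag} :
    M.dual.IsLeaf z ↔ z.isRight := by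
  rcases z with x | b
  · simpa using hM.not_isLeaf_dual_inl x
  · simpa using M.isLeaf_dual_inr b

theorem IsHom.of_dual {Φ : F ⊕ M.BdFlag ≃ F' ⊕ M'.BdFlag} (h : M.dual.IsHom M'.dual Φ)
    (hM : M.IsMonogonFree) (hM' : M'.IsMonogonFree) :
    ∃ φ : F ≃ F', M.IsHom M' φ ∧ ∀ z, M'.undual (Φ z) = φ (M.undual z) := by
  have isRight_iff (z : F ⊕ M.BdFlag) : (Φ z).isRight ↔ z.isRight := by
    rw [← hM'.isLeaf_dual_iff, h.isLeaf_iff Φ.injective, hM.isLeaf_dual_iff]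
  obtain ⟨φ, hφ⟩ := exists_forall_apply_inl_eq isRight_iff
  have undual_apply (z : F ⊕ M.BdFlag) : M'.undual (Φ z) = φ (M.undual z) := by
    rcases z with x | b
    · rw [hφ]
      rfl
    · obtain ⟨b', hb'⟩ := Sum.isRight_iff.1 ((isRight_iff (.inr b)).2 rfl)
      have hb := h.map_endFlip (.inr b)
      rw [hb', dual_endFlip_inr, dual_endFlip_inr, hφ] at hb
      rw [hb']
      exact (Sum.inl_injective hb).symm
  refine ⟨φ, ⟨fun x => ?_, fun x => ?_, fun x => ?_⟩, undual_apply⟩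
  · have hx := h.map_sideFlip (.inl x)
    rw [hφ, dual_sideFlip_inl, dual_sideFlip_inl, hφ] at hx
    exact Sum.inl_injective hx
  · have hx := h.map_cornerFlip (.inl x)
    rw [hφ, dual_cornerFlip_inl, dual_cornerFlip_inl, hφ] at hx
    exact Sum.inl_injective hx
  · calc φ (M.sideFlip x) = φ (M.undual (M.dual.endFlip (.inl x))) := by
          rw [undual_dual_endFlip]
          rfl
      _ = M'.sideFlip (φ x) := by
          rw [← undual_apply, h.map_endFlip, undual_dual_endFlip, undual_apply]
          rfl

theorem pointedIso_dual_iff {r : M.BdFlag} {r' : M'.BdFlag} (hM : M.IsMonogonFree)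
    (hM' : M'.IsMonogonFree) :
    M.dual.PointedIso (.inr r) M'.dual (.inr r') ↔ M.PointedIso r M' r' := by
  constructor
  · rintro ⟨Φ, hΦ, hr⟩
    obtain ⟨φ, hφ, undual_apply⟩ := hΦ.of_dual hM hM'
    exact ⟨φ, hφ, (undual_apply (.inr r)).symm.trans (congrArg M'.undual hr)⟩
  · rintro ⟨φ, hφ, hr⟩
    exact ⟨hφ.dualEquiv, hφ.isHom_dualEquiv, congrArg Sum.inr (Subtype.ext hr)⟩

end DualIso

section Predual

variable (M : CombMap F)

theorem isLeaf_sideFlip_iff {x : F} : M.IsLeaf (M.sideFlip x) ↔ M.IsLeaf x :=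
  ⟨fun h => M.sideFlip_sideFlip x ▸ h.sideFlip, IsLeaf.sideFlip⟩

theorem isLeaf_cornerFlip_iff {x : F} : M.IsLeaf (M.cornerFlip x) ↔ M.IsLeaf x := by
  rw [IsLeaf, IsLeaf, M.cornerFlip_cornerFlip, ← M.sideFlip.apply_eq_iff_eq, M.sideFlip_sideFlip,
    eq_comm]

open Classical in
/-- The side flip of the predual map: the edges of `M` that end in a leaf become boundary edges. -/
noncomputable def predualSide (x : {x // ¬M.IsLeaf x}) : {x // ¬M.IsLeaf x} :=
  if h : M.IsLeaf (M.endFlip x) then x else ⟨M.endFlip x, h⟩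

variable {M} in
theorem predualSide_of_isLeaf {x : {x // ¬M.IsLeaf x}} (h : M.IsLeaf (M.endFlip x)) :
    M.predualSide x = x := dif_pos h

variable {M} in
theorem predualSide_of_not_isLeaf {x : {x // ¬M.IsLeaf x}} (h : ¬M.IsLeaf (M.endFlip x)) :
    M.predualSide x = ⟨M.endFlip x, h⟩ := dif_neg h

theorem predualSide_involutive : Function.Involutive M.predualSide := by
  intro x
  by_cases h : M.IsLeaf (M.endFlip x)
  · rw [predualSide_of_isLeaf h, predualSide_of_isLeaf h]
  · rw [predualSide_of_not_isLeaf h, predualSide_of_not_isLeaf] <;> simp [M.endFlip_endFlip, x.2]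

theorem predualSide_eq_self_iff {x : {x // ¬M.IsLeaf x}} :
    M.predualSide x = x ↔ M.IsLeaf (M.endFlip x) := by
  refine ⟨fun hx => ?_, predualSide_of_isLeaf⟩
  by_contra h
  rw [predualSide_of_not_isLeaf h] at hx
  exact M.endFlip_ne x (congrArg Subtype.val hx)

/-- The map whose dual is `M`: a vertex for each face of `M`, a face for each vertex that is not a
leaf, and a boundary edge for each edge that ends in a leaf. -/
noncomputable def predual (hM : M.IsBoundaryless) : CombMap {x // ¬M.IsLeaf x} where
  endFlip := M.sideFlip.subtypePerm fun _ => not_congr M.isLeaf_sideFlip_iff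
  cornerFlip := M.cornerFlip.subtypePerm fun _ => not_congr M.isLeaf_cornerFlip_iff
  sideFlip := M.predualSide_involutive.toPerm
  endFlip_endFlip x := Subtype.ext (M.sideFlip_sideFlip x)
  cornerFlip_cornerFlip x := Subtype.ext (M.cornerFlip_cornerFlip x)
  sideFlip_sideFlip := M.predualSide_involutive
  endFlip_sideFlip x := by
    have isLeaf_iff : M.IsLeaf (M.endFlip (M.sideFlip x)) ↔ M.IsLeaf (M.endFlip x) := by
      rw [M.endFlip_sideFlip, isLeaf_sideFlip_iff]
    by_cases h : M.IsLeaf (M.endFlip x)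
    · simp [predualSide_of_isLeaf h, predualSide_of_isLeaf, isLeaf_iff.2 h]
    · refine Eq.trans ?_ (predualSide_of_not_isLeaf (mt isLeaf_iff.1 h)).symm
      simp [predualSide_of_not_isLeaf h, M.endFlip_sideFlip]
  endFlip_ne x h := hM x (congrArg Subtype.val h)
  cornerFlip_ne x h := M.cornerFlip_ne x (congrArg Subtype.val h)
  endFlip_ne_sideFlip x hx := by
    change (⟨M.sideFlip x, _⟩ : {x // ¬M.IsLeaf x}) = M.predualSide x at hx
    by_cases h : M.IsLeaf (M.endFlip x)
    · rw [predualSide_of_isLeaf h] at hx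
      exact hM x (congrArg Subtype.val hx)
    · rw [predualSide_of_not_isLeaf h] at hx
      exact M.endFlip_ne_sideFlip x (congrArg Subtype.val hx).symm

variable {M} (hM : M.IsBoundaryless)

theorem onBoundary_predual_iff {x : {x // ¬M.IsLeaf x}} :
    (M.predual hM).OnBoundary x ↔ M.IsLeaf (M.endFlip x) := M.predualSide_eq_self_iff

theorem isMonogonFree_predual : (M.predual hM).IsMonogonFree :=
  fun x h => x.2 (congrArg Subtype.val h)

/-- The map from the flags of the dual of the predual map to those of the original map. -/
def ofDualPredual : {x // ¬M.IsLeaf x} ⊕ (M.predual hM).BdFlag → F :=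
  Sum.elim Subtype.val fun b => M.endFlip b

theorem bijective_ofDualPredual (hl : ∀ x, M.IsLeaf x → ¬M.IsLeaf (M.endFlip x)) :
    Function.Bijective (ofDualPredual hM) := by
  refine ⟨Subtype.val_injective.sumElim (fun b b' h => ?_) fun x b h => ?_, fun z => ?_⟩
  · exact Subtype.ext (Subtype.ext (M.endFlip.injective h))
  · exact x.2 (h ▸ (onBoundary_predual_iff hM).1 b.2)
  · by_cases hz : M.IsLeaf z
    · refine ⟨.inr ⟨⟨M.endFlip z, hl z hz⟩, (onBoundary_predual_iff hM).2 ?_⟩, M.endFlip_endFlip z⟩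
      rwa [M.endFlip_endFlip]
    · exact ⟨.inl ⟨z, hz⟩, rfl⟩

theorem isHom_ofDualPredual : (M.predual hM).dual.IsHom M (ofDualPredual hM) where
  map_endFlip := by
    rintro (x | b)
    · by_cases hx : (M.predual hM).OnBoundary x
      · rw [(M.predual hM).dual_endFlip_coe ⟨x, hx⟩]
        rfl
      · rw [(M.predual hM).dual_endFlip_of_not_onBoundary hx]
        exact congrArg Subtype.val
          (predualSide_of_not_isLeaf (mt (onBoundary_predual_iff hM).2 hx))
    · exact (M.endFlip_endFlip _).symm
  map_cornerFlip := by
    rintro (x | b)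
    · rfl
    · exact (M.endFlip_sideFlip _).trans ((onBoundary_predual_iff hM).1 b.2).symm
  map_sideFlip := by
    rintro (x | b)
    · rfl
    · exact M.endFlip_sideFlip _

theorem exists_pointedIso_dual_predual {r : F} (hl : ∀ x, M.IsLeaf x → ¬M.IsLeaf (M.endFlip x))
    (hr : M.IsLeaf r) : ∃ r₀, (M.predual hM).dual.PointedIso (.inr r₀) M r := by
  have hr₀ : (M.predual hM).OnBoundary ⟨M.endFlip r, hl r hr⟩ :=
    (onBoundary_predual_iff hM).2 (by rwa [M.endFlip_endFlip])
  exact ⟨⟨_, hr₀⟩, Equiv.ofBijective _ (bijective_ofDualPredual hM hl), isHom_ofDualPredual hM,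
    M.endFlip_endFlip r⟩

end Predual

end CombMap

namespace RootedMap

open CombMap

variable {P Q : RootedMap → Prop}

theorem nonempty_classes_equiv (D : RootedMap → RootedMap → Prop)
    (left_total : ∀ R, P R → ∃ R', Q R' ∧ D R R') (right_total : ∀ R', Q R' → ∃ R, P R ∧ D R R')
    (mk_eq_mk_iff : ∀ {R₁ R₂ R₁' R₂'}, P R₁ → P R₂ → D R₁ R₁' → D R₂ R₂' →
      ((⟦R₁⟧ : Quotient RootedMap.setoid) = ⟦R₂⟧ ↔
        (⟦R₁'⟧ : Quotient RootedMap.setoid) = ⟦R₂'⟧)) :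
    Nonempty (classes P ≃ classes Q) := by
  have exists_image (q : classes P) :
      ∃ (q' : classes Q) (R R' : RootedMap), ⟦R⟧ = q.1 ∧ ⟦R'⟧ = q'.1 ∧ P R ∧ D R R' := by
    obtain ⟨_, R, rfl, hR⟩ := q
    obtain ⟨R', hR', hD⟩ := left_total R hR
    exact ⟨⟨_, R', rfl, hR'⟩, R, R', rfl, rfl, hR, hD⟩
  choose f R R' mk_R mk_R' hR hD using exists_image
  refine ⟨Equiv.ofBijective f ⟨fun q₁ q₂ hq => Subtype.ext ?_, ?_⟩⟩
  · rw [← mk_R, ← mk_R, mk_eq_mk_iff (hR q₁) (hR q₂) (hD q₁) (hD q₂), mk_R', mk_R', hq]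
  · rintro ⟨_, R₀', rfl, hR₀'⟩
    obtain ⟨R₀, hR₀, hD₀⟩ := right_total R₀' hR₀'
    refine ⟨⟨_, R₀, rfl, hR₀⟩, Subtype.ext ?_⟩
    rw [← mk_R', ← mk_eq_mk_iff (hR _) hR₀ (hD _) hD₀, mk_R]

/-- The rooted map `R'` is the dual of `R`, rooted at the leaf across the root-edge of `R`. -/
def IsDual (R R' : RootedMap) : Prop :=
  ∃ h : R.IsBoundaryRooted, R.toMap.dual.PointedIso (.inr ⟨R.root, h⟩) R'.toMap R'.root

theorem IsDual.mk_eq_mk_iff {R₁ R₂ R₁' R₂' : RootedMap} (hR₁ : R₁.toMap.IsMonogonFree)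
    (hR₂ : R₂.toMap.IsMonogonFree) (h₁ : R₁.IsDual R₁') (h₂ : R₂.IsDual R₂') :
    (⟦R₁⟧ : Quotient RootedMap.setoid) = ⟦R₂⟧ ↔
      (⟦R₁'⟧ : Quotient RootedMap.setoid) = ⟦R₂'⟧ := by
  obtain ⟨hb₁, h₁⟩ := h₁
  obtain ⟨hb₂, h₂⟩ := h₂
  rw [RootedMap.mk_eq_mk_iff, RootedMap.mk_eq_mk_iff,
    ← pointedIso_dual_iff (r := ⟨R₁.root, hb₁⟩) (r' := ⟨R₂.root, hb₂⟩) hR₁ hR₂]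
  exact ⟨fun h => h₁.symm.trans (h.trans h₂), fun h => h₁.trans (h.trans h₂.symm)⟩

theorem exists_isDual_of_isBoundaryRooted {R : RootedMap} (h : R.IsBoundaryRooted) :
    ∃ R', R.IsDual R' :=
  ⟨_, h, pointedIso_ofMap _ _⟩

theorem exists_isMonogonFree_isDual {R' : RootedMap} (hR' : R'.toMap.IsBoundaryless)
    (hl : ∀ x, R'.toMap.IsLeaf x → ¬R'.toMap.IsLeaf (R'.toMap.endFlip x))
    (hr : R'.toMap.IsLeaf R'.root) :
    ∃ R : RootedMap, R.toMap.IsMonogonFree ∧ R.IsDual R' := by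
  obtain ⟨r, hiso⟩ := exists_pointedIso_dual_predual hR' hl hr
  obtain ⟨φ, hφ, hφr⟩ := pointedIso_ofMap (R'.toMap.predual hR') r
  have boundaryRooted : (ofMap (R'.toMap.predual hR') r).IsBoundaryRooted := by
    rw [IsBoundaryRooted, ← hφr]
    exact (hφ.onBoundary_iff φ.injective _).2 r.2
  refine ⟨ofMap (R'.toMap.predual hR') r, ?_, boundaryRooted, ?_⟩
  · refine φ.surjective.forall.2 fun x hx => isMonogonFree_predual hR' x (φ.injective ?_)
    rw [hφ.map_cornerFlip, hφ.map_endFlip, hx]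
  · exact PointedIso.trans (.symm ⟨hφ.dualEquiv, hφ.isHom_dualEquiv,
      congrArg Sum.inr (Subtype.ext hφr)⟩) hiso

end RootedMap

section Count

open CombMap RootedMap

variable {S : Surface}

/-- The isomorphism classes of the maps of `CombMap.IsLeafyCubic S n` all of whose faces have a
leaf. -/
def fullLeafyClasses (S : Surface) (n : ℕ) : Set (Quotient RootedMap.setoid) :=
  classes fun R => R.toMap.IsLeafyCubic S n R.root ∧ ∀ f, ¬R.toMap.IsLeafless f

theorem fullLeafyClasses_subset (S : Surface) (n : ℕ) : fullLeafyClasses S n ⊆ leafyClasses S n :=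
  fun _ ⟨R, hR, h⟩ => ⟨R, hR, h.1⟩

theorem RootedMap.IsDual.isTriangularMap_iff {R R' : RootedMap} {n : ℕ} (h : R.IsDual R') :
    (R.toMap.IsMapOn S ∧ R.IsBoundaryRooted ∧ R.toMap.IsTriangular ∧
      R.toMap.AllVerticesOnBoundary ∧ R.toMap.numVertices = n) ↔
      (R'.toMap.IsLeafyCubic S n R'.root ∧ ∀ f, ¬R'.toMap.IsLeafless f) ∧
        R.toMap.IsMonogonFree := by
  obtain ⟨hb, hiso⟩ := h
  have isLeafyCubic_iff : R.toMap.dual.IsLeafyCubic S n (.inr ⟨R.root, hb⟩) ↔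
      R'.toMap.IsLeafyCubic S n R'.root :=
    ⟨fun h => h.of_pointedIso hiso, fun h => h.of_pointedIso hiso.symm⟩
  obtain ⟨Φ, hΦ, -⟩ := hiso
  have isLeafless_iff : (∀ f, ¬R.toMap.dual.IsLeafless f) ↔ ∀ f, ¬R'.toMap.IsLeafless f :=
    hΦ.faceEquiv.forall_congr fun {f} => not_congr hΦ.isLeafless_iff.symm
  rw [← isLeafyCubic_iff, ← isLeafless_iff, and_assoc,
    ← R.toMap.isTriangularMap_iff_dual ⟨R.root, hb⟩]
  simp only [hb, true_and]

theorem nonempty_triangularMaps_equiv (hS : S.eulerChar ≤ 0) (n : ℕ) :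
    Nonempty (triangularMaps S n ≃ fullLeafyClasses S n) := by
  refine nonempty_classes_equiv IsDual (fun R hR => ?_) (fun R' hR' => ?_)
    fun hR₁ hR₂ h₁ h₂ => IsDual.mk_eq_mk_iff (h₁.isTriangularMap_iff.1 hR₁).2
      (h₂.isTriangularMap_iff.1 hR₂).2 h₁ h₂
  · obtain ⟨R', hD⟩ := exists_isDual_of_isBoundaryRooted hR.2.1
    exact ⟨R', (hD.isTriangularMap_iff.1 hR).1, hD⟩
  · obtain ⟨R, hM, hD⟩ := exists_isMonogonFree_isDual hR'.1.boundaryless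
      (fun _ => hR'.1.not_isLeaf_endFlip hS) hR'.1.root
    exact ⟨R, hD.isTriangularMap_iff.2 ⟨hR', hM⟩, hD⟩

theorem triangularMaps_finite (hS : S.eulerChar ≤ 0) (n : ℕ) : (triangularMaps S n).Finite := by
  obtain ⟨e⟩ := nonempty_triangularMaps_equiv hS n
  have := ((leafyClasses_finite S n).subset (fullLeafyClasses_subset S n)).to_subtype
  exact Finite.of_equiv _ e.symm

theorem ncard_triangularMaps (hS : S.eulerChar ≤ 0) (n : ℕ) :
    (triangularMaps S n).ncard = (fullLeafyClasses S n).ncard :=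
  Nat.card_congr (nonempty_triangularMaps_equiv hS n).some

theorem ncard_leafyClasses (S : Surface) (n : ℕ) :
    (leafyClasses S n).ncard = Fintype.card (leafyClasses S n) :=
  Nat.card_eq_fintype_card

theorem ncard_leafyClasses_sdiff_le (S : Surface) (n : ℕ) :
    ((leafyClasses S n \ fullLeafyClasses S n).ncard : ℝ) ≤ totalWeight S n 1 := by
  classical
  have one_le (q : leafyClasses S n) (hq : q.1 ∉ fullLeafyClasses S n) :
      1 ≤ q.1.out.toMap.leaflessWeight 1 := by
    obtain ⟨f, hf⟩ : ∃ f, q.1.out.toMap.IsLeafless f := by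
      by_contra! h
      exact hq ⟨q.1.out, Quotient.out_eq _, isLeafyCubic_out q, h⟩
    exact one_le_leaflessWeight_one hf
  have ncard_eq : (leafyClasses S n \ fullLeafyClasses S n).ncard =
      (Finset.univ.filter fun q : leafyClasses S n => q.1 ∉ fullLeafyClasses S n).card := by
    rw [← Set.ncard_coe_finset, ← Set.ncard_image_of_injective _ Subtype.val_injective]
    congr 1
    ext q
    simp [and_comm]
  rw [ncard_eq, Finset.card_eq_sum_ones, Nat.cast_sum, totalWeight, Finset.sum_filter]
  refine Finset.sum_le_sum fun q _ => ?_
  split_ifs with hq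
  · exact Finset.sum_nonneg fun _ _ => pow_nonneg zero_le_one _
  · exact_mod_cast one_le q hq

theorem abs_ncard_triangularMaps_sub_le (hS : S.eulerChar ≤ 0) {n : ℕ} (hn : 1 ≤ n) :
    |((triangularMaps S n).ncard : ℝ) - (leafyClasses S n).ncard| ≤
      S.β * (leafyClasses S n).ncard * (2 * √(flagCount S 1) / √n) := by
  have ncard_sdiff := Set.ncard_sdiff_add_ncard_of_subset (fullLeafyClasses_subset S n)
    (leafyClasses_finite S n)
  rw [ncard_triangularMaps hS, ← ncard_sdiff, Nat.cast_add, sub_add_cancel_right, abs_neg,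
    Nat.abs_cast, ← Nat.cast_add, ncard_sdiff, ncard_leafyClasses]
  exact (ncard_leafyClasses_sdiff_le S n).trans (totalWeight_one_le hS hn)

theorem isBigO_ncard_triangularMaps_sub (hS : S.eulerChar ≤ 0) :
    (fun n => ((triangularMaps S n).ncard : ℝ) - (leafyClasses S n).ncard) =O[atTop]
      fun n => ((leafyClasses S n).ncard : ℝ) * (n : ℝ) ^ (-(1 / 2) : ℝ) := by
  refine .of_bound (S.β * (2 * √(flagCount S 1))) ?_
  filter_upwards [eventually_ge_atTop 1] with n hn
  rw [Real.rpow_neg n.cast_nonneg, ← Real.sqrt_eq_rpow, Real.norm_eq_abs,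
    Real.norm_of_nonneg (by positivity)]
  refine (abs_ncard_triangularMaps_sub_le hS hn).trans_eq ?_
  ring

theorem ncard_leafyClasses_succ (hS : S.eulerChar ≤ 0) (n : ℕ) :
    n * ((leafyClasses S (n + 1)).ncard : ℝ) =
      4 * (n + -3 * S.eulerChar / 2) * (leafyClasses S n).ncard := by
  have h := card_leafyClasses_succ hS n
  rw [ncard_leafyClasses, ncard_leafyClasses]
  rw [flagCount] at h
  linear_combination h / 2

theorem Surface.eulerChar_nonpos (hboundary : 1 ≤ S.β) (hdisc : S ≠ Surface.disc) :
    S.eulerChar ≤ 0 := by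
  rcases S with ⟨g | k, β⟩
  · simp only [Surface.eulerChar, ClosedSurface.eulerChar] at hboundary ⊢
    by_contra! h
    obtain ⟨rfl, rfl⟩ : g = 0 ∧ β = 1 := by lia
    exact hdisc rfl
  · have := k.pos
    simp only [Surface.eulerChar, ClosedSurface.eulerChar] at hboundary ⊢
    lia

end Count

theorem mainTheorem4 (S : Surface) (hboundary : 1 ≤ S.β) (hdisc : S ≠ Surface.disc) :
    (cubicSchemes S).Finite ∧ (∀ n : ℕ, (triangularMaps S n).Finite) ∧
    ∃ ε : ℕ → ℝ, ε =O[atTop] (fun n : ℕ => (n : ℝ) ^ (-(1 / 2) : ℝ)) ∧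
      ∀ᶠ n : ℕ in atTop,
        ((triangularMaps S n).ncard : ℝ) =
          ((cubicSchemes S).ncard : ℝ) / (4 * Real.Gamma (1 - 3 * (S.eulerChar : ℝ) / 2)) *
            (n : ℝ) ^ (-3 * (S.eulerChar : ℝ) / 2) * (4 : ℝ) ^ n * (1 + ε n) := by
  have hS := Surface.eulerChar_nonpos hboundary hdisc
  have exponent_nonneg : 0 ≤ -3 * (S.eulerChar : ℝ) / 2 := by
    have : (S.eulerChar : ℝ) ≤ 0 := Int.cast_nonpos.2 hS
    linarith
  rw [cubicSchemes_eq, show 1 - 3 * (S.eulerChar : ℝ) / 2 = 1 + -3 * S.eulerChar / 2 by ring]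
  exact ⟨leafyClasses_finite S 1, triangularMaps_finite hS,
    asymptotics_of_recurrence four_ne_zero exponent_nonneg
      (fun n _ => ncard_leafyClasses_succ hS n) (isBigO_ncard_triangularMaps_sub hS)⟩
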